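/- **Setting.** Let $1\le K\le N$ and $T\ge1$ be integers, $[N]=\{1,\dots,N\}$, let $r_i\in(0,1]$ be known profits, $r_0=0$, and let $v_i\in[0,1]$ ($i\in[N]$) be unknown preference parameters. For $S\subseteq[N]$ and $\bm v\in[0,\infty)^N$ let $F(S,\bm v)$ be the cumulative distribution function of the random profit that equals $r_i$ with probability $v_i/(1+\sum_{j\in S}v_j)$ for $i\in S$, and $r_0=0$ with probability $1/(1+\sum_{j\in S}v_j)$ (no purchase). Let $\mathcal D[0,1]$ be the set of cumulative distribution functions of random variables with values in $[0,1]$, and let the risk criterion be a function $U:\mathcal D[0,1]\to\mathbb R$ such that 1. (quasiconvexity) $U(\lambda F_1+(1-\lambda)F_2)\le\max\{U(F_1),U(F_2)\}$ for all $\lambda\in[0,1]$ and $F_1,F_2\in\mathcal D[0,1]$; 2. (boundedness) $|U(F)|\le\gamma_1$ for all $F\in\mathcal D[0,1]$; 3. (one-sided Lipschitz condition) $U(F(S,\bm v'))-U(F(S,\bm v))\le\frac{\gamma_2}{1+\sum_{i\in S}v_i}\sum_{i\in S}(v_i'-v_i)$ for all $S\subseteq[N]$ and all $\bm v,\bm v'\in[0,\infty)^N$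 with $v_i'\ge v_i$ for all $i$. At each time $t=1,\dots,T$ the decision maker offers $S_t\subseteq[N]$, $|S_t|\le K$, and observes the customer's choice $c_t$, where, given the past, $\Pr(c_t=i)=v_i/(1+\sum_{j\in S_t}v_j)$ for $i\in S_t$ and $\Pr(c_t=0)=1/(1+\sum_{j\in S_t}v_j)$. The regret is $$\mathfrak R_T=T\max_{S\subseteq[N],\,|S|\le K}U(F(S,\bm v))-\mathbb E\Big[\sum_{t=1}^TU(F(S_t,\bm v))\Big].$$ **Algorithm $\mathtt{RiskAwareTS}$.** Time is divided into episodes $\ell=1,2,\dots$; during episode $\ell$ the same assortment $S_\ell$ is offered until a no-purchase is observed (or time $T$ is reached). Before episode $\ell$ let $T_i(\ell)$ be the number of earlier episodes in which product $i$ was offered and $n_i(\ell)$ the number of purchases of $i$ in them. If $T_i(\ell)=0$ for some $i$, then $S_\ell=\{i\}$ for such an $i$. Otherwise draw $\theta^{(1)}_\ell,\dots,\theta^{(K)}_\ell$ i.i.d. from $\mathcal N(0,1)$, independently of the past, put $$\bar v_i^\ell=\frac{n_i(\ell)}{T_i(\ell)},\qquad \hat\sigma_i^\ell=\sqrt{\frac{50\,\bar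 v_i^\ell(\bar v_i^\ell+1)}{T_i(\ell)}}+\frac{75\sqrt{\log(TK)}}{T_i(\ell)},\qquad \tilde v_i^\ell=\max_{1\le j\le K}\big(\bar v_i^\ell+\theta_\ell^{(j)}\hat\sigma_i^\ell\big),$$ and let $S_\ell$ be a smallest maximizer of $U(F(S,\tilde{\bm v}^\ell))$ over the $S\subseteq[N]$ with $|S|\le K$ and $\tilde v_i^\ell\ge0$ for all $i\in S$ (so that $F(S,\tilde{\bm v}^\ell)$ is a distribution function); remaining ties are broken by any rule that makes $S_\ell$ a measurable function of $\tilde{\bm v}^\ell$. **Theorem 2.** The regret of $\mathtt{RiskAwareTS}$ is $\tilde{\mathcal O}(\sqrt{NT})$: there is an absolute constant $p\in\mathbb N$, and for all $\gamma_1,\gamma_2$ a constant $C$ that depends only on $\gamma_1,\gamma_2$, such that for all $N,K,T,\bm r,\bm v,U$ as above $$\mathfrak R_T\le C\sqrt{NT}\,\big(1+\log(NT)\big)^p .$$ -/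

import Mathlib

open MeasureTheory ProbabilityTheory
open scoped NNReal ENNReal

noncomputable section

namespace MNLBandit

/-! ### The multinomial logit model

Products are the elements of `Fin N`. A customer's choice is an element of `Fin (N + 1)`:
`0` is "no purchase" (preference parameter `1`), and `i.succ` is "product `i` is bought". -/

/-- Probability of each choice when assortment `S` is shown to a customer with preferences `v`. -/
def choiceProb {N : ℕ} (S : Finset (Fin N)) (v : Fin N → ℝ≥0) : Fin (N + 1) → ℝ≥0 :=
  Fin.cons (1 / (1 + ∑ j ∈ S, v j)) (fun i => if i ∈ S then v i / (1 + ∑ j ∈ S, v j) else 0)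

theorem sum_choiceProb {N : ℕ} (S : Finset (Fin N)) (v : Fin N → ℝ≥0) :
    ∑ c, choiceProb S v c = 1 := by
  have h : (1 + ∑ j ∈ S, v j) ≠ 0 := by positivity
  rw [Fin.sum_univ_succ]
  simp only [choiceProb, Fin.cons_zero, Fin.cons_succ, Finset.sum_ite_mem, Finset.univ_inter]
  rw [← Finset.sum_div, ← add_div, div_self h]

/-- The multinomial logit distribution of the customer's choice. -/
def choicePMF {N : ℕ} (S : Finset (Fin N)) (v : Fin N → ℝ≥0) : PMF (Fin (N + 1)) :=
  PMF.ofFintype (fun c => (choiceProb S v c : ℝ≥0∞)) (by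
    rw [← ENNReal.ofNNReal_finsetSum, sum_choiceProb, ENNReal.coe_one])

/-- The profit of a choice: `r i` if product `i` is bought, and `0` for no purchase. -/
def profit {N : ℕ} (r : Fin N → ℝ) : Fin (N + 1) → ℝ := Fin.cons 0 r

/-- `F(S, v)`: the cumulative distribution function of the profit made with assortment `S`. -/
def profitCDF {N : ℕ} (r : Fin N → ℝ) (S : Finset (Fin N)) (v : Fin N → ℝ≥0) : ℝ → ℝ :=
  fun x => cdf ((choicePMF S v).toMeasure.map (profit r)) x

/-! ### Risk criteria -/

/-- `𝒟[0,1]`: the cumulative distribution functions of random variables with values in `[0,1]`. -/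
def unitCDFs : Set (ℝ → ℝ) :=
  {F | ∃ μ : Measure ℝ, IsProbabilityMeasure μ ∧ μ (Set.Icc 0 1) = 1 ∧ ∀ x, F x = cdf μ x}

/-- Quasiconvexity of the risk criterion on `𝒟[0,1]`. -/
def QuasiconvexRisk (U : (ℝ → ℝ) → ℝ) : Prop :=
  ∀ lam : ℝ, 0 ≤ lam → lam ≤ 1 → ∀ F₁ ∈ unitCDFs, ∀ F₂ ∈ unitCDFs,
    U (lam • F₁ + (1 - lam) • F₂) ≤ max (U F₁) (U F₂)

/-- Boundedness of the risk criterion on `𝒟[0,1]`. -/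
def BoundedRisk (U : (ℝ → ℝ) → ℝ) (γ₁ : ℝ) : Prop := ∀ F ∈ unitCDFs, |U F| ≤ γ₁

/-- The one-sided Lipschitz condition. -/
def OneSidedLipschitzRisk {N : ℕ} (U : (ℝ → ℝ) → ℝ) (r : Fin N → ℝ) (γ₂ : ℝ) : Prop :=
  ∀ v v' : Fin N → ℝ≥0, (∀ i, v i ≤ v' i) → ∀ S : Finset (Fin N),
    U (profitCDF r S v') - U (profitCDF r S v) ≤
      γ₂ / (1 + ∑ i ∈ S, (v i : ℝ)) * ∑ i ∈ S, ((v' i : ℝ) - (v i : ℝ))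

/-! ### Optimal assortments -/

/-- The value of the best assortment with at most `K` products under the preferences `v`. -/
def optimalValue {N : ℕ} (U : (ℝ → ℝ) → ℝ) (r : Fin N → ℝ) (K : ℕ) (v : Fin N → ℝ≥0) : ℝ :=
  (Finset.univ.filter fun S : Finset (Fin N) => S.card ≤ K).sup' ⟨∅, by simp⟩
    (fun S => U (profitCDF r S v))

/-- `S` has at most `K` products, and `w` is nonnegative on `S`, so that `F(S, w)` is a
cumulative distribution function. -/
def IsAdmissible {N : ℕ} (K : ℕ) (w : Fin N → ℝ) (S : Finset (Fin N)) : Prop :=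
  S.card ≤ K ∧ ∀ i ∈ S, 0 ≤ w i

/-- `S` maximizes `U (F(S, w))` among the admissible assortments. (`Real.toNNReal` only changes
the type of the coordinates in an admissible `S`; the others do not enter `F(S, w)`.) -/
def IsOptimal {N : ℕ} (U : (ℝ → ℝ) → ℝ) (r : Fin N → ℝ) (K : ℕ) (w : Fin N → ℝ)
    (S : Finset (Fin N)) : Prop :=
  IsAdmissible K w S ∧ ∀ S', IsAdmissible K w S' →
    U (profitCDF r S' fun i => (w i).toNNReal) ≤ U (profitCDF r S fun i => (w i).toNNReal)

/-- `S` is a smallest one among the maximizers. -/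
def IsSmallestOptimal {N : ℕ} (U : (ℝ → ℝ) → ℝ) (r : Fin N → ℝ) (K : ℕ) (w : Fin N → ℝ)
    (S : Finset (Fin N)) : Prop :=
  IsOptimal U r K w S ∧ ∀ S', IsOptimal U r K w S' → S.card ≤ S'.card

/-! ### The Thompson sampling algorithm with correlated Gaussian samples -/

/-- `v̄ᵢ`: average number of purchases of the product per completed episode that offered it. -/
def meanEst (Ti ni : ℕ) : ℝ := (ni : ℝ) / (Ti : ℝ)

/-- `σ̂ᵢ`, for the horizon `T` and the capacity `K`. -/
def sigmaHat (K T : ℕ) (Ti ni : ℕ) : ℝ :=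
  √(50 * meanEst Ti ni * (meanEst Ti ni + 1) / (Ti : ℝ)) +
    75 * √(Real.log ((T : ℝ) * (K : ℝ))) / (Ti : ℝ)

/-- The virtual preference `ṽᵢ = max_j (v̄ᵢ + θ^{(j)} σ̂ᵢ)`; the same samples `θ^{(1)}, …, θ^{(K)}`
serve all the products. -/
def virtualPref {N : ℕ} (K T : ℕ) (served bought : Fin N → ℕ) (θ : Fin K → ℝ) : Fin N → ℝ :=
  fun i => ⨆ j : Fin K, (meanEst (served i) (bought i) + θ j * sigmaHat K T (served i) (bought i))

/-- What the algorithm remembers during an episode. -/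
structure TSState (N : ℕ) where
  /-- the number of the current episode (starting from `0`) -/
  episode : ℕ
  /-- `T_i`: the number of completed episodes in which product `i` was offered -/
  served : Fin N → ℕ
  /-- `n_i`: the number of purchases of product `i` in these episodes -/
  bought : Fin N → ℕ
  /-- the number of purchases of product `i` so far in the current episode -/
  current : Fin N → ℕ
  /-- the assortment offered throughout the current episode -/
  assortment : Finset (Fin N)

/-- The assortment for a new episode: a not yet offered product alone (chosen by `pick`) if there
is one, and otherwise an optimal assortment (chosen by `sel`) for the virtual preferences. -/
def tsSelect {N : ℕ} (K T : ℕ) (pick : Finset (Fin N) → Fin N)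
    (sel : (Fin N → ℝ) → Finset (Fin N)) (served bought : Fin N → ℕ) (θ : Fin K → ℝ) :
    Finset (Fin N) :=
  if ∃ i, served i = 0 then {pick (Finset.univ.filter fun i => served i = 0)}
  else sel (virtualPref K T served bought θ)

/-- The state at the first time step. -/
def tsInit {N : ℕ} (K T : ℕ) (pick : Finset (Fin N) → Fin N)
    (sel : (Fin N → ℝ) → Finset (Fin N)) (θ : ℕ × Fin K → ℝ) : TSState N where
  episode := 0
  served := fun _ => 0
  bought := fun _ => 0
  current := fun _ => 0
  assortment := tsSelect K T pick sel (fun _ => 0) (fun _ => 0) (fun j => θ (0, j))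

/-- The state after the customer's choice `c`: a purchase is counted, and no purchase ends the
episode. -/
def tsStep {N : ℕ} (K T : ℕ) (pick : Finset (Fin N) → Fin N)
    (sel : (Fin N → ℝ) → Finset (Fin N)) (θ : ℕ × Fin K → ℝ) (c : Fin (N + 1))
    (s : TSState N) : TSState N :=
  if c = 0 then
    let served' : Fin N → ℕ := fun i => if i ∈ s.assortment then s.served i + 1 else s.served i
    let bought' : Fin N → ℕ := fun i =>
      if i ∈ s.assortment then s.bought i + s.current i else s.bought i
    { episode := s.episode + 1
      served := served'
      bought := bought'
      current := fun _ => 0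
      assortment := tsSelect K T pick sel served' bought' (fun j => θ (s.episode + 1, j)) }
  else
    { s with current := fun i => if c = i.succ then s.current i + 1 else s.current i }

/-- The randomness: the Gaussian sample `θ (ℓ, j)` for each episode `ℓ` and each `j`, and the
choice that the customer arriving at time `t` would make from each assortment `S`. -/
abbrev Outcome (N K : ℕ) : Type := (ℕ × Fin K → ℝ) × (ℕ × Finset (Fin N) → Fin (N + 1))

/-- All these are independent; the samples are standard Gaussian, and the choice from `S` has the
multinomial logit distribution. -/
def outcomeMeasure {N : ℕ} (K : ℕ) (v : Fin N → ℝ≥0) : Measure (Outcome N K) :=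
  (Measure.infinitePi fun _ : ℕ × Fin K => gaussianReal 0 1).prod
    (Measure.infinitePi fun p : ℕ × Finset (Fin N) => (choicePMF p.2 v).toMeasure)

/-- The state at time step `t` (time starts from `0`). Only the choice of the customer from the
assortment that is offered is observed. -/
def tsState {N K : ℕ} (T : ℕ) (pick : Finset (Fin N) → Fin N)
    (sel : (Fin N → ℝ) → Finset (Fin N)) (ω : Outcome N K) : ℕ → TSState N
  | 0 => tsInit K T pick sel ω.1
  | t + 1 =>
    let s := tsState T pick sel ω t
    tsStep K T pick sel ω.1 (ω.2 (t, s.assortment)) s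

/-- The regret of the algorithm with horizon `T` after `T` time steps. -/
def tsRegret {N : ℕ} (U : (ℝ → ℝ) → ℝ) (r : Fin N → ℝ) (v : Fin N → ℝ≥0) (K T : ℕ)
    (pick : Finset (Fin N) → Fin N) (sel : (Fin N → ℝ) → Finset (Fin N)) : ℝ :=
  (T : ℝ) * optimalValue U r K v -
    ∫ ω : Outcome N K,
      ∑ t ∈ Finset.range T, U (profitCDF r (tsState T pick sel ω t).assortment v)
      ∂(outcomeMeasure K v)

end MNLBandit

end

/-! Monotonicity. Scaling down the preferences of part of an assortment moves its profit
distribution along a segment towards that of the smaller assortment. Hence, by quasiconvexity,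
raising the preferences either does not lower the value, or some proper subassortment was already at
least as good. So the best value over subassortments is monotone in the preferences
(`QuasiconvexRisk.exists_subset_le`), and for a smallest maximizer the value itself is monotone
(`IsSmallestOptimal.mono`).

Decomposition. Call a state good if every product has been offered, no product was bought far too
often, and no product of a fixed optimal assortment `A` is underestimated at level `m`. States that
are not good cost `O(N)` for the initial exploration plus a term controlled by concentration bounds
from Ville's inequality. In a good state let `W` be the optimal value for the virtual preferences.
The loss is the shortfall `U(F(A, v)) - W` plus `W - U(F(S, v))`.

The second part is at most the excess of the virtual over the true preferences on `S`, times `γ₂ /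
(1 + V)`, where `V` is the total true preference of `S` (`IsSmallestOptimal.sub_le`). As `1 / (1 +
V)` is the probability that the episode ends now, the sum over times becomes a sum over episodes of
confidence widths. It is of order `√(N T)` up to logarithms, by a harmonic sum and the
Cauchy-Schwarz inequality (`sum_goodWidth_le`).

The shortfall has no factor `1 / (1 + V)`, so the episode length, up to `1 + K` on average, must be
paid for. All virtual preferences are increasing functions of one number, the largest of the `K`
samples (`virtualPref_eq`). If every `v i` in `A` is within `√k` widths of its estimate, a largest
sample of at least `√k` is optimistic and makes the shortfall vanish. Otherwise compare with an
independent optimistic sample: the shortfall is at most a difference of virtual values, hence a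
width. Among `K` samples a failure is so rare that its cost, multiplied by `1 + K`, is still of
order `exp (3 k / 2) / K` times an expected width (`lintegral_optimalValue_sub_virtualValue_le`).

The level `k` is random. Failure of level `k` at any time has probability of order `K log T exp (-5
k)`, while the squared cost is of order `exp (3 k) / K²`; the expected squared cost is therefore
only logarithmic, without a power of `K` (`optimismCost_sq_mul_le`). -/

namespace MNLBandit

variable {N : ℕ}

/-! ### Profit distributions as mixtures -/

theorem profitCDF_apply (r : Fin N → ℝ) (S : Finset (Fin N)) (v : Fin N → ℝ≥0) (x : ℝ) :
    profitCDF r S v x = ((if 0 ≤ x then 1 else 0) + ∑ i ∈ S, if r i ≤ x then (v i : ℝ) else 0) /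
      (1 + ∑ i ∈ S, (v i : ℝ)) := by
  have hm : Measurable (profit r) := measurable_of_finite _
  have : IsProbabilityMeasure ((choicePMF S v).toMeasure.map (profit r)) :=
    Measure.isProbabilityMeasure_map hm.aemeasurable
  rw [profitCDF, cdf_eq_real, Measure.real, Measure.map_apply hm measurableSet_Iic,
    PMF.toMeasure_apply_fintype]
  have hterm : ∀ c, (profit r ⁻¹' Set.Iic x).indicator (⇑(choicePMF S v)) c =
      ENNReal.ofNNReal (if profit r c ≤ x then choiceProb S v c else 0) := by
    intro c
    by_cases h : profit r c ≤ x <;> simp [Set.indicator, h, choicePMF]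
  simp only [hterm]
  rw [← ENNReal.ofNNReal_finsetSum, ENNReal.coe_toReal, Fin.sum_univ_succ]
  simp only [profit, choiceProb, Fin.cons_zero, Fin.cons_succ]
  rw [add_div, Finset.sum_div]
  push_cast
  congr 1
  · split_ifs <;> simp
  · rw [← Finset.sum_filter_add_sum_filter_not Finset.univ (· ∈ S)]
    rw [Finset.sum_congr rfl (g := fun _ => (0 : ℝ)) (s₁ := Finset.univ.filter fun i => ¬ i ∈ S)]
    · simp only [Finset.sum_const_zero, add_zero, Finset.filter_mem_eq_inter, Finset.univ_inter]
      refine Finset.sum_congr rfl fun i hi => ?_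
      split_ifs <;> simp
    · intro i hi
      simp only [Finset.mem_filter, Finset.mem_univ, true_and] at hi
      simp [hi]

theorem profitCDF_congr (r : Fin N → ℝ) {S : Finset (Fin N)} {v w : Fin N → ℝ≥0}
    (h : ∀ i ∈ S, v i = w i) : profitCDF r S v = profitCDF r S w := by
  funext x
  rw [profitCDF_apply, profitCDF_apply]
  congr 2
  · exact Finset.sum_congr rfl fun i hi => by rw [h i hi]
  · exact Finset.sum_congr rfl fun i hi => by rw [h i hi]

theorem profitCDF_mem_unitCDFs {r : Fin N → ℝ} (hr : ∀ i, 0 < r i ∧ r i ≤ 1)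
    (S : Finset (Fin N)) (v : Fin N → ℝ≥0) : profitCDF r S v ∈ unitCDFs := by
  have hm : Measurable (profit r) := measurable_of_finite _
  refine ⟨(choicePMF S v).toMeasure.map (profit r),
    Measure.isProbabilityMeasure_map hm.aemeasurable, ?_, fun x => rfl⟩
  rw [Measure.map_apply hm measurableSet_Icc]
  have : profit r ⁻¹' Set.Icc 0 1 = Set.univ := by
    ext c
    refine Fin.cases ?_ (fun i => ?_) c
    · simp [profit]
    · simp [profit, (hr i).1.le, (hr i).2]
  rw [this, measure_univ]

/-- The scaled CDF is a mixture of the other two. With `a`, `b` the total preferences of `J` and `S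
\ J`, the weight of the full assortment is `s (1 + a + b) / (1 + s a + b)`. -/
theorem QuasiconvexRisk.scale_le {U : (ℝ → ℝ) → ℝ} (hU : QuasiconvexRisk U) {r : Fin N → ℝ}
    (hr : ∀ i, 0 < r i ∧ r i ≤ 1) {S J : Finset (Fin N)} (hJ : J ⊆ S) {s : ℝ≥0} (hs : s ≤ 1)
    (w : Fin N → ℝ≥0) :
    U (profitCDF r S fun i => if i ∈ J then s * w i else w i) ≤
      max (U (profitCDF r S w)) (U (profitCDF r (S \ J) w)) := by
  set a : ℝ := ∑ i ∈ J, (w i : ℝ)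
  set b : ℝ := ∑ i ∈ S \ J, (w i : ℝ)
  have ha : 0 ≤ a := Finset.sum_nonneg fun i _ => (w i).2
  have hb : 0 ≤ b := Finset.sum_nonneg fun i _ => (w i).2
  have hs0 : (0 : ℝ) ≤ s := s.2
  have hs1 : (s : ℝ) ≤ 1 := by exact_mod_cast hs
  have hd : 0 < 1 + s * a + b := by positivity
  have hsplit : ∀ f : Fin N → ℝ, ∑ i ∈ S, f i = ∑ i ∈ J, f i + ∑ i ∈ S \ J, f i := fun f => by
    rw [add_comm, Finset.sum_sdiff hJ]
  have key : (profitCDF r S fun i => if i ∈ J then s * w i else w i) =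
      (s * (1 + a + b) / (1 + s * a + b)) • profitCDF r S w +
        (1 - s * (1 + a + b) / (1 + s * a + b)) • profitCDF r (S \ J) w := by
    funext x
    simp only [Pi.add_apply, Pi.smul_apply, smul_eq_mul, profitCDF_apply]
    rw [hsplit (fun i => if r i ≤ x then (w i : ℝ) else 0), hsplit (fun i => (w i : ℝ)),
      hsplit (fun i => (((if i ∈ J then s * w i else w i : ℝ≥0)) : ℝ)),
      hsplit (fun i => if r i ≤ x then (((if i ∈ J then s * w i else w i : ℝ≥0)) : ℝ) else 0)]
    have e1 : ∑ i ∈ J, (((if i ∈ J then s * w i else w i : ℝ≥0)) : ℝ) = s * a := by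
      rw [Finset.mul_sum]
      exact Finset.sum_congr rfl fun i hi => by simp [hi]
    have e2 : ∑ i ∈ S \ J, (((if i ∈ J then s * w i else w i : ℝ≥0)) : ℝ) = b :=
      Finset.sum_congr rfl fun i hi => by simp [(Finset.mem_sdiff.1 hi).2]
    have e3 : ∑ i ∈ J, (if r i ≤ x then (((if i ∈ J then s * w i else w i : ℝ≥0)) : ℝ) else 0) =
        s * ∑ i ∈ J, if r i ≤ x then (w i : ℝ) else 0 := by
      rw [Finset.mul_sum]
      exact Finset.sum_congr rfl fun i hi => by simp [hi]
    have e4 : ∑ i ∈ S \ J, (if r i ≤ x then (((if i ∈ J then s * w i else w i : ℝ≥0)) : ℝ) else 0)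
        = ∑ i ∈ S \ J, if r i ≤ x then (w i : ℝ) else 0 :=
      Finset.sum_congr rfl fun i hi => by simp [(Finset.mem_sdiff.1 hi).2]
    rw [e1, e2, e3, e4]
    have h1 : 1 + (a + b) ≠ 0 := by positivity
    have h2 : 1 + b ≠ 0 := by positivity
    have h3 : 1 + (s * a + b) ≠ 0 := by positivity
    have h4 : 1 + s * a + b ≠ 0 := by positivity
    have h5 : 1 + a + b ≠ 0 := by positivity
    change _ = _ * (_ / (1 + (a + b))) + _ * (_ / (1 + b))
    generalize (∑ i ∈ J, if r i ≤ x then (w i : ℝ) else 0) = p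
    generalize (∑ i ∈ S \ J, if r i ≤ x then (w i : ℝ) else 0) = q
    generalize (if 0 ≤ x then (1 : ℝ) else 0) = c
    rw [show 1 + (a + b) = 1 + a + b by ring, show 1 + (s * a + b) = 1 + s * a + b by ring]
    field_simp
    ring
  rw [key]
  refine hU _ (by positivity) ?_ _ (profitCDF_mem_unitCDFs hr _ _) _
    (profitCDF_mem_unitCDFs hr _ _)
  rw [div_le_one hd]
  nlinarith

/-- Let `J` be the set where `v` and `w` differ. Shrink `w` on `J` by a common factor until a first
coordinate meets `v`, and use induction on the size of `J`. The alternative `S \ J` in `scale_le` is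
a proper subassortment on which `v` and `w` agree. -/
theorem QuasiconvexRisk.le_or_exists_ssubset {U : (ℝ → ℝ) → ℝ} (hU : QuasiconvexRisk U)
    {r : Fin N → ℝ} (hr : ∀ i, 0 < r i ∧ r i ≤ 1) {S : Finset (Fin N)} {v w : Fin N → ℝ≥0}
    (hvw : ∀ i ∈ S, v i ≤ w i) :
    U (profitCDF r S v) ≤ U (profitCDF r S w) ∨
      ∃ S' ⊂ S, U (profitCDF r S v) ≤ U (profitCDF r S' v) := by
  induction hn : (S.filter fun i => v i ≠ w i).card using Nat.strong_induction_on
    generalizing w with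
  | _ n ih =>
  set J := S.filter fun i => v i ≠ w i with hJdef
  have hJS : J ⊆ S := Finset.filter_subset _ _
  rcases J.eq_empty_or_nonempty with hJ | hJ
  · left
    rw [profitCDF_congr r (v := v) (w := w)]
    intro i hi
    by_contra h
    have : i ∈ J := Finset.mem_filter.2 ⟨hi, h⟩
    simp [hJ] at this
  -- The largest ratio belongs to the coordinate that meets `v` first, so the shrunken vector still
  -- dominates `v`.
  · obtain ⟨j, hj, hmax⟩ := J.exists_max_image (fun i => v i / w i) hJ
    have hlt : ∀ i ∈ J, v i < w i := fun i hi =>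
      lt_of_le_of_ne (hvw i (hJS hi)) (Finset.mem_filter.1 hi).2
    have hpos : ∀ i ∈ J, 0 < w i := fun i hi => zero_le.trans_lt (hlt i hi)
    set s := v j / w j with hs
    have hs1 : s ≤ 1 := div_le_one_of_le₀ (hvw j (hJS hj)) zero_le
    set w' : Fin N → ℝ≥0 := fun i => if i ∈ J then s * w i else w i with hw'
    have hvw' : ∀ i ∈ S, v i ≤ w' i := by
      intro i hi
      by_cases hiJ : i ∈ J
      · simp only [hw', hiJ, if_true]
        have := hmax i hiJ
        rwa [div_le_iff₀ (hpos i hiJ)] at this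
      · simp only [hw', hiJ, if_false]
        exact hvw i hi
    have hcard : (S.filter fun i => v i ≠ w' i).card < n := by
      rw [← hn]
      refine Finset.card_lt_card ⟨fun i hi => ?_, fun h => ?_⟩
      · obtain ⟨hiS, hi⟩ := Finset.mem_filter.1 hi
        by_contra hiJ
        refine hi ?_
        simp only [hw', hiJ, if_false]
        by_contra h
        exact hiJ (Finset.mem_filter.2 ⟨hiS, h⟩)
      · have := (Finset.mem_filter.1 (h hj)).2
        simp only [hw', hj, if_true, hs] at this
        exact this (div_mul_cancel₀ _ (hpos j hj).ne').symm
    rcases ih _ hcard hvw' rfl with h | h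
    · rcases le_max_iff.1 (h.trans (hU.scale_le hr hJS hs1 w)) with h' | h'
      · exact Or.inl h'
      · refine Or.inr ⟨S \ J, Finset.sdiff_ssubset hJS hJ, ?_⟩
        rw [profitCDF_congr r (S := S \ J) (v := v) (w := w)]
        · exact h'
        · intro i hi
          obtain ⟨hiS, hiJ⟩ := Finset.mem_sdiff.1 hi
          by_contra h
          exact hiJ (Finset.mem_filter.2 ⟨hiS, h⟩)
    · exact Or.inr h

/-- The value of the best sub-assortment is monotone in the preferences. -/
theorem QuasiconvexRisk.exists_subset_le {U : (ℝ → ℝ) → ℝ} (hU : QuasiconvexRisk U)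
    {r : Fin N → ℝ} (hr : ∀ i, 0 < r i ∧ r i ≤ 1) {S : Finset (Fin N)} {v w : Fin N → ℝ≥0}
    (hvw : ∀ i ∈ S, v i ≤ w i) : ∃ S' ⊆ S, U (profitCDF r S v) ≤ U (profitCDF r S' w) := by
  induction S using Finset.strongInduction with
  | _ S ih =>
  rcases hU.le_or_exists_ssubset hr hvw with h | ⟨S', hS', h⟩
  · exact ⟨S, subset_rfl, h⟩
  · obtain ⟨S'', hS'', h'⟩ := ih S' hS' fun i hi => hvw i (hS'.1 hi)
    exact ⟨S'', hS''.trans hS'.1, h.trans h'⟩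

/-! ### Optimal assortments -/

section Optimal

variable {U : (ℝ → ℝ) → ℝ} {r : Fin N → ℝ} {K : ℕ}

theorem IsOptimal.le {w : Fin N → ℝ} {S S' : Finset (Fin N)} (h : IsOptimal U r K w S)
    (hS' : S'.card ≤ K) : U (profitCDF r S' fun i => (w i).toNNReal) ≤
      U (profitCDF r S fun i => (w i).toNNReal) := by
  -- restricting `S'` to the products with nonnegative preferences does not change the CDF
  have hadm : IsAdmissible K w (S'.filter fun i => 0 ≤ w i) :=
    ⟨(Finset.card_filter_le _ _).trans hS', fun i hi => (Finset.mem_filter.1 hi).2⟩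
  refine le_of_eq_of_le ?_ (h.2 _ hadm)
  congr 1
  funext x
  rw [profitCDF_apply, profitCDF_apply]
  have hz : ∀ i ∈ S', i ∉ S'.filter (fun i => 0 ≤ w i) → (w i).toNNReal = 0 := by
    intro i hi hi'
    rw [Real.toNNReal_eq_zero]
    by_contra h
    exact hi' (Finset.mem_filter.2 ⟨hi, (not_le.1 h).le⟩)
  rw [Finset.sum_subset (Finset.filter_subset (fun i => 0 ≤ w i) S'),
    Finset.sum_subset (Finset.filter_subset (fun i => 0 ≤ w i) S')]
  · intro i hi hi'
    simp [hz i hi hi']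
  · intro i hi hi'
    simp [hz i hi hi']

/-- Raising the preferences does not lower the value of a smallest maximizer. -/
theorem IsSmallestOptimal.mono (hU : QuasiconvexRisk U) (hr : ∀ i, 0 < r i ∧ r i ≤ 1)
    {w : Fin N → ℝ} {S : Finset (Fin N)} (h : IsSmallestOptimal U r K w S) {w' : Fin N → ℝ≥0}
    (hw : ∀ i ∈ S, (w i).toNNReal ≤ w' i) :
    U (profitCDF r S fun i => (w i).toNNReal) ≤ U (profitCDF r S w') := by
  rcases hU.le_or_exists_ssubset hr hw with h' | ⟨S', hS', h'⟩
  · exact h'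
  -- A proper subassortment that is at least as good would be a maximizer with fewer products; this
  -- is where the choice of a smallest maximizer enters.
  · exfalso
    have hcard := Finset.card_lt_card hS'
    have hopt : IsOptimal U r K w S' :=
      ⟨⟨hcard.le.trans h.1.1.1, fun i hi => h.1.1.2 i (hS'.1 hi)⟩,
        fun T hT => (h.1.2 T hT).trans h'⟩
    exact absurd (h.2 S' hopt) (not_le.2 hcard)

/-- Raise `w` to `max w v`, which does not lower the value, and apply the Lipschitz condition
between `v` and `max w v`. The denominator then involves the true `v` and matches the no-purchase
probability. -/
theorem IsSmallestOptimal.sub_le {γ₂ : ℝ} (hU : QuasiconvexRisk U)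
    (hr : ∀ i, 0 < r i ∧ r i ≤ 1) (hlip : OneSidedLipschitzRisk U r γ₂) {w : Fin N → ℝ}
    {S : Finset (Fin N)} (h : IsSmallestOptimal U r K w S) (v : Fin N → ℝ≥0) :
    U (profitCDF r S fun i => (w i).toNNReal) - U (profitCDF r S v) ≤
      |γ₂| / (1 + ∑ i ∈ S, (v i : ℝ)) * ∑ i ∈ S, max (w i - v i) 0 := by
  set w' : Fin N → ℝ≥0 := fun i => max (w i).toNNReal (v i)
  have h1 := h.mono hU hr (w' := w') fun i _ => le_max_left _ _
  have h2 := hlip v w' (fun i => le_max_right _ _) S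
  have h0 : (0 : ℝ) ≤ ∑ i ∈ S, (v i : ℝ) := Finset.sum_nonneg fun i _ => (v i).2
  have h3 : ∑ i ∈ S, ((w' i : ℝ) - v i) = ∑ i ∈ S, max (w i - v i) 0 := by
    refine Finset.sum_congr rfl fun i hi => ?_
    simp only [w', NNReal.coe_max, Real.coe_toNNReal', max_eq_left (h.1.1.2 i hi)]
    rw [← max_sub_sub_right, sub_self]
  rw [h3] at h2
  have h4 : γ₂ / (1 + ∑ i ∈ S, (v i : ℝ)) * ∑ i ∈ S, max (w i - v i) 0 ≤
      |γ₂| / (1 + ∑ i ∈ S, (v i : ℝ)) * ∑ i ∈ S, max (w i - v i) 0 := by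
    gcongr
    exact le_abs_self _
  linarith

/-- Comparison of the optimal values for two preference vectors. -/
theorem IsOptimal.sub_le_of_le {γ₂ : ℝ}
    (hlip : OneSidedLipschitzRisk U r γ₂) {w w' : Fin N → ℝ}
    {S S' : Finset (Fin N)} (h : IsOptimal U r K w S) (h' : IsOptimal U r K w' S')
    (hw : ∀ i, w i ≤ w' i) :
    U (profitCDF r S' fun i => (w' i).toNNReal) - U (profitCDF r S fun i => (w i).toNNReal) ≤
      |γ₂| * ∑ i ∈ S', (w' i - w i) := by
  -- The maximizer for the larger preferences also competes under the smaller ones, so only the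
  -- coordinates in `S'` matter.
  have h1 := h.le h'.1.1
  have h2 := hlip (fun i => (w i).toNNReal) (fun i => (w' i).toNNReal)
    (fun i => Real.toNNReal_le_toNNReal (hw i)) S'
  have h0 : (0 : ℝ) ≤ ∑ i ∈ S', ((w i).toNNReal : ℝ) :=
    Finset.sum_nonneg fun i _ => NNReal.coe_nonneg _
  have h3 : ∀ i ∈ S', 0 ≤ (((w' i).toNNReal : ℝ) - (w i).toNNReal) := fun i _ =>
    sub_nonneg.2 (NNReal.coe_le_coe.2 (Real.toNNReal_le_toNNReal (hw i)))
  have h4 : γ₂ / (1 + ∑ i ∈ S', ((w i).toNNReal : ℝ)) *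
      ∑ i ∈ S', (((w' i).toNNReal : ℝ) - (w i).toNNReal) ≤ |γ₂| * ∑ i ∈ S', (w' i - w i) := by
    have h5 : ∑ i ∈ S', (((w' i).toNNReal : ℝ) - (w i).toNNReal) ≤ ∑ i ∈ S', (w' i - w i) := by
      refine Finset.sum_le_sum fun i hi => ?_
      rw [Real.coe_toNNReal _ (h'.1.2 i hi)]
      have := Real.le_coe_toNNReal (w i)
      linarith
    have h6 : γ₂ / (1 + ∑ i ∈ S', ((w i).toNNReal : ℝ)) ≤ |γ₂| := by
      refine (div_le_div_of_nonneg_right (le_abs_self _) (by positivity)).trans ?_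
      exact div_le_self (abs_nonneg _) (by linarith)
    exact mul_le_mul h6 h5 (Finset.sum_nonneg h3) (abs_nonneg _)
  linarith

theorem exists_eq_optimalValue (U : (ℝ → ℝ) → ℝ) (r : Fin N → ℝ) (K : ℕ) (v : Fin N → ℝ≥0) :
    ∃ S : Finset (Fin N), S.card ≤ K ∧ U (profitCDF r S v) = optimalValue U r K v := by
  obtain ⟨S, hS, h⟩ := Finset.exists_mem_eq_sup'
    (⟨∅, by simp⟩ : (Finset.univ.filter fun S : Finset (Fin N) => S.card ≤ K).Nonempty)
    (fun S => U (profitCDF r S v))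
  exact ⟨S, (Finset.mem_filter.1 hS).2, h.symm⟩

theorem le_optimalValue (U : (ℝ → ℝ) → ℝ) (r : Fin N → ℝ) {K : ℕ} (v : Fin N → ℝ≥0)
    {S : Finset (Fin N)} (hS : S.card ≤ K) : U (profitCDF r S v) ≤ optimalValue U r K v :=
  Finset.le_sup' (fun S => U (profitCDF r S v)) (Finset.mem_filter.2 ⟨Finset.mem_univ _, hS⟩)

/-- Optimism: the optimal value does not decrease if the preferences of the products in an
assortment are overestimated. -/
theorem IsOptimal.optimistic (hU : QuasiconvexRisk U) (hr : ∀ i, 0 < r i ∧ r i ≤ 1)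
    {w : Fin N → ℝ} {S Sopt : Finset (Fin N)} (h : IsOptimal U r K w S) {v : Fin N → ℝ≥0}
    (hS : Sopt.card ≤ K) (hw : ∀ i ∈ Sopt, (v i : ℝ) ≤ w i) :
    U (profitCDF r Sopt v) ≤ U (profitCDF r S fun i => (w i).toNNReal) := by
  obtain ⟨S', hS', h'⟩ := hU.exists_subset_le hr (S := Sopt) (v := v)
    (w := fun i => (w i).toNNReal) fun i hi => by
      rw [← Real.toNNReal_coe (r := v i)]
      exact Real.toNNReal_le_toNNReal (hw i hi)
  exact h'.trans (h.le ((Finset.card_le_card hS').trans hS))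

end Optimal

end MNLBandit

namespace MNLBandit

/-! ### Resampling coordinates of a product measure -/

-- Overwriting the coordinates in `s` by an independent copy keeps the law. An integrand whose other
-- factors ignore these coordinates can then be integrated over the copy first, which replaces
-- conditioning.
open Classical in
theorem measurePreserving_ite_mem {ι : Type*} {X : ι → Type*} [∀ i, MeasurableSpace (X i)]
    (μ : ∀ i, Measure (X i)) [∀ i, IsProbabilityMeasure (μ i)] (s : Set ι) :
    MeasurePreserving (fun (p : (∀ i, X i) × (∀ i, X i)) i => if i ∈ s then p.2 i else p.1 i)
      ((Measure.infinitePi μ).prod (Measure.infinitePi μ)) (Measure.infinitePi μ) := by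
  have hm : Measurable
      (fun (p : (∀ i, X i) × (∀ i, X i)) i => if i ∈ s then p.2 i else p.1 i) := by
    refine measurable_pi_lambda _ fun i => ?_
    by_cases h : i ∈ s
    · simp only [h, if_true]; fun_prop
    · simp only [h, if_false]; fun_prop
  refine ⟨hm, Measure.eq_infinitePi _ fun F B hB => ?_⟩
  rw [Measure.map_apply hm (.pi F.countable_toSet fun i _ => hB i)]
  have hpre : (fun (p : (∀ i, X i) × (∀ i, X i)) i => if i ∈ s then p.2 i else p.1 i) ⁻¹'
      (Set.pi F B) = (Set.pi (F.filter fun i => i ∉ s : Finset ι) B) ×ˢ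
        (Set.pi (F.filter fun i => i ∈ s : Finset ι) B) := by
    ext p
    simp only [Set.mem_preimage, Set.mem_pi, Set.mem_prod, Finset.mem_coe, Finset.mem_filter]
    constructor
    · intro h
      exact ⟨fun i hi => by simpa [hi.2] using h i hi.1, fun i hi => by simpa [hi.2] using h i hi.1⟩
    · rintro ⟨h1, h2⟩ i hi
      by_cases his : i ∈ s
      · simpa [his] using h2 i ⟨hi, his⟩
      · simpa [his] using h1 i ⟨hi, his⟩
  rw [hpre, Measure.prod_prod, Measure.infinitePi_pi _ (fun i _ => hB i),
    Measure.infinitePi_pi _ (fun i _ => hB i), mul_comm, Finset.prod_filter_mul_prod_filter_not]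

theorem infinitePi_map_block {ι κ : Type*} [Fintype κ] (ν : Measure ℝ) [IsProbabilityMeasure ν]
    (l : ι) : (Measure.infinitePi fun _ : ι × κ => ν).map (fun x j => x (l, j)) =
      Measure.pi fun _ : κ => ν := by
  have hm : Measurable fun (x : ι × κ → ℝ) (j : κ) => x (l, j) := by fun_prop
  refine (Measure.pi_eq fun B hB => ?_).symm
  classical
  rw [Measure.map_apply hm (.univ_pi hB)]
  have hpre : (fun (x : ι × κ → ℝ) (j : κ) => x (l, j)) ⁻¹' (Set.univ.pi B) =
      Set.pi ((Finset.univ.map ⟨fun j => (l, j), fun a b h => by simpa using h⟩ : Finset (ι × κ)))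
        (fun p => B p.2) := by
    ext x
    simp only [Set.mem_preimage, Set.mem_pi, Set.mem_univ, true_imp_iff, Finset.mem_coe,
      Finset.mem_map, Finset.mem_univ, true_and, forall_exists_index, forall_apply_eq_imp_iff]
    exact Iff.rfl
  rw [hpre, Measure.infinitePi_pi _ (fun i _ => hB i.2), Finset.prod_map]
  rfl

/-! ### The law of the outcome -/

section Law

variable {N K : ℕ}

instance isProbabilityMeasure_outcomeMeasure (v : Fin N → ℝ≥0) :
    IsProbabilityMeasure (outcomeMeasure K v) := by
  unfold outcomeMeasure; infer_instance

/-- `f` only depends on the samples and on the choices made before time `t`. -/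
def DependsOnPast {β : Type*} (t : ℕ) (f : Outcome N K → β) : Prop :=
  ∀ ω ω' : Outcome N K, ω.1 = ω'.1 → (∀ s < t, ∀ S, ω.2 (s, S) = ω'.2 (s, S)) → f ω = f ω'

/-- Resample all the choices at time `t`: `g` does not notice, and the indicator integrates to the
choice probability. -/
theorem lintegral_mul_choice_indicator (v : Fin N → ℝ≥0) {t : ℕ} {g : Outcome N K → ℝ≥0∞}
    (hg : Measurable g) (hgt : DependsOnPast t g) (S : Finset (Fin N)) (c : Fin (N + 1)) :
    ∫⁻ ω, g ω * (if ω.2 (t, S) = c then 1 else 0) ∂(outcomeMeasure K v) =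
      ∫⁻ ω, g ω * choicePMF S v c ∂(outcomeMeasure K v) := by
  classical
  have hind : Measurable fun y : ℕ × Finset (Fin N) → Fin (N + 1) =>
      (if y (t, S) = c then (1 : ℝ≥0∞) else 0) :=
    have hy : Measurable fun y : ℕ × Finset (Fin N) → Fin (N + 1) => y (t, S) :=
      measurable_pi_apply _
    Measurable.ite (hy (measurableSet_singleton c)) measurable_const measurable_const
  have hm : Measurable fun ω : Outcome N K => g ω * (if ω.2 (t, S) = c then 1 else 0) :=
    hg.mul (hind.comp measurable_snd)
  unfold outcomeMeasure
  rw [lintegral_prod _ hm.aemeasurable, lintegral_prod _ (hg.mul_const _).aemeasurable]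
  refine lintegral_congr fun θ => ?_
  have hmp := measurePreserving_ite_mem
    (fun p : ℕ × Finset (Fin N) => (choicePMF p.2 v).toMeasure) {p | p.1 = t}
  have hmθ : Measurable fun x : ℕ × Finset (Fin N) → Fin (N + 1) =>
      g (θ, x) * (if x (t, S) = c then 1 else 0) := hm.comp measurable_prodMk_left
  rw [← hmp.lintegral_comp hmθ]
  refine (lintegral_prod _ (hmθ.comp hmp.measurable).aemeasurable).trans ?_
  refine lintegral_congr fun x => ?_
  have hgx : ∀ y : ℕ × Finset (Fin N) → Fin (N + 1),
      g (θ, fun i => if i ∈ {p : ℕ × Finset (Fin N) | p.1 = t} then y i else x i) = g (θ, x) := by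
    intro y
    refine hgt _ _ rfl fun s hs S' => ?_
    simp [hs.ne]
  have hmem : (t, S) ∈ {p : ℕ × Finset (Fin N) | p.1 = t} := rfl
  simp only [Function.comp_apply, hgx, if_pos hmem]
  rw [lintegral_const_mul _ hind]
  congr 1
  have h1 := (measurePreserving_eval_infinitePi
    (fun p : ℕ × Finset (Fin N) => (choicePMF p.2 v).toMeasure) (t, S)).lintegral_comp
    (f := fun b : Fin (N + 1) => if b = c then (1 : ℝ≥0∞) else 0) (measurable_of_finite _)
  simp only [Function.eval] at h1
  rw [h1, show (fun b : Fin (N + 1) => if b = c then (1 : ℝ≥0∞) else 0) =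
    Set.indicator {c} 1 by ext b; simp [Set.indicator],
    lintegral_indicator_one (measurableSet_singleton c),
    PMF.toMeasure_apply_singleton _ _ (measurableSet_singleton c)]

/-- The choice at time `t` from an assortment that only depends on the past. -/
theorem lintegral_choice (v : Fin N → ℝ≥0) {t : ℕ} {A : Outcome N K → Finset (Fin N)}
    (hA : ∀ S, MeasurableSet {ω | A ω = S}) (hAt : DependsOnPast t A)
    {f : Fin (N + 1) → Outcome N K → ℝ≥0∞} (hf : ∀ c, Measurable (f c))
    (hft : ∀ c, DependsOnPast t (f c)) :
    ∫⁻ ω, f (ω.2 (t, A ω)) ω ∂(outcomeMeasure K v) =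
      ∫⁻ ω, ∑ c, choicePMF (A ω) v c * f c ω ∂(outcomeMeasure K v) := by
  classical
  have hgm : ∀ (S : Finset (Fin N)) (c : Fin (N + 1)),
      Measurable fun ω : Outcome N K => if A ω = S then f c ω else 0 := fun S c =>
    Measurable.ite (hA S) (hf c) measurable_const
  have hgt : ∀ (S : Finset (Fin N)) (c : Fin (N + 1)),
      DependsOnPast t fun ω : Outcome N K => if A ω = S then f c ω else 0 := by
    intro S c ω ω' h1 h2
    simp only [hAt ω ω' h1 h2, hft c ω ω' h1 h2]
  have hind : ∀ (S : Finset (Fin N)) (c : Fin (N + 1)), Measurable fun ω : Outcome N K =>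
      (if ω.2 (t, S) = c then (1 : ℝ≥0∞) else 0) := fun S c =>
    have hy : Measurable fun ω : Outcome N K => ω.2 (t, S) :=
      (measurable_pi_apply (t, S)).comp measurable_snd
    Measurable.ite (hy (measurableSet_singleton c)) measurable_const measurable_const
  -- A sum over the possible values of the assortment and of the choice replaces the random
  -- coordinate by fixed ones.
  have h1 : ∀ ω : Outcome N K, f (ω.2 (t, A ω)) ω =
      ∑ S, ∑ c, (if A ω = S then f c ω else 0) * (if ω.2 (t, S) = c then 1 else 0) := by
    intro ω
    simp [mul_ite]
  have h2 : ∀ ω : Outcome N K, ∑ c, choicePMF (A ω) v c * f c ω =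
      ∑ S, ∑ c, (if A ω = S then f c ω else 0) * choicePMF S v c := by
    intro ω
    rw [Finset.sum_eq_single (A ω)]
    · simp [mul_comm]
    · intro S _ hS
      simp [Ne.symm hS]
    · simp
  simp only [h1, h2]
  have hm1 : ∀ S c, Measurable fun ω : Outcome N K =>
      (if A ω = S then f c ω else 0) * (if ω.2 (t, S) = c then 1 else 0) := fun S c =>
    (hgm S c).mul (hind S c)
  have hm2 : ∀ S c, Measurable fun ω : Outcome N K =>
      (if A ω = S then f c ω else 0) * choicePMF S v c := fun S c => (hgm S c).mul_const _
  rw [lintegral_finsetSum _ fun S _ => Finset.measurable_fun_sum _ fun c _ => hm1 S c,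
    lintegral_finsetSum _ fun S _ => Finset.measurable_fun_sum _ fun c _ => hm2 S c]
  refine Finset.sum_congr rfl fun S _ => ?_
  rw [lintegral_finsetSum _ fun c _ => hm1 S c, lintegral_finsetSum _ fun c _ => hm2 S c]
  exact Finset.sum_congr rfl fun c _ => lintegral_mul_choice_indicator v (hgm S c) (hgt S c) S c

/-- The law of the samples of one episode. -/
noncomputable def sampleMeasure (K : ℕ) : Measure (Fin K → ℝ) :=
  Measure.pi fun _ => gaussianReal 0 1

instance isProbabilityMeasure_sampleMeasure : IsProbabilityMeasure (sampleMeasure K) := by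
  unfold sampleMeasure; infer_instance

/-- The samples of episode `l` are independent of everything else. -/
theorem lintegral_sample (v : Fin N → ℝ≥0) (l : ℕ) {G : Outcome N K → (Fin K → ℝ) → ℝ≥0∞}
    (hG : Measurable (Function.uncurry G))
    (hGl : ∀ ω ω' : Outcome N K, ω.2 = ω'.2 → (∀ l' ≠ l, ∀ j, ω.1 (l', j) = ω'.1 (l', j)) →
      G ω = G ω') :
    ∫⁻ ω, G ω (fun j => ω.1 (l, j)) ∂(outcomeMeasure K v) =
      ∫⁻ ω, ∫⁻ y, G ω y ∂(sampleMeasure K) ∂(outcomeMeasure K v) := by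
  classical
  have hblock : Measurable fun ω : Outcome N K => (fun j => ω.1 (l, j)) := by fun_prop
  have hm : Measurable fun ω : Outcome N K => G ω (fun j => ω.1 (l, j)) :=
    hG.comp (measurable_id.prodMk hblock)
  have hm2 : Measurable fun ω : Outcome N K => ∫⁻ y, G ω y ∂(sampleMeasure K) :=
    hG.lintegral_prod_right'
  unfold outcomeMeasure
  rw [lintegral_prod_symm _ hm.aemeasurable, lintegral_prod_symm _ hm2.aemeasurable]
  refine lintegral_congr fun ch => ?_
  have hmp := measurePreserving_ite_mem (fun _ : ℕ × Fin K => gaussianReal 0 1) {p | p.1 = l}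
  have hmc : Measurable fun x : ℕ × Fin K → ℝ => G (x, ch) (fun j => x (l, j)) :=
    hm.comp measurable_prodMk_right
  rw [← hmp.lintegral_comp hmc]
  refine (lintegral_prod _ (hmc.comp hmp.measurable).aemeasurable).trans ?_
  refine lintegral_congr fun x => ?_
  have hGx : ∀ y : ℕ × Fin K → ℝ,
      G (fun i => if i ∈ {p : ℕ × Fin K | p.1 = l} then y i else x i, ch) = G (x, ch) := by
    intro y
    refine hGl _ _ rfl fun l' hl' j => ?_
    simp [hl']
  have hmem : ∀ j : Fin K, (l, j) ∈ {p : ℕ × Fin K | p.1 = l} := fun _ => rfl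
  simp only [Function.comp_apply, hGx, if_pos (hmem _)]
  rw [sampleMeasure, ← infinitePi_map_block (gaussianReal 0 1) l,
    lintegral_map (f := G (x, ch)) (hG.comp measurable_prodMk_left) (by fun_prop)]

end Law

/-! ### Measurability and dependence of the states -/

section State

variable {N K : ℕ}

/-- States form a countable type, so every function of the state is measurable. -/
instance measurableSpace_TSState : MeasurableSpace (TSState N) := ⊤

instance discreteMeasurableSpace_TSState : DiscreteMeasurableSpace (TSState N) := ⟨fun _ => trivial⟩

instance countable_TSState : Countable (TSState N) :=
  Function.Injective.countable
    (f := fun s : TSState N => (s.episode, s.served, s.bought, s.current, s.assortment))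
    (by
      rintro ⟨a, b, c, d, e⟩ ⟨a', b', c', d', e'⟩ h
      simp only [Prod.mk.injEq] at h
      obtain ⟨rfl, rfl, rfl, rfl, rfl⟩ := h
      rfl)

/-- As `σ̂` is nonnegative and the samples are shared by the products, a single number, the largest
sample, drives all the virtual preferences monotonically. -/
theorem virtualPref_eq (hK : 1 ≤ K) (T : ℕ) (served bought : Fin N → ℕ)
    (θ : Fin K → ℝ) (i : Fin N) :
    virtualPref K T served bought θ i = meanEst (served i) (bought i) +
      (⨆ j, θ j) * sigmaHat K T (served i) (bought i) := by
  have : Nonempty (Fin K) := ⟨⟨0, hK⟩⟩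
  have hs : 0 ≤ sigmaHat K T (served i) (bought i) := by unfold sigmaHat; positivity
  have hbdd : BddAbove (Set.range θ) := Set.finite_range θ |>.bddAbove
  unfold virtualPref
  rw [Real.iSup_mul_of_nonneg hs]
  exact (add_ciSup (Set.finite_range _).bddAbove _).symm

theorem measurable_virtualPref (T : ℕ) (served bought : Fin N → ℕ) :
    Measurable fun θ : Fin K → ℝ => virtualPref K T served bought θ := by
  refine measurable_pi_lambda _ fun i => ?_
  unfold virtualPref
  refine Measurable.iSup fun j => ?_
  fun_prop

variable {T : ℕ} {pick : Finset (Fin N) → Fin N} {sel : (Fin N → ℝ) → Finset (Fin N)}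

theorem measurableSet_tsSelect (hsel : ∀ S, MeasurableSet {w | sel w = S})
    (served bought : Fin N → ℕ) (S : Finset (Fin N)) :
    MeasurableSet {θ : Fin K → ℝ | tsSelect K T pick sel served bought θ = S} := by
  unfold tsSelect
  split_ifs
  · exact MeasurableSet.const _
  · exact measurable_virtualPref T served bought (hsel S)

theorem measurable_tsSelect_comp {β : Type*} [MeasurableSpace β]
    (hsel : ∀ S, MeasurableSet {w | sel w = S}) (served bought : Fin N → ℕ)
    (g : Finset (Fin N) → β) :
    Measurable fun θ : Fin K → ℝ => g (tsSelect K T pick sel served bought θ) := by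
  intro B _
  have : (fun θ : Fin K → ℝ => g (tsSelect K T pick sel served bought θ)) ⁻¹' B =
      ⋃ S ∈ {S | g S ∈ B}, {θ : Fin K → ℝ | tsSelect K T pick sel served bought θ = S} := by
    ext θ; simp
  rw [this]
  exact MeasurableSet.biUnion (Set.to_countable _) fun S _ => measurableSet_tsSelect hsel _ _ S

theorem measurable_tsInit (hsel : ∀ S, MeasurableSet {w | sel w = S}) :
    Measurable fun θ : ℕ × Fin K → ℝ => tsInit K T pick sel θ :=
  (measurable_tsSelect_comp hsel (fun _ => 0) (fun _ => 0)
    (fun S => (⟨0, fun _ => 0, fun _ => 0, fun _ => 0, S⟩ : TSState N))).comp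
    (by fun_prop : Measurable fun (θ : ℕ × Fin K → ℝ) (j : Fin K) => θ (0, j))

theorem measurable_tsStep (hsel : ∀ S, MeasurableSet {w | sel w = S}) (c : Fin (N + 1))
    (s : TSState N) : Measurable fun θ : ℕ × Fin K → ℝ => tsStep K T pick sel θ c s := by
  unfold tsStep
  split_ifs
  · exact (measurable_tsSelect_comp hsel
      (fun i => if i ∈ s.assortment then s.served i + 1 else s.served i)
      (fun i => if i ∈ s.assortment then s.bought i + s.current i else s.bought i)
      (fun S => (⟨s.episode + 1, _, _, fun _ => 0, S⟩ : TSState N))).comp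
      (by fun_prop : Measurable fun (θ : ℕ × Fin K → ℝ) (j : Fin K) => θ (s.episode + 1, j))
  · exact measurable_const

theorem measurable_tsState (hsel : ∀ S, MeasurableSet {w | sel w = S}) (t : ℕ) :
    Measurable fun ω : Outcome N K => tsState T pick sel ω t := by
  induction t with
  | zero => exact (measurable_tsInit hsel).comp measurable_fst
  | succ t ih =>
    have h1 : Measurable fun p : (Fin (N + 1) × TSState N) × (ℕ × Fin K → ℝ) =>
        tsStep K T pick sel p.2 p.1.1 p.1.2 :=
      measurable_from_prod_countable_right fun q => measurable_tsStep hsel q.1 q.2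
    have h2 : Measurable fun p : TSState N × Outcome N K => p.2.2 (t, p.1.assortment) :=
      measurable_from_prod_countable_right fun s =>
        (measurable_pi_apply (t, s.assortment)).comp measurable_snd
    exact h1.comp (((h2.comp (ih.prodMk measurable_id)).prodMk ih).prodMk measurable_fst)

theorem measurable_choice (hsel : ∀ S, MeasurableSet {w | sel w = S}) (t : ℕ) :
    Measurable fun ω : Outcome N K => ω.2 (t, (tsState T pick sel ω t).assortment) := by
  have h2 : Measurable fun p : TSState N × Outcome N K => p.2.2 (t, p.1.assortment) :=
    measurable_from_prod_countable_right fun s =>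
      (measurable_pi_apply (t, s.assortment)).comp measurable_snd
  exact h2.comp ((measurable_tsState hsel t).prodMk measurable_id)

theorem dependsOnPast_tsState {s t : ℕ} (hst : s ≤ t) :
    DependsOnPast (K := K) t fun ω => tsState T pick sel ω s := by
  intro ω ω' h1 h2
  induction s with
  | zero => simp only [tsState, h1]
  | succ s ih =>
    have ih' : tsState T pick sel ω s = tsState T pick sel ω' s := ih (by omega)
    simp only [tsState, ih', h1, h2 s (by omega)]

theorem tsState_episode_le_succ (ω : Outcome N K) (t : ℕ) :
    (tsState T pick sel ω t).episode ≤ (tsState T pick sel ω (t + 1)).episode := by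
  simp only [tsState, tsStep]
  split_ifs <;> simp

/-- The samples of block `l` are first read when episode `l` starts. This makes the samples of the
next episode independent of the present state. -/
theorem tsState_eq_of_episode_lt {l t : ℕ} {ω ω' : Outcome N K} (h2 : ω.2 = ω'.2)
    (h1 : ∀ l' ≠ l, ∀ j, ω.1 (l', j) = ω'.1 (l', j))
    (hl : (tsState T pick sel ω t).episode < l) :
    tsState T pick sel ω t = tsState T pick sel ω' t := by
  induction t with
  | zero =>
    have : (0 : ℕ) < l := hl
    simp only [tsState, tsInit, h1 0 this.ne]
  | succ t ih =>
    have ih' := ih ((tsState_episode_le_succ ω t).trans_lt hl)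
    simp only [tsState, tsStep] at hl ⊢
    rw [← ih', ← h2]
    split_ifs at hl ⊢ with hc
    · simp only at hl
      simp only [h1 _ hl.ne]
    · rfl

theorem tsState_assortment (ω : Outcome N K) (t : ℕ) :
    (tsState T pick sel ω t).assortment = tsSelect K T pick sel (tsState T pick sel ω t).served
      (tsState T pick sel ω t).bought fun j => ω.1 ((tsState T pick sel ω t).episode, j) := by
  induction t with
  | zero => rfl
  | succ t ih =>
    simp only [tsState, tsStep]
    split_ifs
    · rfl
    · exact ih

theorem tsState_episode_le (ω : Outcome N K) (t : ℕ) :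
    (tsState T pick sel ω t).episode ≤ t := by
  induction t with
  | zero => exact le_rfl
  | succ t ih =>
    simp only [tsState, tsStep]
    split_ifs <;> simp <;> omega

end State

end MNLBandit

namespace MNLBandit

/-! ### Exponential supermartingales -/

theorem exp_neg_le_quadratic {x : ℝ} (hx : 0 ≤ x) : Real.exp (-x) ≤ 1 - x + x ^ 2 / 2 := by
  have h1 := Real.quadratic_le_exp_of_nonneg hx
  have h2 : Real.exp (-x) * Real.exp x = 1 := by rw [← Real.exp_add]; simp
  have h3 := Real.exp_pos (-x)
  have h4 : 0 < 1 + x + x ^ 2 / 2 := by positivity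
  have h5 : Real.exp (-x) * (1 + x + x ^ 2 / 2) ≤ 1 := by
    exact (mul_le_mul_of_nonneg_left h1 h3.le).trans h2.le
  have h6 : 1 ≤ (1 - x + x ^ 2 / 2) * (1 + x + x ^ 2 / 2) := by nlinarith [pow_nonneg hx 4]
  exact le_of_mul_le_mul_right (h5.trans h6) h4

/-- The purchases of a product per episode are geometric with mean `v`; this is the supermartingale
condition for the tilt `-lam`. If `lam ≥ 1`, both exponentials are at most `1`; otherwise `x = v lam
(1 - lam)` lies in `[0, 1]` and a Taylor bound of order three applies. -/
theorem geometric_mgf_lower {v lam : ℝ} (hv0 : 0 ≤ v) (hv1 : v ≤ 1) (hl : 0 ≤ lam) :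
    v * Real.exp (-lam) + Real.exp (-(-lam * v + v * lam ^ 2)) ≤ 1 + v := by
  have h1 := exp_neg_le_quadratic hl
  rcases le_or_gt 1 lam with h | h
  · have h2 : Real.exp (-lam) ≤ 1 := Real.exp_le_one_iff.2 (by linarith)
    have h3 : Real.exp (-(-lam * v + v * lam ^ 2)) ≤ 1 := by
      refine Real.exp_le_one_iff.2 ?_
      nlinarith [mul_nonneg hv0 hl]
    nlinarith
  · set x := v * lam * (1 - lam) with hx
    have hvl : 0 ≤ v * lam := mul_nonneg hv0 hl
    have hx0 : 0 ≤ x := mul_nonneg hvl (by linarith)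
    have hvl1 : v * lam ≤ 1 := by nlinarith
    have hx1 : x ≤ 1 := by nlinarith
    have h2 := Real.exp_bound' hx0 hx1 (n := 3) (by norm_num)
    simp only [Finset.sum_range_succ, Finset.sum_range_zero, Nat.factorial] at h2
    norm_num at h2
    rw [show -(-lam * v + v * lam ^ 2) = x by rw [hx]; ring]
    have h3 : v * Real.exp (-lam) ≤ v * (1 - lam + lam ^ 2 / 2) :=
      mul_le_mul_of_nonneg_left h1 hv0
    have hx2 : x ^ 2 ≤ v * lam ^ 2 * (1 - lam) ^ 2 := by
      have : x ^ 2 = v * (v * lam ^ 2 * (1 - lam) ^ 2) := by rw [hx]; ring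
      rw [this]
      have : 0 ≤ v * lam ^ 2 * (1 - lam) ^ 2 := by positivity
      nlinarith
    have hxl : x ≤ lam := by nlinarith
    have hx3 : x ^ 3 ≤ v * lam ^ 2 * (1 - lam) ^ 2 * lam := by
      calc x ^ 3 = x ^ 2 * x := by ring
        _ ≤ (v * lam ^ 2 * (1 - lam) ^ 2) * lam := by gcongr
    have hfin : (1 - lam) ^ 2 * (1 / 2 + 2 / 9 * lam) ≤ 1 / 2 := by
      nlinarith [mul_nonneg hl hl, mul_nonneg hl (sub_nonneg.2 h.le),
        mul_nonneg (mul_nonneg hl hl) (sub_nonneg.2 h.le)]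
    have hfin2 := mul_le_mul_of_nonneg_left hfin (by positivity : 0 ≤ v * lam ^ 2)
    nlinarith

/-- With `lam ≤ 1/4` the squared compensator `y²` is at most `4 v lam²`. The second-order terms `v
lam²` and `y² / 2` then add up to at most the constant `3`. -/
theorem geometric_mgf_upper {v lam : ℝ} (hv0 : 0 ≤ v) (hv1 : v ≤ 1) (hl : 0 ≤ lam)
    (hl1 : lam ≤ 1 / 4) :
    v * Real.exp lam + Real.exp (-(lam * v + 3 * v * lam ^ 2)) ≤ 1 + v := by
  have h1 := Real.exp_bound' hl (by linarith) (n := 2) (by norm_num)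
  simp only [Finset.sum_range_succ, Finset.sum_range_zero, Nat.factorial] at h1
  norm_num at h1
  set y := lam * v + 3 * v * lam ^ 2 with hy
  have hy0 : 0 ≤ y := by positivity
  have h2 := exp_neg_le_quadratic hy0
  have h3 : v * Real.exp lam ≤ v * (1 + lam + lam ^ 2) :=
    mul_le_mul_of_nonneg_left (by nlinarith) hv0
  have h4 : y ^ 2 ≤ 4 * (v * lam ^ 2) := by
    have : y ^ 2 = v * lam ^ 2 * (v * (1 + 3 * lam) ^ 2) := by rw [hy]; ring
    rw [this, mul_comm]
    have h5 : (1 + 3 * lam) ^ 2 ≤ 4 := by nlinarith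
    have h6 : v * (1 + 3 * lam) ^ 2 ≤ 4 := by nlinarith [sq_nonneg (1 + 3 * lam)]
    exact mul_le_mul_of_nonneg_right h6 (by positivity)
  nlinarith

/-! ### One-step factors of the exponential process -/

section

variable {N K : ℕ}

theorem choicePMF_apply (S : Finset (Fin N)) (v : Fin N → ℝ≥0) (c : Fin (N + 1)) :
    choicePMF S v c = (choiceProb S v c : ℝ≥0∞) := rfl

theorem sum_choicePMF_mul_ofReal (S : Finset (Fin N)) (v : Fin N → ℝ≥0) {k : Fin (N + 1) → ℝ}
    (hk : ∀ c, 0 ≤ k c) : ∑ c, choicePMF S v c * ENNReal.ofReal (k c) =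
      ENNReal.ofReal (∑ c, (choiceProb S v c : ℝ) * k c) := by
  rw [ENNReal.ofReal_sum_of_nonneg fun c _ => mul_nonneg (NNReal.coe_nonneg _) (hk c)]
  refine Finset.sum_congr rfl fun c _ => ?_
  rw [ENNReal.ofReal_mul (NNReal.coe_nonneg _), ENNReal.ofReal_coe_nnreal, choicePMF_apply]

theorem sum_choiceProb_real (S : Finset (Fin N)) (v : Fin N → ℝ≥0) :
    ∑ c, (choiceProb S v c : ℝ) = 1 := by exact_mod_cast sum_choiceProb S v

theorem choiceProb_zero (S : Finset (Fin N)) (v : Fin N → ℝ≥0) :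
    (choiceProb S v 0 : ℝ) = 1 / (1 + ∑ j ∈ S, (v j : ℝ)) := by
  simp [choiceProb]

theorem choiceProb_succ {S : Finset (Fin N)} {i : Fin N} (hi : i ∈ S) (v : Fin N → ℝ≥0) :
    (choiceProb S v i.succ : ℝ) = v i / (1 + ∑ j ∈ S, (v j : ℝ)) := by
  simp [choiceProb, hi]

/-- The purchases of product `i` up to now in the episodes that offered it, including the current
one. -/
def TSState.total (s : TSState N) (i : Fin N) : ℕ :=
  s.bought i + if i ∈ s.assortment then s.current i else 0

/-- Purchases count immediately, but the compensator `mu` is charged only when an episode that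
offered `i` ends. -/
noncomputable def expProcess (lam mu : ℝ) (i : Fin N) (s : TSState N) : ℝ :=
  Real.exp (lam * s.total i - mu * s.served i)

noncomputable def expFactor (lam mu : ℝ) (i : Fin N) (S : Finset (Fin N)) (c : Fin (N + 1)) : ℝ :=
  if i ∈ S then (if c = 0 then Real.exp (-mu) else if c = i.succ then Real.exp lam else 1) else 1

theorem expFactor_nonneg (lam mu : ℝ) (i : Fin N) (S : Finset (Fin N)) (c : Fin (N + 1)) :
    0 ≤ expFactor lam mu i S c := by
  unfold expFactor; split_ifs <;> positivity

/-- Only "no purchase" and a purchase of `i` change the process. The mean change is `v i exp lam +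
exp (-mu) - (1 + v i)` over `1 + V`, where `V` is the total preference of `S`, so its sign does not
depend on the other products. -/
theorem sum_choiceProb_mul_expFactor_le {lam mu : ℝ} {i : Fin N} {v : Fin N → ℝ≥0}
    (h : v i * Real.exp lam + Real.exp (-mu) ≤ 1 + v i) (S : Finset (Fin N)) :
    ∑ c, (choiceProb S v c : ℝ) * expFactor lam mu i S c ≤ 1 := by
  by_cases hi : i ∈ S
  · have h1 : ∀ c, (choiceProb S v c : ℝ) * expFactor lam mu i S c = choiceProb S v c +
        ((if c = 0 then (choiceProb S v c : ℝ) * (Real.exp (-mu) - 1) else 0) +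
        (if c = i.succ then (choiceProb S v c : ℝ) * (Real.exp lam - 1) else 0)) := by
      intro c
      simp only [expFactor, hi, if_true]
      by_cases h0 : c = 0
      · subst h0
        simp [(Fin.succ_ne_zero i).symm]
        ring
      · simp only [h0, if_false]
        split_ifs <;> ring
    simp only [h1, Finset.sum_add_distrib, sum_choiceProb_real, Finset.sum_ite_eq',
      Finset.mem_univ, if_true]
    rw [choiceProb_zero, choiceProb_succ hi]
    have hV : (0 : ℝ) < 1 + ∑ j ∈ S, (v j : ℝ) := by positivity
    have : 1 / (1 + ∑ j ∈ S, (v j : ℝ)) * (Real.exp (-mu) - 1) +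
        v i / (1 + ∑ j ∈ S, (v j : ℝ)) * (Real.exp lam - 1) =
        (v i * Real.exp lam + Real.exp (-mu) - (1 + v i)) / (1 + ∑ j ∈ S, (v j : ℝ)) := by
      field_simp; ring
    rw [this]
    have := div_nonpos_of_nonpos_of_nonneg (sub_nonpos.2 h) hV.le
    linarith
  · simp [expFactor, hi, sum_choiceProb_real]

variable {T : ℕ} {pick : Finset (Fin N) → Fin N} {sel : (Fin N → ℝ) → Finset (Fin N)}

theorem expProcess_succ (lam mu : ℝ) (i : Fin N) (ω : Outcome N K) (t : ℕ) :
    expProcess lam mu i (tsState T pick sel ω (t + 1)) =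
      expProcess lam mu i (tsState T pick sel ω t) *
        expFactor lam mu i (tsState T pick sel ω t).assortment
          (ω.2 (t, (tsState T pick sel ω t).assortment)) := by
  simp only [tsState]
  set s := tsState T pick sel ω t
  set c := ω.2 (t, s.assortment)
  by_cases hi : i ∈ s.assortment
  · by_cases hc : c = 0
    · simp only [expProcess, expFactor, tsStep, TSState.total, hc, hi, if_true, ite_self, add_zero,
        ← Real.exp_add]
      push_cast
      ring_nf
    · by_cases hci : c = i.succ
      · have h0 : ¬ (i.succ : Fin (N + 1)) = 0 := Fin.succ_ne_zero i
        simp only [expProcess, expFactor, tsStep, TSState.total, hci, hi, if_true, h0, if_false,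
          ← Real.exp_add]
        push_cast
        ring_nf
      · simp only [expProcess, expFactor, tsStep, TSState.total, hc, hci, hi, if_true, if_false,
          mul_one]
  · by_cases hc : c = 0
    · simp only [expProcess, expFactor, tsStep, TSState.total, hc, hi, if_true, if_false, ite_self,
        add_zero, mul_one]
    · simp only [expProcess, expFactor, tsStep, TSState.total, hc, hi, if_false, add_zero, mul_one]

/-- The supermartingale property, tested against nonnegative functions of the past instead of being
stated with conditional expectations. -/
theorem lintegral_expProcess_succ_le (hsel : ∀ S, MeasurableSet {w | sel w = S})
    {lam mu : ℝ} {i : Fin N} {v : Fin N → ℝ≥0}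
    (h : v i * Real.exp lam + Real.exp (-mu) ≤ 1 + v i) {t : ℕ} {f : Outcome N K → ℝ≥0∞}
    (hf : Measurable f) (hft : DependsOnPast t f) :
    ∫⁻ ω, f ω * ENNReal.ofReal (expProcess lam mu i (tsState T pick sel ω (t + 1)))
        ∂(outcomeMeasure K v) ≤
      ∫⁻ ω, f ω * ENNReal.ofReal (expProcess lam mu i (tsState T pick sel ω t))
        ∂(outcomeMeasure K v) := by
  have hms := measurable_tsState (K := K) (T := T) (pick := pick) hsel t
  have hpast := dependsOnPast_tsState (K := K) (T := T) (pick := pick) (sel := sel) (le_refl t)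
  set F : Fin (N + 1) → Outcome N K → ℝ≥0∞ := fun c ω =>
    f ω * ENNReal.ofReal (expProcess lam mu i (tsState T pick sel ω t)) *
      ENNReal.ofReal (expFactor lam mu i (tsState T pick sel ω t).assortment c) with hF
  have h1 := lintegral_choice (t := t) v (A := fun ω => (tsState T pick sel ω t).assortment)
    (f := F) (fun S => hms (MeasurableSet.of_discrete (s := {s : TSState N | s.assortment = S})))
    (fun ω ω' h1 h2 => by simp only [hpast ω ω' h1 h2])
    (fun c => ((hf.mul ((Measurable.of_discrete
        (f := fun s => ENNReal.ofReal (expProcess lam mu i s))).comp hms)).mul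
      ((Measurable.of_discrete
        (f := fun s : TSState N => ENNReal.ofReal (expFactor lam mu i s.assortment c))).comp hms)))
    (fun c ω ω' h1 h2 => by
      have e := hpast ω ω' h1 h2
      simp only at e
      simp only [hF, hft ω ω' h1 h2, e])
  have h2 : ∀ ω, f ω * ENNReal.ofReal (expProcess lam mu i (tsState T pick sel ω (t + 1))) =
      F (ω.2 (t, (tsState T pick sel ω t).assortment)) ω := by
    intro ω
    rw [expProcess_succ, ENNReal.ofReal_mul (by unfold expProcess; positivity), ← mul_assoc]
  simp only [h2]
  rw [h1]
  refine lintegral_mono fun ω => ?_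
  simp only [hF]
  have h3 : ∀ a : ℝ≥0∞, ∑ c, choicePMF (tsState T pick sel ω t).assortment v c * (a *
      ENNReal.ofReal (expFactor lam mu i (tsState T pick sel ω t).assortment c)) =
      a * ∑ c, choicePMF (tsState T pick sel ω t).assortment v c *
      ENNReal.ofReal (expFactor lam mu i (tsState T pick sel ω t).assortment c) := by
    intro a
    rw [Finset.mul_sum]
    exact Finset.sum_congr rfl fun c _ => by ring
  rw [h3, sum_choicePMF_mul_ofReal _ _ (expFactor_nonneg _ _ _ _)]
  refine mul_le_of_le_one_right' ?_
  exact ENNReal.ofReal_le_one.2 (sum_choiceProb_mul_expFactor_le h _)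

/-- Ville's maximal inequality. -/
theorem measure_exists_expProcess_ge_le (hsel : ∀ S, MeasurableSet {w | sel w = S})
    {lam mu : ℝ} {i : Fin N} {v : Fin N → ℝ≥0}
    (h : v i * Real.exp lam + Real.exp (-mu) ≤ 1 + v i) (t : ℕ) (L : ℝ) :
    outcomeMeasure K v {ω | ∃ s ≤ t, L ≤ lam * (tsState T pick sel ω s).total i -
      mu * (tsState T pick sel ω s).served i} ≤ ENNReal.ofReal (Real.exp (-L)) := by
  classical
  set a : ℝ≥0∞ := ENNReal.ofReal (Real.exp L) with ha
  set M : ℕ → Outcome N K → ℝ≥0∞ := fun t ω =>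
    ENNReal.ofReal (expProcess lam mu i (tsState T pick sel ω t)) with hM
  have hMm : ∀ t, Measurable (M t) := fun t =>
    (Measurable.of_discrete (f := fun s => ENNReal.ofReal (expProcess lam mu i s))).comp
      (measurable_tsState hsel t)
  have hMt : ∀ s t, s ≤ t → DependsOnPast t (M s) := fun s t hst ω ω' h1 h2 => by
    have e := dependsOnPast_tsState (K := K) (T := T) (pick := pick) (sel := sel) hst ω ω' h1 h2
    simp only at e
    simp only [hM, e]
  set H : ℕ → Set (Outcome N K) := fun t => {ω | ∃ s < t, a ≤ M s ω} with hH
  have hHm : ∀ t, MeasurableSet (H t) := fun t => by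
    have : H t = ⋃ s ∈ Set.Iio t, {ω | a ≤ M s ω} := by ext; simp [hH]
    rw [this]
    exact MeasurableSet.biUnion (Set.to_countable _) fun s _ =>
      measurableSet_le measurable_const (hMm s)
  -- The process is replaced by the value `a` once it has reached that level. As `H t` only looks at
  -- times `s < t`, the event `H (t + 1)` is known at time `t`.
  have key : ∀ t, ∫⁻ ω, ((H t).indicator (fun _ => a) ω + (H t)ᶜ.indicator 1 ω * M t ω)
      ∂(outcomeMeasure K v) ≤ 1 := by
    intro t
    induction t with
    | zero =>
      have : ∀ ω, (H 0).indicator (fun _ => a) ω + (H 0)ᶜ.indicator 1 ω * M 0 ω = 1 := by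
        intro ω
        simp [hH, hM, expProcess, tsState, tsInit, TSState.total]
      simp only [this, lintegral_one, measure_univ, le_refl]
    | succ t ih =>
      refine le_trans ?_ ih
      rw [lintegral_add_left (measurable_const.indicator (hHm _))]
      have hstep := lintegral_expProcess_succ_le (K := K) (T := T) (pick := pick) hsel h (t := t)
        (f := (H (t + 1))ᶜ.indicator 1) (measurable_one.indicator (hHm _).compl)
        (fun ω ω' h1 h2 => by
          have : ω ∈ H (t + 1) ↔ ω' ∈ H (t + 1) := by
            simp only [hH, Set.mem_ofPred_eq]
            refine exists_congr fun s => and_congr_right fun hs => ?_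
            rw [hMt s t (by omega) ω ω' h1 h2]
          simp only [Set.indicator, Set.mem_compl_iff, this, Pi.one_apply])
      refine (add_le_add_right hstep _).trans ?_
      rw [← lintegral_add_left (measurable_const.indicator (hHm _))]
      refine lintegral_mono fun ω => ?_
      have hsplit : ω ∈ H (t + 1) ↔ ω ∈ H t ∨ a ≤ M t ω := by
        simp only [hH, Set.mem_ofPred_eq]
        constructor
        · rintro ⟨s, hs, hs'⟩
          rcases Nat.lt_succ_iff_lt_or_eq.1 hs with h | rfl
          · exact Or.inl ⟨s, h, hs'⟩
          · exact Or.inr hs'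
        · rintro (⟨s, hs, hs'⟩ | h)
          · exact ⟨s, by omega, hs'⟩
          · exact ⟨t, by omega, h⟩
      by_cases h1 : ω ∈ H t
      · have h2 : ω ∈ H (t + 1) := hsplit.2 (Or.inl h1)
        simp [Set.indicator, h1, h2]
      · by_cases h3 : a ≤ M t ω
        · have h2 : ω ∈ H (t + 1) := hsplit.2 (Or.inr h3)
          simpa [Set.indicator, h1, h2] using h3
        · have h2 : ω ∉ H (t + 1) := fun h => (hsplit.1 h).elim h1 h3
          simp [Set.indicator, h1, h2, hM]
  have h1 : a * outcomeMeasure K v (H (t + 1)) ≤ 1 := by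
    refine le_trans ?_ (key (t + 1))
    rw [← lintegral_indicator_const (hHm _)]
    exact lintegral_mono fun ω => le_self_add
  have hsub : {ω : Outcome N K | ∃ s ≤ t, L ≤ lam * (tsState T pick sel ω s).total i -
      mu * (tsState T pick sel ω s).served i} ⊆ H (t + 1) := by
    rintro ω ⟨s, hs, hs'⟩
    exact ⟨s, by omega, ENNReal.ofReal_le_ofReal (Real.exp_le_exp.2 hs')⟩
  refine (measure_mono hsub).trans ?_
  have h2 : ENNReal.ofReal (Real.exp (-L)) = a⁻¹ := by
    rw [ha, ← ENNReal.ofReal_inv_of_pos (Real.exp_pos _), Real.exp_neg]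
  rw [h2]
  have ha0 : a ≠ 0 := by simp [ha, Real.exp_pos]
  have hat : a ≠ ∞ := ENNReal.ofReal_ne_top
  rw [← one_div, ENNReal.le_div_iff_mul_le (Or.inl ha0) (Or.inl hat), mul_comm]
  exact h1

/-! ### Concentration of the estimates -/

theorem tsState_served_le (ω : Outcome N K) (t : ℕ) (i : Fin N) :
    (tsState T pick sel ω t).served i ≤ t := by
  induction t with
  | zero => exact le_rfl
  | succ t ih =>
    simp only [tsState, tsStep]
    split_ifs
    · simp only
      split_ifs <;> omega
    · simp only
      omega

/-- Take for `s` the beginning of the current episode. Lower deviations need the equality: `total`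
may exceed `bought` later, the wrong direction for a negative tilt. -/
theorem exists_total_eq_bought (ω : Outcome N K) (t : ℕ) :
    ∃ s ≤ t, (tsState T pick sel ω s).served = (tsState T pick sel ω t).served ∧
      ∀ i, (tsState T pick sel ω s).total i = (tsState T pick sel ω t).bought i := by
  induction t with
  | zero => exact ⟨0, le_rfl, rfl, fun i =>
      (Nat.zero_add _).trans (ite_self (0 : ℕ))⟩
  | succ t ih =>
    by_cases hc : ω.2 (t, (tsState T pick sel ω t).assortment) = 0
    · exact ⟨t + 1, le_rfl, rfl, fun i => by simp [tsState, tsStep, hc, TSState.total]⟩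
    · obtain ⟨s, hs, h1, h2⟩ := ih
      refine ⟨s, by omega, ?_, fun i => ?_⟩
      · simp only [tsState, tsStep, hc, if_false, h1]
      · simp only [tsState, tsStep, hc, if_false, h2]

/-- Some product was bought much more often than expected. -/
def UpperDeviation (v : Fin N → ℝ≥0) (L : ℝ) (s : TSState N) : Prop :=
  ∃ i, 5 * L * (1 + √(s.served i * v i)) < s.bought i - s.served i * v i

/-- Some product in `A` was bought much less often than expected. -/
def LowerDeviation (K T : ℕ) (v : Fin N → ℝ≥0) (A : Finset (Fin N)) (k : ℕ) (s : TSState N) :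
    Prop :=
  ∃ i ∈ A, 0 < s.served i ∧
    meanEst (s.served i) (s.bought i) + √k * sigmaHat K T (s.served i) (s.bought i) < v i

/-- A union bound over the products and the `t + 1` possible values `n` of the counter. The tilt is
of the natural order `1 / √(n v i)`, capped at `1/4` as required by `geometric_mgf_upper`. -/
theorem measure_upperDeviation_le (hsel : ∀ S, MeasurableSet {w | sel w = S})
    {v : Fin N → ℝ≥0} (hv : ∀ i, v i ≤ 1) {L : ℝ} (hL : 1 ≤ L) (t : ℕ) :
    outcomeMeasure K v {ω | UpperDeviation v L (tsState T pick sel ω t)} ≤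
      ENNReal.ofReal (N * (t + 1) * Real.exp (-L)) := by
  set lam : ℕ → Fin N → ℝ := fun n i => 1 / (4 * (1 + √(n * v i))) with hlam
  have hsub : {ω : Outcome N K | UpperDeviation v L (tsState T pick sel ω t)} ⊆
      ⋃ p ∈ (Finset.univ : Finset (Fin N)) ×ˢ Finset.range (t + 1),
        {ω : Outcome N K | ∃ s ≤ t, L ≤ lam p.2 p.1 * (tsState T pick sel ω s).total p.1 -
          (lam p.2 p.1 * v p.1 + 3 * v p.1 * lam p.2 p.1 ^ 2) *
            (tsState T pick sel ω s).served p.1} := by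
    rintro ω ⟨i, hi⟩
    simp only [Set.mem_iUnion]
    refine ⟨(i, (tsState T pick sel ω t).served i), ?_, t, le_rfl, ?_⟩
    · simpa using Nat.lt_succ_of_le (tsState_served_le ω t i)
    · simp only
      set s := tsState T pick sel ω t
      set n : ℝ := (s.served i : ℝ)
      have hn : 0 ≤ n := Nat.cast_nonneg _
      have hv0 : (0 : ℝ) ≤ v i := (v i).2
      have hq := Real.sqrt_nonneg (n * v i)
      have hq2 := Real.sq_sqrt (mul_nonneg hn hv0)
      set q := √(n * v i)
      have hl : lam (s.served i) i = 1 / (4 * (1 + q)) := rfl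
      rw [hl]
      have htot : (s.bought i : ℝ) ≤ s.total i := by
        exact_mod_cast Nat.le_add_right _ _
      have h1 : 0 < 4 * (1 + q) := by positivity
      have h2 : (1 / (4 * (1 + q))) * (5 * L * (1 + q)) ≤
          (1 / (4 * (1 + q))) * (s.total i - n * v i) :=
        mul_le_mul_of_nonneg_left (by linarith) (by positivity)
      -- As `L ≥ 1`, the gain `5 L / 4` exceeds `L` by at least `1/4`, which absorbs the quadratic
      -- term `3/16`.
      have h3 : (1 / (4 * (1 + q))) * (5 * L * (1 + q)) = 5 * L / 4 := by field_simp
      have h4 : 3 * v i * (1 / (4 * (1 + q))) ^ 2 * n ≤ 3 / 16 := by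
        have : 3 * v i * (1 / (4 * (1 + q))) ^ 2 * n = 3 / 16 * (q ^ 2 / (1 + q) ^ 2) := by
          rw [hq2]; field_simp; ring
        rw [this]
        have : q ^ 2 / (1 + q) ^ 2 ≤ 1 := by
          rw [div_le_one (by positivity)]; nlinarith
        linarith
      nlinarith
  refine (measure_mono hsub).trans ((measure_biUnion_finset_le _ _).trans ?_)
  refine (Finset.sum_le_sum fun p _ => measure_exists_expProcess_ge_le (K := K) hsel (v := v)
    (geometric_mgf_upper (v p.1).2 (by exact_mod_cast hv p.1) (by positivity) ?_) t L).trans ?_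
  · rw [hlam]
    refine one_div_le_one_div_of_le (by norm_num) ?_
    have := Real.sqrt_nonneg ((p.2 : ℝ) * v p.1)
    linarith
  · rw [Finset.sum_const, Finset.card_product, Finset.card_univ, Fintype.card_fin,
      Finset.card_range, nsmul_eq_mul, ENNReal.ofReal_mul (by positivity)]
    gcongr
    rw [← ENNReal.ofReal_natCast]
    push_cast
    rfl

theorem lowerDeviation_counts {v k : ℝ} {Ti ni T : ℕ} (hTi : 0 < Ti)
    (h : meanEst Ti ni + √k * sigmaHat K T Ti ni < v) :
    √k * (√(50 * ni) + 75 * √(Real.log (T * K))) < Ti * v - ni := by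
  have hn' : (0 : ℝ) < Ti := by exact_mod_cast hTi
  have hmean : 0 ≤ meanEst Ti ni := by unfold meanEst; positivity
  have h1 : Ti * meanEst Ti ni = ni := by
    unfold meanEst; exact mul_div_cancel₀ _ hn'.ne'
  have h2 : √(50 * ni) + 75 * √(Real.log (T * K)) ≤ Ti * sigmaHat K T Ti ni := by
    unfold sigmaHat
    rw [mul_add]
    refine add_le_add ?_ (le_of_eq ?_)
    · rw [Real.sqrt_le_left (by positivity), mul_pow, Real.sq_sqrt (by positivity)]
      have : (Ti : ℝ) ^ 2 * (50 * meanEst Ti ni * (meanEst Ti ni + 1) / Ti) =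
          50 * (Ti * meanEst Ti ni) * (meanEst Ti ni + 1) := by
        field_simp
      rw [this, h1]
      have : (0 : ℝ) ≤ ni := Nat.cast_nonneg _
      nlinarith
    · exact (mul_div_cancel₀ _ hn'.ne').symm
  have h3 := mul_lt_mul_of_pos_left h hn'
  rw [mul_add, h1] at h3
  have h4 := mul_le_mul_of_nonneg_left h2 (Real.sqrt_nonneg k)
  nlinarith

/-- If this fails, then `D < l (x + y)`. Since `(x + y)² ≤ 4.5 x y` for `y ≤ x ≤ 2 y`, it follows
that `D² < 22.5 k (D + a)`. By `hD2` the part with `a` is at most `0.45 D²`, so `D < 41 k`, against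
`D² > (75 k)²`. -/
theorem le_of_sq_deviation_gt {k a x y l D : ℝ} (hk : 0 < k) (ha : 0 ≤ a) (hy0 : 0 < y)
    (hxy1 : y ≤ x) (hxy2 : x ≤ 2 * y) (hl0 : 0 < l) (hl2 : l ^ 2 * y = 5 * k) (hD : D = x - a)
    (hDpos : 0 < D) (hD2 : 50 * k * a + 5625 * k ^ 2 < D ^ 2) : 5 * k + x * l ^ 2 ≤ l * D := by
  by_contra hcon
  push Not at hcon
  have h2 : l * D < l * (l * (y + x)) := by linarith
  have h3 : D < l * (y + x) := lt_of_mul_lt_mul_left h2 hl0.le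
  have h4 : D ^ 2 < l ^ 2 * (y + x) ^ 2 := by
    rw [← mul_pow]
    exact pow_lt_pow_left₀ h3 hDpos.le (by norm_num)
  have h5 : (y + x) ^ 2 ≤ 4.5 * (y * x) := by nlinarith
  have h6 : D ^ 2 < 22.5 * k * x := by
    have h7 : l ^ 2 * (y + x) ^ 2 ≤ l ^ 2 * (4.5 * (y * x)) := by gcongr
    have h8 : l ^ 2 * (4.5 * (y * x)) = 4.5 * (l ^ 2 * y) * x := by ring
    rw [h8, hl2] at h7
    linarith
  have hxD : x = D + a := by rw [hD]; ring
  rw [hxD] at h6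
  have hka := mul_nonneg hk.le ha
  have h8 : D * (0.55 * D) < D * (22.5 * k) := by nlinarith
  have h9 : 0.55 * D < 22.5 * k := lt_of_mul_lt_mul_left h8 hDpos.le
  nlinarith

/-- Peeling: one tilt serves each dyadic range of the counter, so all times together cost a factor
`log T` instead of `T`. Only the at most `K` products of `A` enter the union bound. -/
theorem measure_exists_lowerDeviation_le (hsel : ∀ S, MeasurableSet {w | sel w = S})
    (hK : 1 ≤ K) {v : Fin N → ℝ≥0} (hv : ∀ i, v i ≤ 1) {A : Finset (Fin N)} (hA : A.card ≤ K)
    {k : ℕ} (hk : (k : ℝ) ≤ Real.log (T * K)) :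
    outcomeMeasure K v {ω | ∃ t ≤ T, LowerDeviation K T v A k (tsState T pick sel ω t)} ≤
      ENNReal.ofReal (K * (Nat.log 2 T + 1) * Real.exp (-(5 * k))) := by
  -- At level `0` the right side is at least `1`.
  rcases Nat.eq_zero_or_pos k with rfl | hk0
  · refine prob_le_one.trans ?_
    rw [← ENNReal.ofReal_one]
    refine ENNReal.ofReal_le_ofReal ?_
    have : (1 : ℝ) ≤ K := by exact_mod_cast hK
    have h2 : (0 : ℝ) ≤ Nat.log 2 T := Nat.cast_nonneg _
    simp
    nlinarith
  have hkpos : (0 : ℝ) < k := by exact_mod_cast hk0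
  set lam : ℕ → Fin N → ℝ := fun m i => √(5 * k / (2 ^ m * v i)) with hlam
  have hsub : {ω : Outcome N K | ∃ t ≤ T, LowerDeviation K T v A k (tsState T pick sel ω t)} ⊆
      ⋃ p ∈ A ×ˢ Finset.range (Nat.log 2 T + 1),
        {ω : Outcome N K | ∃ s ≤ T, 5 * k ≤ -lam p.2 p.1 * (tsState T pick sel ω s).total p.1 -
          (-lam p.2 p.1 * v p.1 + v p.1 * lam p.2 p.1 ^ 2) *
            (tsState T pick sel ω s).served p.1} := by
    rintro ω ⟨t, ht, i, hiA, hn, hi⟩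
    obtain ⟨s, hs, hs1, hs2⟩ := exists_total_eq_bought (T := T) (pick := pick) (sel := sel) ω t
    simp only [Set.mem_iUnion]
    refine ⟨(i, Nat.log 2 ((tsState T pick sel ω t).served i)), ?_, s, hs.trans ht, ?_⟩
    · simp only [Finset.mem_product, hiA, true_and, Finset.mem_range]
      exact Nat.lt_succ_of_le (Nat.log_mono_right ((tsState_served_le ω t i).trans ht))
    · simp only [hs1, hs2]
      set z := tsState T pick sel ω t
      have hn' : (0 : ℝ) < z.served i := by exact_mod_cast hn
      set m := Nat.log 2 (z.served i)
      have hm1 : (2 : ℝ) ^ m ≤ z.served i := by exact_mod_cast Nat.pow_log_le_self 2 hn.ne'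
      have hm2 : (z.served i : ℝ) ≤ 2 * 2 ^ m := by
        have := (Nat.lt_pow_succ_log_self (b := 2) (by norm_num) (z.served i)).le
        rw [pow_succ, mul_comm] at this
        exact_mod_cast this
      have hm0 : (0 : ℝ) < 2 ^ m := by positivity
      set n : ℝ := (z.served i : ℝ)
      set a : ℝ := (z.bought i : ℝ) with haa
      have ha : 0 ≤ a := Nat.cast_nonneg _
      have hvi : (0 : ℝ) < v i := by
        refine lt_of_le_of_lt ?_ hi
        have hmean : 0 ≤ meanEst (z.served i) (z.bought i) := by unfold meanEst; positivity
        have : 0 ≤ sigmaHat K T (z.served i) (z.bought i) := by unfold sigmaHat; positivity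
        positivity
      have hdev := lowerDeviation_counts hn hi
      set D := n * v i - a with hD
      have hDpos : 0 < D := lt_of_le_of_lt (by positivity) hdev
      have hD2 : 50 * k * a + 5625 * k ^ 2 < D ^ 2 := by
        have h1 := pow_lt_pow_left₀ hdev (by positivity) (n := 2) (by norm_num)
        refine lt_of_le_of_lt ?_ h1
        rw [mul_pow, Real.sq_sqrt hkpos.le]
        -- By `k ≤ log (T K)` the second term of `σ̂` contributes at least `75² k`.
        have h2 : 50 * a + 5625 * k ≤ (√(50 * a) + 75 * √(Real.log (T * K))) ^ 2 := by
          have e1 := Real.sq_sqrt (by positivity : 0 ≤ 50 * a)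
          have e2 := Real.sq_sqrt (hkpos.le.trans hk)
          have e3 := mul_nonneg (Real.sqrt_nonneg (50 * a)) (Real.sqrt_nonneg (Real.log (T * K)))
          nlinarith
        nlinarith [mul_le_mul_of_nonneg_left h2 hkpos.le]
      have hl : lam m i = √(5 * k / (2 ^ m * v i)) := rfl
      set l := lam m i
      have hl0 : 0 < l := by rw [hl]; positivity
      have hl2 : l ^ 2 * (2 ^ m * v i) = 5 * k := by
        rw [hl, Real.sq_sqrt (by positivity)]; field_simp
      have hfin := le_of_sq_deviation_gt hkpos ha (y := 2 ^ m * v i) (x := n * v i) (by positivity)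
        (by gcongr) (by rw [← mul_assoc]; gcongr) hl0 hl2 hD hDpos hD2
      rw [hD] at hfin
      linarith
  refine (measure_mono hsub).trans ((measure_biUnion_finset_le _ _).trans ?_)
  refine (Finset.sum_le_sum fun p _ => measure_exists_expProcess_ge_le (K := K) hsel (v := v)
    (geometric_mgf_lower (v p.1).2 (by exact_mod_cast hv p.1) (by positivity)) T (5 * k)).trans ?_
  rw [Finset.sum_const, Finset.card_product, Finset.card_range, nsmul_eq_mul,
    ENNReal.ofReal_mul (by positivity)]
  gcongr
  rw [← ENNReal.ofReal_natCast]
  refine ENNReal.ofReal_le_ofReal ?_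
  push_cast
  gcongr

end

end MNLBandit

namespace MNLBandit

/-! ### Gaussian estimates -/

/-- On the unit interval `[x, x + 1]` the density is at least its value at `x + 1`. -/
theorem gaussian_tail_ge {x : ℝ} (hx : 0 ≤ x) :
    Real.exp (-(x + 1) ^ 2 / 2) / √(2 * Real.pi) ≤ (gaussianReal 0 1).real (Set.Ici x) := by
  have h1 : ENNReal.ofReal (Real.exp (-(x + 1) ^ 2 / 2) / √(2 * Real.pi)) ≤
      gaussianReal 0 1 (Set.Ici x) := by
    rw [gaussianReal_apply _ one_ne_zero]
    calc ENNReal.ofReal (Real.exp (-(x + 1) ^ 2 / 2) / √(2 * Real.pi))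
        = ∫⁻ y in Set.Icc x (x + 1),
            ENNReal.ofReal (Real.exp (-(x + 1) ^ 2 / 2) / √(2 * Real.pi)) := by
          rw [setLIntegral_const, Real.volume_Icc]; simp
      _ ≤ ∫⁻ y in Set.Icc x (x + 1), gaussianPDF 0 1 y := by
          refine setLIntegral_mono' measurableSet_Icc fun y hy => ?_
          refine ENNReal.ofReal_le_ofReal ?_
          rw [gaussianPDFReal, div_eq_inv_mul]
          simp only [NNReal.coe_one, mul_one, sub_zero]
          gcongr
          · exact hx.trans hy.1
          · exact hy.2
      _ ≤ ∫⁻ y in Set.Ici x, gaussianPDF 0 1 y :=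
          lintegral_mono_set Set.Icc_subset_Ici_self
  rw [Measure.real]
  exact (ENNReal.ofReal_le_iff_le_toReal (measure_ne_top _ _)).1 h1

theorem lintegral_ofReal_abs_gaussian_le :
    ∫⁻ y, ENNReal.ofReal |y| ∂(gaussianReal 0 1) ≤ 1 := by
  have hint2 : Integrable (fun y : ℝ => y ^ 2) (gaussianReal 0 1) :=
    (memLp_id_gaussianReal (μ := 0) (v := 1) 2).integrable_sq
  have h2 : ∫ y, y ^ 2 ∂(gaussianReal 0 1) = 1 := by
    have := variance_eq_sub (memLp_id_gaussianReal (μ := 0) (v := 1) 2)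
    rw [variance_id_gaussianReal] at this
    simpa [integral_id_gaussianReal] using this.symm
  calc ∫⁻ y, ENNReal.ofReal |y| ∂(gaussianReal 0 1)
      ≤ ∫⁻ y, ENNReal.ofReal ((1 + y ^ 2) / 2) ∂(gaussianReal 0 1) := by
        refine lintegral_mono fun y => ENNReal.ofReal_le_ofReal ?_
        nlinarith [sq_nonneg (|y| - 1), sq_abs y]
    _ = ENNReal.ofReal (∫ y, (1 + y ^ 2) / 2 ∂(gaussianReal 0 1)) :=
        (ofReal_integral_eq_lintegral_ofReal (((integrable_const 1).add hint2).div_const 2)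
          (ae_of_all _ fun y => by change 0 ≤ (1 + y ^ 2) / 2; positivity)).symm
    _ = 1 := by
        rw [integral_div, integral_add (integrable_const 1) hint2, h2]
        simp

theorem lintegral_ofReal_exp_gaussian (a : ℝ) :
    ∫⁻ y, ENNReal.ofReal (Real.exp (a * y)) ∂(gaussianReal 0 1) =
      ENNReal.ofReal (Real.exp (a ^ 2 / 2)) := by
  rw [← ofReal_integral_eq_lintegral_ofReal (integrable_exp_mul_gaussianReal a)
    (ae_of_all _ fun y => (Real.exp_pos _).le)]
  have := congrFun (mgf_id_gaussianReal (μ := 0) (v := 1)) a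
  simp only [mgf, id] at this
  rw [this]
  simp

/-- The probability that `n` trials fail is compared with the probability that one of `n + 1`
succeeds. With `n + 1 = K`, one of the two powers of `n + 1` pays for the episode length and the
other one leaves the factor `1 / K` in `optimismCost`. -/
theorem sq_mul_pow_le_one_sub_pow {p : ℝ} (hp0 : 0 ≤ p) (hp1 : p ≤ 1) (n : ℕ) :
    p ^ 2 * (n + 1 : ℝ) ^ 2 * (1 - p) ^ n ≤ 2 * (1 - (1 - p) ^ (n + 1)) := by
  induction n with
  | zero => simp; nlinarith
  | succ n ih =>
    have hq : 0 ≤ (1 - p) ^ (n + 1) := pow_nonneg (by linarith) _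
    -- Bernoulli's inequality for `1 / (1 - p)`
    have hb : ∀ m : ℕ, (1 - p) ^ m * (1 + m * p) ≤ 1 := by
      intro m
      induction m with
      | zero => simp
      | succ m ihm =>
        have hm : 0 ≤ (1 - p) ^ m := pow_nonneg (by linarith) _
        rw [pow_succ]
        push_cast
        have : (1 - p) ^ m * (1 - p) * (1 + (m + 1) * p) =
          (1 - p) ^ m * (1 + m * p) - (1 - p) ^ m * ((m + 1) * p ^ 2) := by ring
        rw [this]
        have : 0 ≤ (1 - p) ^ m * ((m + 1) * p ^ 2) := by positivity
        linarith
    have hb' := hb (n + 1)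
    push_cast at hb' ⊢
    have h1 := mul_le_mul_of_nonneg_left ih (by linarith : 0 ≤ 1 - p)
    -- After multiplication of the induction hypothesis by `1 - p`, this is what remains; it follows
    -- from Bernoulli's inequality.
    have h2 : p * (p * (2 * n + 3) * (1 - p) ^ (n + 1)) ≤ p * 2 := by
      refine mul_le_mul_of_nonneg_left ?_ hp0
      nlinarith
    have e1 : (1 - p) * (p ^ 2 * (n + 1 : ℝ) ^ 2 * (1 - p) ^ n) =
      p ^ 2 * (n + 1 : ℝ) ^ 2 * (1 - p) ^ (n + 1) := by ring
    have e2 : (1 - p) * (2 * (1 - (1 - p) ^ (n + 1))) =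
      2 * (1 - (1 - p) ^ (n + 1 + 1)) - 2 * p := by ring
    rw [e1, e2] at h1
    nlinarith

theorem lintegral_pi_prod {ι : Type*} [Fintype ι] (ν : Measure ℝ) [IsProbabilityMeasure ν]
    {f : ι → ℝ → ℝ≥0∞} (hf : ∀ i, Measurable (f i)) :
    ∫⁻ x, ∏ i, f i (x i) ∂(Measure.pi fun _ : ι => ν) = ∏ i, ∫⁻ y, f i y ∂ν := by
  have hind : iIndepFun (fun i (x : ι → ℝ) => f i (x i)) (Measure.pi fun _ : ι => ν) :=
    iIndepFun_pi (X := fun i => f i) fun i => (hf i).aemeasurable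
  rw [lintegral_prod_eq_prod_lintegral_of_indepFun Finset.univ _ hind
    fun i => (hf i).comp (measurable_pi_apply i)]
  refine Finset.prod_congr rfl fun i _ => ?_
  exact (measurePreserving_eval (fun _ : ι => ν) i).lintegral_comp (hf i)

/-! ### The largest of `K` Gaussian samples -/

section

variable {N K : ℕ}

theorem sampleMeasure_iSup_lt (hK : 1 ≤ K) (x : ℝ) :
    sampleMeasure K {θ | (⨆ j, θ j) < x} = (gaussianReal 0 1 (Set.Iio x)) ^ K := by
  have : Nonempty (Fin K) := ⟨⟨0, hK⟩⟩
  have h : {θ : Fin K → ℝ | (⨆ j, θ j) < x} = Set.univ.pi fun _ => Set.Iio x := by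
    ext θ
    simp only [Set.mem_ofPred_eq, Set.mem_pi, Set.mem_univ, true_imp_iff, Set.mem_Iio]
    constructor
    · exact fun h j => (le_ciSup (Set.finite_range θ).bddAbove j).trans_lt h
    · intro h
      obtain ⟨j, hj⟩ := exists_eq_ciSup_of_finite (f := θ)
      exact hj ▸ h j
  rw [h, sampleMeasure, Measure.pi_pi]
  simp

theorem measurable_iSup_sample : Measurable fun θ : Fin K → ℝ => ⨆ j, θ j :=
  Measurable.iSup fun j => measurable_pi_apply j

/-- If all samples are below `x`, one fixed sample `θ j₀` controls the maximum: its absolute value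
is at most `x + |θ j₀|`. Each of the other `K - 1` independent samples contributes the probability
of lying below `x`. -/
theorem lintegral_abs_iSup_le (hK : 1 ≤ K) {x : ℝ} (hx : 0 ≤ x) :
    ∫⁻ θ, {θ : Fin K → ℝ | (⨆ j, θ j) < x}.indicator
        (fun θ => ENNReal.ofReal (1 + |⨆ j, θ j|)) θ ∂(sampleMeasure K) ≤
      ENNReal.ofReal (2 + x) * (gaussianReal 0 1 (Set.Iio x)) ^ (K - 1) := by
  have : Nonempty (Fin K) := ⟨⟨0, hK⟩⟩
  set j₀ : Fin K := ⟨0, hK⟩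
  set f : Fin K → ℝ → ℝ≥0∞ := fun j y =>
    if j = j₀ then ENNReal.ofReal (1 + x + |y|) else (Set.Iio x).indicator 1 y
  have hf : ∀ j, Measurable (f j) := by
    intro j
    by_cases h : j = j₀
    · simp only [f, h, if_true]; fun_prop
    · simp only [f, h, if_false]; exact measurable_one.indicator measurableSet_Iio
  have h1 : ∀ θ : Fin K → ℝ, {θ : Fin K → ℝ | (⨆ j, θ j) < x}.indicator
      (fun θ => ENNReal.ofReal (1 + |⨆ j, θ j|)) θ ≤ ∏ j, f j (θ j) := by
    intro θ
    by_cases h : (⨆ j, θ j) < x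
    · rw [Set.indicator_of_mem (show θ ∈ {θ : Fin K → ℝ | (⨆ j, θ j) < x} from h)]
      have hlt : ∀ j, θ j < x := fun j =>
        (le_ciSup (Set.finite_range θ).bddAbove j).trans_lt h
      rw [← Finset.mul_prod_erase Finset.univ _ (Finset.mem_univ j₀),
        Finset.prod_eq_one (s := Finset.univ.erase j₀), mul_one]
      · simp only [f, if_true]
        refine ENNReal.ofReal_le_ofReal ?_
        have h2 : θ j₀ ≤ ⨆ j, θ j := le_ciSup (Set.finite_range θ).bddAbove j₀
        have h3 : |⨆ j, θ j| ≤ x + |θ j₀| := by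
          rw [abs_le]
          constructor
          · have := neg_abs_le (θ j₀); linarith
          · have := abs_nonneg (θ j₀); linarith
        linarith
      · intro j hj
        simp only [f, Finset.ne_of_mem_erase hj, if_false]
        exact Set.indicator_of_mem (show θ j ∈ Set.Iio x from hlt j) (1 : ℝ → ℝ≥0∞)
    · rw [Set.indicator_of_notMem (show θ ∉ {θ : Fin K → ℝ | (⨆ j, θ j) < x} from h)]
      exact zero_le
  refine (lintegral_mono h1).trans ?_
  rw [sampleMeasure, lintegral_pi_prod _ hf,
    ← Finset.mul_prod_erase Finset.univ _ (Finset.mem_univ j₀)]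
  refine mul_le_mul' ?_ (le_of_eq ?_)
  · simp only [f, if_true]
    have h2 : ∀ y : ℝ, ENNReal.ofReal (1 + x + |y|) = ENNReal.ofReal (1 + x) + ENNReal.ofReal |y| :=
      fun y => ENNReal.ofReal_add (by positivity) (abs_nonneg _)
    simp only [h2]
    rw [lintegral_add_left measurable_const, lintegral_const, measure_univ, mul_one,
      show 2 + x = (1 + x) + 1 by ring, ENNReal.ofReal_add (by positivity) zero_le_one,
      ENNReal.ofReal_one]
    exact add_le_add_right lintegral_ofReal_abs_gaussian_le _
  · rw [Finset.prod_congr rfl (g := fun _ => gaussianReal 0 1 (Set.Iio x)), Finset.prod_const,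
      Finset.card_erase_of_mem (Finset.mem_univ _), Finset.card_univ, Fintype.card_fin]
    intro j hj
    simp only [f, Finset.ne_of_mem_erase hj, if_false]
    exact lintegral_indicator_one measurableSet_Iio

/-- The price of a non-optimistic sample, if optimism requires a sample of at least `√k`. -/
noncomputable def optimismCost (K k : ℕ) : ℝ := 16 * Real.pi * Real.exp 5 * Real.exp (3 / 2 * k) / K

theorem optimismCost_nonneg (K k : ℕ) : 0 ≤ optimismCost K k := by
  unfold optimismCost; positivity

/-- With `p` the chance that one sample reaches `x = √k`, the left side is at most `2 K (2 + x) (1 -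
p) ^ (K - 1)`. By `sq_mul_pow_le_one_sub_pow` this is at most `4 (2 + x) / (K p²)` times the chance
that the largest sample reaches `x`. -/
theorem lintegral_abs_iSup_le_optimismCost (hK : 1 ≤ K) (k : ℕ) :
    (1 + K : ℝ≥0∞) * ∫⁻ θ, {θ : Fin K → ℝ | (⨆ j, θ j) < √k}.indicator
        (fun θ => ENNReal.ofReal (1 + |⨆ j, θ j|)) θ ∂(sampleMeasure K) ≤
      ENNReal.ofReal (optimismCost K k) * sampleMeasure K {θ | √k ≤ ⨆ j, θ j} := by
  have hx : (0 : ℝ) ≤ √k := Real.sqrt_nonneg _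
  have hxk : √(k : ℝ) ^ 2 = k := Real.sq_sqrt (Nat.cast_nonneg k)
  set x : ℝ := √k
  set p : ℝ := (gaussianReal 0 1).real (Set.Ici x) with hp
  have hp1 : p ≤ 1 := measureReal_le_one
  have hplow := gaussian_tail_ge hx
  rw [← hp] at hplow
  have hp0 : 0 < p := lt_of_lt_of_le (by positivity) hplow
  have hq : gaussianReal 0 1 (Set.Iio x) = ENNReal.ofReal (1 - p) := by
    rw [hp, ← probReal_compl_eq_one_sub measurableSet_Ici, Set.compl_Ici, ofReal_measureReal]
  have hms : MeasurableSet {θ : Fin K → ℝ | (⨆ j, θ j) < x} :=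
    measurableSet_lt measurable_iSup_sample measurable_const
  have hp' : sampleMeasure K {θ : Fin K → ℝ | x ≤ ⨆ j, θ j} = ENNReal.ofReal (1 - (1 - p) ^ K) := by
    have : {θ : Fin K → ℝ | x ≤ ⨆ j, θ j} = {θ : Fin K → ℝ | (⨆ j, θ j) < x}ᶜ := by
      ext; simp
    rw [this, prob_compl_eq_one_sub hms, sampleMeasure_iSup_lt hK, hq,
      ← ENNReal.ofReal_pow (by linarith), ENNReal.ofReal_sub _ (pow_nonneg (by linarith) _),
      ENNReal.ofReal_one]
  refine (mul_le_mul_right (lintegral_abs_iSup_le hK hx) _).trans ?_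
  have hKc : (1 + K : ℝ≥0∞) = ENNReal.ofReal (1 + K) := by
    rw [ENNReal.ofReal_add zero_le_one (Nat.cast_nonneg _)]; simp
  rw [hp', hq, hKc, ← ENNReal.ofReal_pow (by linarith), ← ENNReal.ofReal_mul (by positivity),
    ← ENNReal.ofReal_mul (by positivity), ← ENNReal.ofReal_mul (optimismCost_nonneg _ _)]
  refine ENNReal.ofReal_le_ofReal ?_
  obtain ⟨n, rfl⟩ : ∃ n, K = n + 1 := ⟨K - 1, by omega⟩
  have hmain := sq_mul_pow_le_one_sub_pow hp0.le hp1 n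
  simp only [Nat.add_sub_cancel]
  have hq0 : 0 ≤ (1 - p) ^ n := pow_nonneg (by linarith) _
  have hn : (0 : ℝ) ≤ n := Nat.cast_nonneg n
  -- the lower bound on the tail
  have hexp : 4 * (2 + x) ≤ optimismCost (n + 1) k * (n + 1) * p ^ 2 := by
    have h1 : optimismCost (n + 1) k * (n + 1) =
        16 * Real.pi * Real.exp 5 * Real.exp (3 / 2 * k) := by
      unfold optimismCost; push_cast; field_simp
    have h2 : Real.exp (-(x + 1) ^ 2) / (2 * Real.pi) ≤ p ^ 2 := by
      have h3 := pow_le_pow_left₀ (by positivity) hplow 2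
      rw [div_pow, Real.sq_sqrt (by positivity), ← Real.exp_nat_mul] at h3
      refine le_trans (le_of_eq ?_) h3
      congr 2
      push_cast; ring
    rw [h1]
    have h3 : (2 + x) ≤ 2 * Real.exp (x / 2) := by
      have := Real.add_one_le_exp (x / 2); linarith
    calc 4 * (2 + x) ≤ 8 * Real.exp (x / 2) := by linarith
      _ ≤ 8 * Real.exp (5 + 3 / 2 * k - (x + 1) ^ 2) := by
          gcongr
          -- As `x² = k`, the exponents differ by `(x - 5/2)² / 2 + 7/8`; this explains the
          -- constants `5` and `3/2` in `optimismCost`.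
          nlinarith [sq_nonneg (x - 5 / 2)]
      _ = 16 * Real.pi * Real.exp 5 * Real.exp (3 / 2 * k) *
            (Real.exp (-(x + 1) ^ 2) / (2 * Real.pi)) := by
          rw [sub_eq_add_neg, Real.exp_add, Real.exp_add]
          field_simp
          norm_num
      _ ≤ _ := by gcongr
  have hp2 : 0 < p ^ 2 := by positivity
  have hn1 : (0 : ℝ) < n + 1 := by positivity
  refine le_of_mul_le_mul_left ?_ (mul_pos hp2 hn1)
  have hD : 0 ≤ 1 - (1 - p) ^ (n + 1) := by
    have := pow_le_one₀ (n := n + 1) (by linarith : 0 ≤ 1 - p) (by linarith); linarith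
  calc p ^ 2 * (n + 1) * ((1 + ((n + 1 : ℕ) : ℝ)) * ((2 + x) * (1 - p) ^ n))
      ≤ p ^ 2 * (n + 1) * ((2 * (n + 1)) * ((2 + x) * (1 - p) ^ n)) := by
        push_cast
        gcongr
        linarith
    _ = 2 * (2 + x) * (p ^ 2 * (n + 1) ^ 2 * (1 - p) ^ n) := by ring
    _ ≤ 2 * (2 + x) * (2 * (1 - (1 - p) ^ (n + 1))) := by gcongr
    _ = 4 * (2 + x) * (1 - (1 - p) ^ (n + 1)) := by ring
    _ ≤ optimismCost (n + 1) k * (n + 1) * p ^ 2 * (1 - (1 - p) ^ (n + 1)) := by gcongr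
    _ = _ := by ring

/-! ### The price of non-optimistic samples -/

variable {U : (ℝ → ℝ) → ℝ} {r : Fin N → ℝ} {T : ℕ} {pick : Finset (Fin N) → Fin N}
  {sel : (Fin N → ℝ) → Finset (Fin N)}

/-- The optimal value for the virtual preferences. -/
noncomputable def virtualValue (U : (ℝ → ℝ) → ℝ) (r : Fin N → ℝ) (K T : ℕ)
    (sel : (Fin N → ℝ) → Finset (Fin N)) (served bought : Fin N → ℕ) (θ : Fin K → ℝ) : ℝ :=
  U (profitCDF r (sel (virtualPref K T served bought θ))
    fun i => (virtualPref K T served bought θ i).toNNReal)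

/-- The total width of the confidence intervals of the products in an assortment. -/
noncomputable def width (K T : ℕ) (served bought : Fin N → ℕ) (S : Finset (Fin N)) : ℝ :=
  ∑ i ∈ S, sigmaHat K T (served i) (bought i)

theorem sigmaHat_nonneg (K T Ti ni : ℕ) : 0 ≤ sigmaHat K T Ti ni := by
  unfold sigmaHat meanEst; positivity

theorem width_nonneg (K T : ℕ) (served bought : Fin N → ℕ) (S : Finset (Fin N)) :
    0 ≤ width K T served bought S :=
  Finset.sum_nonneg fun _ _ => sigmaHat_nonneg _ _ _ _

theorem le_virtualValue_of_optimistic (hK : 1 ≤ K) (hU : QuasiconvexRisk U)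
    (hr : ∀ i, 0 < r i ∧ r i ≤ 1)
    (hsel : ∀ w, IsSmallestOptimal U r K w (sel w)) {v : Fin N → ℝ≥0} {A : Finset (Fin N)}
    (hA : A.card ≤ K) {served bought : Fin N → ℕ} {x : ℝ}
    (hx : ∀ i ∈ A, (v i : ℝ) ≤
      meanEst (served i) (bought i) + x * sigmaHat K T (served i) (bought i))
    {θ : Fin K → ℝ} (hθ : x ≤ ⨆ j, θ j) :
    U (profitCDF r A v) ≤ virtualValue U r K T sel served bought θ := by
  refine (hsel _).1.optimistic hU hr hA fun i hi => ?_
  rw [virtualPref_eq hK]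
  refine (hx i hi).trans ?_
  have := mul_le_mul_of_nonneg_right hθ (sigmaHat_nonneg K T (served i) (bought i))
  linarith

/-- The virtual preferences differ by the gap of the two largest samples times `σ̂`. Bounding this
gap by a product separates `θ` from `θ'`, which will be independent, and the width only involves the
assortment chosen for `θ'`. -/
theorem virtualValue_sub_le (hK : 1 ≤ K) {γ₂ : ℝ} (hlip : OneSidedLipschitzRisk U r γ₂)
    (hsel : ∀ w, IsSmallestOptimal U r K w (sel w)) {served bought : Fin N → ℕ}
    {θ θ' : Fin K → ℝ} (hθ : (⨆ j, θ j) ≤ ⨆ j, θ' j) :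
    virtualValue U r K T sel served bought θ' - virtualValue U r K T sel served bought θ ≤
      |γ₂| * ((1 + |⨆ j, θ j|) * ((1 + max (⨆ j, θ' j) 0) *
        width K T served bought (sel (virtualPref K T served bought θ')))) := by
  refine (IsOptimal.sub_le_of_le hlip (hsel _).1 (hsel _).1 fun i => ?_).trans ?_
  · rw [virtualPref_eq hK, virtualPref_eq hK]
    have := mul_le_mul_of_nonneg_right hθ (sigmaHat_nonneg K T (served i) (bought i))
    linarith
  · refine mul_le_mul_of_nonneg_left ?_ (abs_nonneg _)
    have h1 : ∑ i ∈ sel (virtualPref K T served bought θ'),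
        (virtualPref K T served bought θ' i - virtualPref K T served bought θ i) =
        ((⨆ j, θ' j) - ⨆ j, θ j) *
          width K T served bought (sel (virtualPref K T served bought θ')) := by
      rw [width, Finset.mul_sum]
      refine Finset.sum_congr rfl fun i _ => ?_
      rw [virtualPref_eq hK, virtualPref_eq hK]
      ring
    rw [h1, ← mul_assoc]
    refine mul_le_mul_of_nonneg_right ?_ (width_nonneg _ _ _ _ _)
    have h2 := le_max_left (⨆ j, θ' j) 0
    have h3 := le_max_right (⨆ j, θ' j) 0
    have h4 := neg_abs_le (⨆ j, θ j)
    have h5 := abs_nonneg (⨆ j, θ j)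
    nlinarith [mul_nonneg h3 h5]

/-- A sample `θ` with largest entry at least `√k` has no shortfall. For any other `θ`, average `u -
W θ ≤ W θ' - W θ` over optimistic independent `θ'`; this gives `P` times the shortfall on the left
and an expected width on the right. Then integrate over `θ` and cancel `P`. -/
theorem lintegral_optimalValue_sub_virtualValue_le (hK : 1 ≤ K) {γ₂ : ℝ} (hU : QuasiconvexRisk U)
    (hr : ∀ i, 0 < r i ∧ r i ≤ 1) (hlip : OneSidedLipschitzRisk U r γ₂)
    (hsel : ∀ w, IsSmallestOptimal U r K w (sel w)) (hselm : ∀ S, MeasurableSet {w | sel w = S})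
    {v : Fin N → ℝ≥0} {A : Finset (Fin N)} (hA : A.card ≤ K) {served bought : Fin N → ℕ} {k : ℕ}
    (hx : ∀ i ∈ A, (v i : ℝ) ≤
      meanEst (served i) (bought i) + √k * sigmaHat K T (served i) (bought i)) :
    (1 + K : ℝ≥0∞) * ∫⁻ θ, ENNReal.ofReal
        (U (profitCDF r A v) - virtualValue U r K T sel served bought θ) ∂(sampleMeasure K) ≤
      ENNReal.ofReal (|γ₂| * optimismCost K k) *
        ∫⁻ θ, ENNReal.ofReal ((1 + max (⨆ j, θ j) 0) *
          width K T served bought (sel (virtualPref K T served bought θ))) ∂(sampleMeasure K) := by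
  set W := virtualValue U r K T sel served bought
  set u := U (profitCDF r A v)
  set x : ℝ := √k
  set R : (Fin K → ℝ) → ℝ := fun θ => (1 + max (⨆ j, θ j) 0) *
    width K T served bought (sel (virtualPref K T served bought θ)) with hR
  set I := ∫⁻ θ, ENNReal.ofReal (R θ) ∂(sampleMeasure K)
  set P := sampleMeasure K {θ : Fin K → ℝ | x ≤ ⨆ j, θ j} with hP
  have hmsup := measurable_iSup_sample (K := K)
  have hset : MeasurableSet {θ : Fin K → ℝ | x ≤ ⨆ j, θ j} :=
    measurableSet_le measurable_const hmsup
  have hset' : MeasurableSet {θ : Fin K → ℝ | (⨆ j, θ j) < x} :=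
    measurableSet_lt hmsup measurable_const
  have hRm : Measurable fun θ => ENNReal.ofReal (R θ) := by
    refine ENNReal.measurable_ofReal.comp (((hmsup.max measurable_const).const_add 1).mul ?_)
    have : Measurable fun w : Fin N → ℝ => width K T served bought (sel w) := by
      intro B _
      have : (fun w : Fin N → ℝ => width K T served bought (sel w)) ⁻¹' B =
          ⋃ S ∈ {S | width K T served bought S ∈ B}, {w | sel w = S} := by
        ext θ; simp
      rw [this]
      exact MeasurableSet.biUnion (Set.to_countable _) fun S _ => hselm S
    exact this.comp (measurable_virtualPref T served bought)
  set a : (Fin K → ℝ) → ℝ≥0∞ := {θ : Fin K → ℝ | (⨆ j, θ j) < x}.indicator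
    (fun θ => ENNReal.ofReal (1 + |⨆ j, θ j|)) with ha
  have ham : Measurable a :=
    Measurable.indicator (ENNReal.measurable_ofReal.comp (by fun_prop)) hset'
  have hpoint : ∀ θ, P * ENNReal.ofReal (u - W θ) ≤ a θ * (ENNReal.ofReal |γ₂| * I) := by
    intro θ
    rcases lt_or_ge (⨆ j, θ j) x with h | h
    · rw [mul_comm, hP, ← setLIntegral_const, ha, Set.indicator_of_mem
        (show θ ∈ {θ : Fin K → ℝ | (⨆ j, θ j) < x} from h),
        ← mul_assoc, ← lintegral_const_mul _ hRm]
      refine (setLIntegral_mono' hset fun θ' hθ' => ?_).trans (setLIntegral_le_lintegral _ _)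
      rw [← ENNReal.ofReal_mul (by positivity), ← ENNReal.ofReal_mul (by positivity)]
      refine ENNReal.ofReal_le_ofReal ?_
      have h1 := le_virtualValue_of_optimistic hK hU hr hsel hA hx hθ'
      have h2 := virtualValue_sub_le (T := T) hK hlip hsel (served := served) (bought := bought)
        (h.le.trans hθ')
      calc u - W θ ≤ W θ' - W θ := by linarith
        _ ≤ _ := h2
        _ = _ := by rw [hR]; ring
    · have := le_virtualValue_of_optimistic hK hU hr hsel hA hx h
      rw [ENNReal.ofReal_eq_zero.2 (by linarith), mul_zero]
      exact zero_le
  have hcost := lintegral_abs_iSup_le_optimismCost hK k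
  -- If `P = 0`, then `hcost` makes the complementary event null as well.
  have hP0 : P ≠ 0 := by
    intro h0
    rw [← hP, h0, mul_zero] at hcost
    have h1 : ∫⁻ θ, a θ ∂(sampleMeasure K) = 0 := by
      have := nonpos_iff_eq_zero.1 hcost
      exact (mul_eq_zero.1 this).resolve_left (by simp)
    have h2 : sampleMeasure K {θ : Fin K → ℝ | (⨆ j, θ j) < x} ≤ 0 := by
      rw [← h1, ← lintegral_indicator_one hset']
      refine lintegral_mono fun θ => Set.indicator_le_indicator' fun h => ?_
      rw [Pi.one_apply, ← ENNReal.ofReal_one]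
      exact ENNReal.ofReal_le_ofReal (by have := abs_nonneg (⨆ j, θ j); linarith)
    have h3 : {θ : Fin K → ℝ | x ≤ ⨆ j, θ j} = {θ : Fin K → ℝ | (⨆ j, θ j) < x}ᶜ := by
      ext; simp
    rw [hP, h3, prob_compl_eq_one_sub hset', nonpos_iff_eq_zero.1 h2] at h0
    simp at h0
  have hPt : P ≠ ∞ := measure_ne_top _ _
  have hmul : P * ∫⁻ θ, ENNReal.ofReal (u - W θ) ∂(sampleMeasure K) ≤
      (∫⁻ θ, a θ ∂(sampleMeasure K)) * (ENNReal.ofReal |γ₂| * I) := by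
    rw [← lintegral_const_mul' _ _ hPt, ← lintegral_mul_const _ ham]
    exact lintegral_mono hpoint
  rw [← ENNReal.mul_le_mul_iff_right hP0 hPt]
  calc P * ((1 + K : ℝ≥0∞) * ∫⁻ θ, ENNReal.ofReal (u - W θ) ∂(sampleMeasure K))
      = (1 + K : ℝ≥0∞) * (P * ∫⁻ θ, ENNReal.ofReal (u - W θ) ∂(sampleMeasure K)) := by ring
    _ ≤ (1 + K : ℝ≥0∞) * ((∫⁻ θ, a θ ∂(sampleMeasure K)) * (ENNReal.ofReal |γ₂| * I)) := by
        gcongr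
    _ = ((1 + K : ℝ≥0∞) * ∫⁻ θ, a θ ∂(sampleMeasure K)) * (ENNReal.ofReal |γ₂| * I) := by ring
    _ ≤ (ENNReal.ofReal (optimismCost K k) * P) * (ENNReal.ofReal |γ₂| * I) := by gcongr
    _ = P * (ENNReal.ofReal (|γ₂| * optimismCost K k) * I) := by
        rw [ENNReal.ofReal_mul (abs_nonneg _)]; ring

end

end MNLBandit

namespace MNLBandit

/-! ### Sums along a path -/

/-- With `p t` for "an episode ends at `t`" and `φ` constant within episodes, this moves a sum over
episode ends to the beginnings of the next episodes, up to boundary terms. -/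
theorem sum_ite_add_eq_add_sum_ite_succ {M : Type*} [AddCommMonoid M] (p : ℕ → Prop)
    [DecidablePred p] (φ : ℕ → M) (h : ∀ t, ¬ p t → φ (t + 1) = φ t) (n : ℕ) :
    (∑ t ∈ Finset.range n, if p t then φ t else 0) + φ n =
      φ 0 + ∑ t ∈ Finset.range n, if p t then φ (t + 1) else 0 := by
  induction n with
  | zero => simp
  | succ n ih =>
    rw [Finset.sum_range_succ, Finset.sum_range_succ, ← add_assoc, ← ih]
    by_cases hp : p n
    · simp only [hp, if_true]
    · simp only [hp, if_false, add_zero, h n hp]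

theorem sum_range_inv_le {n T : ℕ} (hn : n ≤ T) :
    ∑ k ∈ Finset.range n, (k : ℝ)⁻¹ ≤ 1 + Real.log T := by
  have hT : 0 ≤ Real.log T := Real.log_natCast_nonneg T
  rcases n with _ | m
  · simp; linarith
  · rw [Finset.sum_range_succ']
    have h := harmonic_le_one_add_log m
    simp only [harmonic] at h
    push_cast at h ⊢
    simp only [inv_zero, add_zero]
    refine h.trans ?_
    rcases Nat.eq_zero_or_pos m with rfl | hm
    · simpa using hT
    · have h1 : (0 : ℝ) < m := by exact_mod_cast hm
      have h2 : (m : ℝ) ≤ T := by exact_mod_cast (by omega : m ≤ T)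
      have := Real.log_le_log h1 h2
      linarith

theorem sum_sqrt_le {ι : Type*} (s : Finset ι) {f : ι → ℝ} (hf : ∀ i ∈ s, 0 ≤ f i) :
    ∑ i ∈ s, √(f i) ≤ √(s.card * ∑ i ∈ s, f i) := by
  refine Real.le_sqrt_of_sq_le ((sq_sum_le_card_mul_sum_sq).trans (le_of_eq ?_))
  congr 1
  exact Finset.sum_congr rfl fun i hi => Real.sq_sqrt (hf i hi)

section

variable {N K T : ℕ} {pick : Finset (Fin N) → Fin N} {sel : (Fin N → ℝ) → Finset (Fin N)}

/-- The choice of the customer arriving at time `t`. -/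
noncomputable def choiceAt (T : ℕ) (pick : Finset (Fin N) → Fin N)
    (sel : (Fin N → ℝ) → Finset (Fin N))
    (ω : Outcome N K) (t : ℕ) : Fin (N + 1) := ω.2 (t, (tsState T pick sel ω t).assortment)

theorem tsState_succ (ω : Outcome N K) (t : ℕ) : tsState T pick sel ω (t + 1) =
    tsStep K T pick sel ω.1 (choiceAt T pick sel ω t) (tsState T pick sel ω t) := rfl

theorem bought_le_succ (ω : Outcome N K) (t : ℕ) (i : Fin N) :
    (tsState T pick sel ω t).bought i ≤ (tsState T pick sel ω (t + 1)).bought i := by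
  rw [tsState_succ, tsStep]
  split_ifs
  · simp only
    split_ifs <;> omega
  · exact le_rfl

theorem bought_mono (ω : Outcome N K) {s t : ℕ} (h : s ≤ t) (i : Fin N) :
    (tsState T pick sel ω s).bought i ≤ (tsState T pick sel ω t).bought i :=
  monotone_nat_of_le_succ (f := fun t => (tsState T pick sel ω t).bought i)
    (fun t => bought_le_succ ω t i) h

theorem sum_bought_add_current_le (ω : Outcome N K) (t : ℕ) :
    ∑ i, ((tsState T pick sel ω t).bought i + (tsState T pick sel ω t).current i) ≤ t := by
  induction t with
  | zero => simp [tsState, tsInit]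
  | succ t ih =>
    rw [tsState_succ, tsStep]
    split_ifs with hc
    · refine le_trans (Finset.sum_le_sum fun i _ => ?_) (ih.trans (Nat.le_succ t))
      simp only
      split_ifs <;> omega
    · simp only
      have h1 : ∀ i, (tsState T pick sel ω t).bought i +
          (if choiceAt T pick sel ω t = i.succ then (tsState T pick sel ω t).current i + 1
            else (tsState T pick sel ω t).current i) =
          ((tsState T pick sel ω t).bought i + (tsState T pick sel ω t).current i) +
            if choiceAt T pick sel ω t = i.succ then 1 else 0 := by
        intro i; split_ifs <;> omega
      simp only [h1, Finset.sum_add_distrib]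
      rw [Finset.sum_add_distrib] at ih
      have h2 : ∑ i : Fin N, (if choiceAt T pick sel ω t = i.succ then 1 else 0) ≤ 1 := by
        rw [Finset.sum_boole]
        simp only [Nat.cast_id]
        refine Finset.card_le_one.2 fun a ha b hb => ?_
        have e1 := (Finset.mem_filter.1 ha).2
        have e2 := (Finset.mem_filter.1 hb).2
        exact Fin.succ_injective _ (e1.symm.trans e2)
      omega

/-- Each such episode end raises the counter by one, so the summands run through consecutive
integers. The first is `0⁻¹ = 0`. -/
theorem sum_inv_served (ω : Outcome N K) (i : Fin N) (n : ℕ) :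
    (∑ t ∈ Finset.range n, if choiceAt T pick sel ω t = 0 ∧ i ∈ (tsState T pick sel ω t).assortment
      then ((tsState T pick sel ω t).served i : ℝ)⁻¹ else 0) =
      ∑ k ∈ Finset.range ((tsState T pick sel ω n).served i), (k : ℝ)⁻¹ := by
  induction n with
  | zero => simp [tsState, tsInit]
  | succ n ih =>
    rw [Finset.sum_range_succ, ih, tsState_succ, tsStep]
    by_cases hc : choiceAt T pick sel ω n = 0
    · by_cases hi : i ∈ (tsState T pick sel ω n).assortment
      · simp only [hc, hi, and_self, if_true]
        rw [Finset.sum_range_succ]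
      · simp only [hc, hi, and_false, if_false, if_true, add_zero]
    · simp only [hc, false_and, if_false, add_zero]

/-- The end of each exploratory episode makes one more counter nonzero. -/
theorem sum_unserved_le (hpick : ∀ A : Finset (Fin N), A.Nonempty → pick A ∈ A)
    (ω : Outcome N K) (n : ℕ) :
    (∑ t ∈ Finset.range n, if choiceAt T pick sel ω t = 0 ∧
      ∃ i, (tsState T pick sel ω t).served i = 0 then 1 else 0) ≤ N := by
  suffices h : (∑ t ∈ Finset.range n, if choiceAt T pick sel ω t = 0 ∧
      ∃ i, (tsState T pick sel ω t).served i = 0 then 1 else 0) ≤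
      (Finset.univ.filter fun i => (tsState T pick sel ω n).served i ≠ 0).card by
    exact h.trans ((Finset.card_le_univ _).trans (by simp))
  induction n with
  | zero => simp
  | succ n ih =>
    rw [Finset.sum_range_succ]
    set s := tsState T pick sel ω n with hs
    have hsub : (Finset.univ.filter fun i => s.served i ≠ 0) ⊆
        Finset.univ.filter fun i => (tsState T pick sel ω (n + 1)).served i ≠ 0 := by
      intro i hi
      have h1 := (Finset.mem_filter.1 hi).2
      refine Finset.mem_filter.2 ⟨Finset.mem_univ _, ?_⟩
      rw [tsState_succ, tsStep]
      split_ifs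
      · simp only
        split_ifs
        · omega
        · exact h1
      · exact h1
    split_ifs with h
    · obtain ⟨hc, hu⟩ := h
      have hass : s.assortment = {pick (Finset.univ.filter fun i => s.served i = 0)} := by
        rw [hs, tsState_assortment, tsSelect, if_pos hu]
      have hmem : pick (Finset.univ.filter fun i => s.served i = 0) ∈
          Finset.univ.filter fun i => s.served i = 0 :=
        hpick _ (by obtain ⟨i, hi⟩ := hu; exact ⟨i, by simpa using hi⟩)
      set j := pick (Finset.univ.filter fun i => s.served i = 0)
      have hj0 : s.served j = 0 := (Finset.mem_filter.1 hmem).2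
      have hlt : (Finset.univ.filter fun i => s.served i ≠ 0).card <
          (Finset.univ.filter fun i => (tsState T pick sel ω (n + 1)).served i ≠ 0).card := by
        refine Finset.card_lt_card ⟨hsub, fun h => ?_⟩
        have hj1 : j ∈ Finset.univ.filter fun i => (tsState T pick sel ω (n + 1)).served i ≠ 0 := by
          refine Finset.mem_filter.2 ⟨Finset.mem_univ _, ?_⟩
          rw [tsState_succ, tsStep, if_pos hc]
          have : j ∈ s.assortment := by rw [hass]; exact Finset.mem_singleton_self _
          simp [← hs, this]
        exact (Finset.mem_filter.1 (h hj1)).2 hj0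
      omega
    · exact (Nat.add_zero _).le.trans (ih.trans (Finset.card_le_card hsub))

/-! ### States with reliable estimates -/

/-- All products have been offered, and the estimates are not far from the preferences. -/
def GoodState (K T : ℕ) (v : Fin N → ℝ≥0) (A : Finset (Fin N)) (L : ℝ) (m : ℕ) (s : TSState N) :
    Prop :=
  (∀ i, s.served i ≠ 0) ∧ ¬ UpperDeviation v L s ∧ ¬ LowerDeviation K T v A m s

theorem sqrt_bought_le_mul_sigmaHat (K T : ℕ) {Ti ni : ℕ} (hTi : 0 < Ti) :
    √ni + 75 * √(Real.log (T * K)) ≤ Ti * sigmaHat K T Ti ni := by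
  have hn : (0 : ℝ) < Ti := by exact_mod_cast hTi
  have hni : (0 : ℝ) ≤ ni := Nat.cast_nonneg _
  have hmean : 0 ≤ meanEst Ti ni := by unfold meanEst; positivity
  have h1 : Ti * meanEst Ti ni = ni := by unfold meanEst; exact mul_div_cancel₀ _ hn.ne'
  unfold sigmaHat
  rw [mul_add]
  refine add_le_add ?_ (le_of_eq (mul_div_cancel₀ _ hn.ne').symm)
  rw [Real.sqrt_le_left (by positivity), mul_pow, Real.sq_sqrt (by positivity)]
  have : (Ti : ℝ) ^ 2 * (50 * meanEst Ti ni * (meanEst Ti ni + 1) / Ti) =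
      50 * (Ti * meanEst Ti ni) * (meanEst Ti ni + 1) := by field_simp
  rw [this, h1]
  nlinarith

/-- If `i` was bought more often than expected, the true scale `√(T_i v_i)` is at most the observed
`√n_i`, which `T_i σ̂_i` dominates; `hTK` covers the additive `1`. -/
theorem meanEst_sub_le {v : Fin N → ℝ≥0} {L : ℝ} (hL : 1 ≤ L)
    (hTK : 1 ≤ 75 * √(Real.log (T * K))) {s : TSState N} (hs : ∀ i, s.served i ≠ 0)
    (hU : ¬ UpperDeviation v L s) (i : Fin N) :
    meanEst (s.served i) (s.bought i) - v i ≤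
      5 * L * sigmaHat K T (s.served i) (s.bought i) := by
  have hn0 := Nat.pos_of_ne_zero (hs i)
  have hn : (0 : ℝ) < s.served i := by exact_mod_cast hn0
  have h1 := sqrt_bought_le_mul_sigmaHat K T (ni := s.bought i) hn0
  have h2 : (s.served i : ℝ) * meanEst (s.served i) (s.bought i) = s.bought i := by
    unfold meanEst; exact mul_div_cancel₀ _ hn.ne'
  have h3 : (s.bought i : ℝ) - s.served i * v i ≤ 5 * L * (1 + √(s.served i * v i)) := by
    by_contra h
    exact hU ⟨i, not_le.1 h⟩
  have hσ := sigmaHat_nonneg K T (s.served i) (s.bought i)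
  refine le_of_mul_le_mul_left ?_ hn
  rw [mul_sub, h2]
  rcases le_or_gt (s.bought i : ℝ) (s.served i * v i) with h | h
  · have : 0 ≤ s.served i * (5 * L * sigmaHat K T (s.served i) (s.bought i)) := by positivity
    linarith
  · have h4 := Real.sqrt_le_sqrt h.le
    nlinarith

/-- Without upper deviation `n_i ≤ T_i + 5 L (1 + T_i)`, so `v̄_i + 1 ≤ 12 L`. The numerator may use
any later purchase count `b`, which makes it constant along a path. -/
theorem sigmaHat_le {v : Fin N → ℝ≥0} (hv : ∀ i, v i ≤ 1) {L : ℝ} (hL : 1 ≤ L)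
    {s : TSState N} (hs : ∀ i, s.served i ≠ 0) (hU : ¬ UpperDeviation v L s) (i : Fin N) {b : ℕ}
    (hb : s.bought i ≤ b) :
    sigmaHat K T (s.served i) (s.bought i) ≤
      (√(600 * L * b) + 75 * √(Real.log (T * K))) * (s.served i : ℝ)⁻¹ := by
  have hn0 := Nat.pos_of_ne_zero (hs i)
  have hn : (0 : ℝ) < s.served i := by exact_mod_cast hn0
  have hn1 : (1 : ℝ) ≤ s.served i := by exact_mod_cast hn0
  have hvi : (v i : ℝ) ≤ 1 := by exact_mod_cast hv i
  have hvi0 : (0 : ℝ) ≤ v i := (v i).2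
  have hb' : (s.bought i : ℝ) ≤ b := by exact_mod_cast hb
  have hb0 : (0 : ℝ) ≤ s.bought i := Nat.cast_nonneg _
  have h2 : (s.served i : ℝ) * meanEst (s.served i) (s.bought i) = s.bought i := by
    unfold meanEst; exact mul_div_cancel₀ _ hn.ne'
  have h3 : (s.bought i : ℝ) - s.served i * v i ≤ 5 * L * (1 + √(s.served i * v i)) := by
    by_contra h
    exact hU ⟨i, not_le.1 h⟩
  have hmean : 0 ≤ meanEst (s.served i) (s.bought i) := by unfold meanEst; positivity
  have h4 : √(s.served i * v i) ≤ s.served i := by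
    rw [Real.sqrt_le_left hn.le]; nlinarith
  have h5 : meanEst (s.served i) (s.bought i) + 1 ≤ 12 * L := by
    refine le_of_mul_le_mul_left ?_ hn
    rw [mul_add, h2]
    nlinarith
  rw [← div_eq_mul_inv, le_div_iff₀ hn]
  unfold sigmaHat
  rw [add_mul, div_mul_cancel₀ _ hn.ne']
  refine add_le_add_left (Real.le_sqrt_of_sq_le ?_) _
  rw [mul_pow, Real.sq_sqrt (by positivity)]
  have : 50 * meanEst (s.served i) (s.bought i) * (meanEst (s.served i) (s.bought i) + 1) /
      (s.served i) * (s.served i : ℝ) ^ 2 = 50 * (s.served i * meanEst (s.served i) (s.bought i)) *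
      (meanEst (s.served i) (s.bought i) + 1) := by field_simp
  rw [this, h2]
  calc 50 * (s.bought i : ℝ) * (meanEst (s.served i) (s.bought i) + 1)
      ≤ 50 * b * (12 * L) := by gcongr
    _ = 600 * L * b := by ring

open Classical in
/-- The total width of the confidence intervals of the offered products in a good state. -/
noncomputable def goodWidth (K T : ℕ) (v : Fin N → ℝ≥0) (A : Finset (Fin N)) (L : ℝ) (m : ℕ)
    (s : TSState N) : ℝ :=
  if GoodState K T v A L m s then width K T s.served s.bought s.assortment else 0

theorem goodWidth_nonneg (K T : ℕ) (v : Fin N → ℝ≥0) (A : Finset (Fin N)) (L : ℝ) (m : ℕ)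
    (s : TSState N) : 0 ≤ goodWidth K T v A L m s := by
  unfold goodWidth
  split_ifs
  · exact width_nonneg _ _ _ _ _
  · exact le_rfl

noncomputable def widthBound (N K T : ℕ) (L : ℝ) : ℝ :=
  (2 + Real.log T) * (√(600 * L) * √(N * T) + 75 * N * √(Real.log (T * K)))

theorem goodWidth_le {v : Fin N → ℝ≥0} (hv : ∀ i, v i ≤ 1) {L : ℝ} (hL : 1 ≤ L)
    (A : Finset (Fin N)) (m : ℕ) {s : TSState N} {b : Fin N → ℕ} (hb : ∀ i, s.bought i ≤ b i) :
    goodWidth K T v A L m s ≤ ∑ i, if i ∈ s.assortment then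
      (√(600 * L * b i) + 75 * √(Real.log (T * K))) * (s.served i : ℝ)⁻¹ else 0 := by
  rw [Finset.sum_ite_mem, Finset.univ_inter]
  unfold goodWidth
  split_ifs with h
  · exact Finset.sum_le_sum fun i _ => sigmaHat_le hv hL h.1 h.2.1 i (hb i)
  · exact Finset.sum_nonneg fun i _ => by positivity

/-- With the final purchase counts in the numerators, the counters give harmonic sums, and the
Cauchy-Schwarz inequality bounds the sum of `√(b i)` by `√(N T)`. The extra term for the state at
time `T` is needed when the sum is shifted to the next episodes. -/
theorem sum_goodWidth_le {v : Fin N → ℝ≥0} (hv : ∀ i, v i ≤ 1) {L : ℝ} (hL : 1 ≤ L)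
    (A : Finset (Fin N)) (m : ℕ) (ω : Outcome N K) :
    (∑ t ∈ Finset.range T, if choiceAt T pick sel ω t = 0 then
      goodWidth K T v A L m (tsState T pick sel ω t) else 0) +
      goodWidth K T v A L m (tsState T pick sel ω T) ≤ widthBound N K T L := by
  set b := (tsState T pick sel ω T).bought with hb
  set D : Fin N → ℝ := fun i => √(600 * L * b i) + 75 * √(Real.log (T * K)) with hD
  have hD0 : ∀ i, 0 ≤ D i := fun i => by positivity
  have h1 : (∑ t ∈ Finset.range T, if choiceAt T pick sel ω t = 0 then
      goodWidth K T v A L m (tsState T pick sel ω t) else 0) ≤ ∑ i, D i * (1 + Real.log T) := by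
    calc (∑ t ∈ Finset.range T, if choiceAt T pick sel ω t = 0 then
          goodWidth K T v A L m (tsState T pick sel ω t) else 0)
        ≤ ∑ t ∈ Finset.range T, ∑ i, D i * (if choiceAt T pick sel ω t = 0 ∧
            i ∈ (tsState T pick sel ω t).assortment
            then ((tsState T pick sel ω t).served i : ℝ)⁻¹ else 0) := by
          refine Finset.sum_le_sum fun t ht => ?_
          by_cases hc : choiceAt T pick sel ω t = 0
          · simp only [hc, if_true, true_and, mul_ite, mul_zero]
            exact goodWidth_le hv hL A m fun i => bought_mono ω (Finset.mem_range.1 ht).le i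
          · simp [hc]
      _ = ∑ i, D i * ∑ k ∈ Finset.range ((tsState T pick sel ω T).served i), (k : ℝ)⁻¹ := by
          rw [Finset.sum_comm]
          refine Finset.sum_congr rfl fun i _ => ?_
          rw [← Finset.mul_sum, sum_inv_served]
      _ ≤ _ := Finset.sum_le_sum fun i _ => mul_le_mul_of_nonneg_left
          (sum_range_inv_le (tsState_served_le ω T i)) (hD0 i)
  have h2 : goodWidth K T v A L m (tsState T pick sel ω T) ≤ ∑ i, D i := by
    refine (goodWidth_le (b := b) hv hL A m fun i => le_rfl).trans (Finset.sum_le_sum fun i _ => ?_)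
    split_ifs
    · refine mul_le_of_le_one_right (hD0 i) ?_
      rcases Nat.eq_zero_or_pos ((tsState T pick sel ω T).served i) with h | h
      · simp [h]
      · exact inv_le_one_of_one_le₀ (by exact_mod_cast h)
    · exact hD0 i
  have h3 : ∑ i, D i ≤ √(600 * L) * √(N * T) + 75 * N * √(Real.log (T * K)) := by
    simp only [hD, Finset.sum_add_distrib, Finset.sum_const, Finset.card_univ, Fintype.card_fin,
      nsmul_eq_mul]
    refine add_le_add ?_ (le_of_eq (by ring))
    have h4 : ∀ i, √(600 * L * b i) = √(600 * L) * √(b i) := fun i =>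
      Real.sqrt_mul (by positivity) _
    simp only [h4, ← Finset.mul_sum]
    refine mul_le_mul_of_nonneg_left ?_ (Real.sqrt_nonneg _)
    refine (sum_sqrt_le _ fun i _ => Nat.cast_nonneg _).trans (Real.sqrt_le_sqrt ?_)
    rw [Finset.card_univ, Fintype.card_fin]
    refine mul_le_mul_of_nonneg_left ?_ (Nat.cast_nonneg _)
    have h5 : ∑ i, b i ≤ T := (Finset.sum_le_sum fun i _ => Nat.le_add_right _ _).trans
      (sum_bought_add_current_le (T := T) (pick := pick) (sel := sel) ω T)
    exact_mod_cast h5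
  have hT : 0 ≤ Real.log T := Real.log_natCast_nonneg T
  calc _ ≤ ∑ i, D i * (1 + Real.log T) + ∑ i, D i := add_le_add h1 h2
    _ = (2 + Real.log T) * ∑ i, D i := by rw [← Finset.sum_mul]; ring
    _ ≤ _ := mul_le_mul_of_nonneg_left h3 (by linarith)

theorem sum_goodWidth_succ_le {v : Fin N → ℝ≥0} (hv : ∀ i, v i ≤ 1) {L : ℝ} (hL : 1 ≤ L)
    (A : Finset (Fin N)) (m : ℕ) (ω : Outcome N K) :
    (∑ t ∈ Finset.range T, if choiceAt T pick sel ω t = 0 then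
      goodWidth K T v A L m (tsState T pick sel ω (t + 1)) else 0) ≤ widthBound N K T L := by
  have h := sum_ite_add_eq_add_sum_ite_succ (fun t => choiceAt T pick sel ω t = 0)
    (fun t => goodWidth K T v A L m (tsState T pick sel ω t)) (fun t hc => by
      rw [tsState_succ, tsStep, if_neg hc]; rfl) T
  have h1 := sum_goodWidth_le (T := T) (pick := pick) (sel := sel) hv hL A m ω
  have h2 := goodWidth_nonneg K T v A L m (tsState T pick sel ω 0)
  linarith

end

end MNLBandit

namespace MNLBandit

/-! ### Expectations along the run of the algorithm -/

section

variable {N K T : ℕ} {pick : Finset (Fin N) → Fin N} {sel : (Fin N → ℝ) → Finset (Fin N)}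

/-- The samples of the episode that is running at time `t`. -/
noncomputable def sampleAt (T : ℕ) (pick : Finset (Fin N) → Fin N)
    (sel : (Fin N → ℝ) → Finset (Fin N)) (ω : Outcome N K) (t : ℕ) : Fin K → ℝ :=
  fun j => ω.1 ((tsState T pick sel ω t).episode, j)

theorem measurable_choiceAt (hsel : ∀ S, MeasurableSet {w | sel w = S}) (t : ℕ) :
    Measurable fun ω : Outcome N K => choiceAt T pick sel ω t := measurable_choice hsel t

theorem measurable_comp_state {β : Type*} [MeasurableSpace β]
    (hsel : ∀ S, MeasurableSet {w | sel w = S}) (g : TSState N → β) (t : ℕ) :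
    Measurable fun ω : Outcome N K => g (tsState T pick sel ω t) :=
  Measurable.of_discrete.comp (measurable_tsState hsel t)

theorem dependsOnPast_comp_state {β : Type*} (g : TSState N → β) {s t : ℕ} (hst : s ≤ t) :
    DependsOnPast (K := K) t fun ω => g (tsState T pick sel ω s) := fun ω ω' h1 h2 =>
  congrArg g (dependsOnPast_tsState (T := T) (pick := pick) (sel := sel) hst ω ω' h1 h2)

theorem measurable_comp_state_sample {β : Type*} [MeasurableSpace β]
    (hsel : ∀ S, MeasurableSet {w | sel w = S}) {Φ : TSState N → (Fin K → ℝ) → β}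
    (hΦ : ∀ s, Measurable (Φ s)) (t : ℕ) :
    Measurable fun ω : Outcome N K => Φ (tsState T pick sel ω t) (sampleAt T pick sel ω t) := by
  have h : Measurable fun p : TSState N × Outcome N K => Φ p.1 fun j => p.2.1 (p.1.episode, j) :=
    measurable_from_prod_countable_right fun s =>
      show Measurable fun ω : Outcome N K => Φ s fun j => ω.1 (s.episode, j) from
        (hΦ s).comp (by fun_prop)
  exact h.comp ((measurable_tsState hsel t).prodMk measurable_id)

theorem dependsOnPast_comp_state_sample {β : Type*} (Φ : TSState N → (Fin K → ℝ) → β) (t : ℕ) :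
    DependsOnPast (K := K) t fun ω =>
      Φ (tsState T pick sel ω t) (sampleAt T pick sel ω t) := by
  intro ω ω' h1 h2
  have h : tsState T pick sel ω t = tsState T pick sel ω' t :=
    dependsOnPast_tsState (T := T) (pick := pick) (sel := sel) le_rfl ω ω' h1 h2
  have h' : sampleAt T pick sel ω t = sampleAt T pick sel ω' t := by
    funext j
    simp only [sampleAt, h, h1]
  simp only [h, h']

/-- This converts between sums over times and sums over episodes: the weight on the right is the
probability that the episode ends at time `t`. -/
theorem lintegral_mul_noPurchase (hsel : ∀ S, MeasurableSet {w | sel w = S}) (v : Fin N → ℝ≥0)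
    {t : ℕ} {f : Outcome N K → ℝ≥0∞} (hf : Measurable f) (hft : DependsOnPast t f) :
    ∫⁻ ω, (if choiceAt T pick sel ω t = 0 then f ω else 0) ∂(outcomeMeasure K v) =
      ∫⁻ ω, f ω * ENNReal.ofReal
        (1 / (1 + ∑ i ∈ (tsState T pick sel ω t).assortment, (v i : ℝ))) ∂(outcomeMeasure K v) := by
  have h := lintegral_choice (K := K) v (t := t)
    (A := fun ω => (tsState T pick sel ω t).assortment)
    (f := fun c ω => if c = 0 then f ω else 0)
    (fun S => measurable_tsState (K := K) (T := T) (pick := pick) hsel t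
      (MeasurableSet.of_discrete (s := {s : TSState N | s.assortment = S})))
    (dependsOnPast_comp_state (fun s => s.assortment) le_rfl)
    (fun c => by split_ifs <;> fun_prop)
    (fun c ω ω' h1 h2 => by simp only [hft ω ω' h1 h2])
  refine h.trans (lintegral_congr fun ω => ?_)
  simp only [mul_ite, mul_zero, Finset.sum_ite_eq', Finset.mem_univ, if_true]
  rw [choicePMF_apply, ← ENNReal.ofReal_coe_nnreal, choiceProb_zero, mul_comm]

/-- When an episode ends, the samples of the next one are fresh. -/
theorem lintegral_next_sample (hsel : ∀ S, MeasurableSet {w | sel w = S}) (v : Fin N → ℝ≥0)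
    (t : ℕ) {Φ : TSState N → (Fin K → ℝ) → ℝ≥0∞} (hΦ : ∀ s, Measurable (Φ s)) :
    ∫⁻ ω, (if choiceAt T pick sel ω t = 0 then Φ (tsState T pick sel ω t)
        (fun j => ω.1 ((tsState T pick sel ω t).episode + 1, j)) else 0) ∂(outcomeMeasure K v) =
      ∫⁻ ω, (if choiceAt T pick sel ω t = 0 then
        ∫⁻ y, Φ (tsState T pick sel ω t) y ∂(sampleMeasure K) else 0) ∂(outcomeMeasure K v) := by
  classical
  -- The index of the fresh block is random; on the event that the current episode is `l`, it is the
  -- fixed block `l + 1`.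
  set G : ℕ → Outcome N K → (Fin K → ℝ) → ℝ≥0∞ := fun l ω y =>
    if choiceAt T pick sel ω t = 0 ∧ (tsState T pick sel ω t).episode = l then
      Φ (tsState T pick sel ω t) y else 0 with hG
  have hGm : ∀ l, Measurable (Function.uncurry (G l)) := by
    intro l
    have h : Measurable fun p : (TSState N × Fin (N + 1)) × (Fin K → ℝ) =>
        if p.1.2 = 0 ∧ p.1.1.episode = l then Φ p.1.1 p.2 else 0 :=
      measurable_from_prod_countable_right fun q => by
        by_cases hq : q.2 = 0 ∧ q.1.episode = l
        · simp only [hq, and_self, if_true]; exact hΦ q.1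
        · simp only [hq, if_false]; exact measurable_const
    exact h.comp ((((measurable_tsState hsel t).prodMk (measurable_choiceAt hsel t)).comp
      measurable_fst).prodMk measurable_snd)
  have hGl : ∀ l, ∀ ω ω' : Outcome N K, ω.2 = ω'.2 →
      (∀ l' ≠ l + 1, ∀ j, ω.1 (l', j) = ω'.1 (l', j)) → G l ω = G l ω' := by
    intro l ω ω' h2 h1
    have hsame : tsState T pick sel ω t = tsState T pick sel ω' t → G l ω = G l ω' := by
      intro h
      have hc : choiceAt T pick sel ω t = choiceAt T pick sel ω' t := by
        simp only [choiceAt, h, h2]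
      funext y
      simp only [hG, hc, h]
    by_cases h : (tsState T pick sel ω t).episode < l + 1
    · exact hsame (tsState_eq_of_episode_lt h2 h1 h)
    by_cases h' : (tsState T pick sel ω' t).episode < l + 1
    · exact hsame (tsState_eq_of_episode_lt h2.symm (fun l' hl j => (h1 l' hl j).symm) h').symm
    · funext y
      have e1 : (tsState T pick sel ω t).episode ≠ l := by omega
      have e2 : (tsState T pick sel ω' t).episode ≠ l := by omega
      simp only [hG, e1, e2, and_false, if_false]
  have hsum : ∀ (ω : Outcome N K) (F : ℕ → ℝ≥0∞), ∑ l ∈ Finset.range (t + 1),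
      (if choiceAt T pick sel ω t = 0 ∧ (tsState T pick sel ω t).episode = l then F l else 0) =
      if choiceAt T pick sel ω t = 0 then F (tsState T pick sel ω t).episode else 0 := by
    intro ω F
    have hmem : (tsState T pick sel ω t).episode ∈ Finset.range (t + 1) :=
      Finset.mem_range.2 (Nat.lt_succ_of_le (tsState_episode_le ω t))
    by_cases hc : choiceAt T pick sel ω t = 0
    · simp only [hc, true_and, if_true, Finset.sum_ite_eq, hmem]
    · simp [hc]
  have h1 : ∀ ω : Outcome N K, (if choiceAt T pick sel ω t = 0 then Φ (tsState T pick sel ω t)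
      (fun j => ω.1 ((tsState T pick sel ω t).episode + 1, j)) else 0) =
      ∑ l ∈ Finset.range (t + 1), G l ω (fun j => ω.1 (l + 1, j)) := fun ω =>
    (hsum ω fun l => Φ (tsState T pick sel ω t) (fun j => ω.1 (l + 1, j))).symm
  have h2 : ∀ ω : Outcome N K, (if choiceAt T pick sel ω t = 0 then
      ∫⁻ y, Φ (tsState T pick sel ω t) y ∂(sampleMeasure K) else 0) =
      ∑ l ∈ Finset.range (t + 1), ∫⁻ y, G l ω y ∂(sampleMeasure K) := by
    intro ω
    rw [← hsum ω fun _ => ∫⁻ y, Φ (tsState T pick sel ω t) y ∂(sampleMeasure K)]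
    refine Finset.sum_congr rfl fun l _ => ?_
    simp only [hG]
    split_ifs <;> simp
  simp only [h1, h2]
  rw [lintegral_finsetSum, lintegral_finsetSum]
  · exact Finset.sum_congr rfl fun l _ => lintegral_sample v (l + 1) (hGm l) (hGl l)
  · exact fun l _ => (hGm l).lintegral_prod_right'
  · exact fun l _ => (hGm l).comp (measurable_id.prodMk (by fun_prop))

/-! ### Random factors of the regret bound -/

/-- An upper bound for the squares of the samples that are drawn up to time `T`. -/
noncomputable def sampleFactor (T : ℕ) (b : ℝ) (ω : Outcome N K) : ℝ :=
  (1 + b) ^ 2 + ∑ p ∈ Finset.range (T + 1) ×ˢ (Finset.univ : Finset (Fin K)),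
    2 * Real.exp (2 * ω.1 p - b)

theorem one_add_sq_le_two_mul_exp {x : ℝ} (hx : 0 ≤ x) : (1 + x) ^ 2 ≤ 2 * Real.exp x := by
  have := Real.quadratic_le_exp_of_nonneg hx
  nlinarith

/-- A largest sample below `b` is covered by the first term. A larger one, `x > b`, satisfies `(1 +
x)² ≤ 2 exp x ≤ 2 exp (2 x - b)`. -/
theorem sq_le_sampleFactor (hK : 1 ≤ K) {b : ℝ} (hb : 0 ≤ b) (ω : Outcome N K) {l : ℕ}
    (hl : l ≤ T) : (1 + max (⨆ j, ω.1 (l, j)) 0) ^ 2 ≤ sampleFactor T b ω := by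
  have : Nonempty (Fin K) := ⟨⟨0, hK⟩⟩
  obtain ⟨j, hj⟩ := exists_eq_ciSup_of_finite (f := fun j => ω.1 (l, j))
  rw [← hj]
  unfold sampleFactor
  rcases le_or_gt (ω.1 (l, j)) b with h | h
  · have h1 : (1 + max (ω.1 (l, j)) 0) ^ 2 ≤ (1 + b) ^ 2 := by
      have := le_max_right (ω.1 (l, j)) 0
      have := max_le h hb
      gcongr
    have h2 : 0 ≤ ∑ p ∈ Finset.range (T + 1) ×ˢ (Finset.univ : Finset (Fin K)),
      2 * Real.exp (2 * ω.1 p - b) := Finset.sum_nonneg fun _ _ => by positivity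
    linarith
  · have h0 : 0 ≤ ω.1 (l, j) := hb.trans h.le
    rw [max_eq_left h0]
    have h1 : 2 * Real.exp (2 * ω.1 (l, j) - b) ≤
        ∑ p ∈ Finset.range (T + 1) ×ˢ (Finset.univ : Finset (Fin K)),
          2 * Real.exp (2 * ω.1 p - b) :=
      Finset.single_le_sum (f := fun p => 2 * Real.exp (2 * ω.1 p - b))
        (fun _ _ => by positivity) (Finset.mem_product.2
          ⟨Finset.mem_range.2 (Nat.lt_succ_of_le hl), Finset.mem_univ j⟩)
    have h2 := one_add_sq_le_two_mul_exp h0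
    have h3 : Real.exp (ω.1 (l, j)) ≤ Real.exp (2 * ω.1 (l, j) - b) :=
      Real.exp_le_exp.2 (by linarith)
    have h4 := sq_nonneg (1 + b)
    linarith

theorem sampleFactor_nonneg (T : ℕ) (b : ℝ) (ω : Outcome N K) : 0 ≤ sampleFactor T b ω := by
  unfold sampleFactor; positivity

theorem measurable_sampleFactor (T : ℕ) (b : ℝ) :
    Measurable fun ω : Outcome N K => sampleFactor T b ω := by
  unfold sampleFactor
  refine measurable_const.add (Finset.measurable_fun_sum _ fun p _ => ?_)
  fun_prop

theorem lintegral_sampleFactor (v : Fin N → ℝ≥0) (T : ℕ) {b : ℝ} :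
    ∫⁻ ω, ENNReal.ofReal (sampleFactor T b ω) ∂(outcomeMeasure K v) =
      ENNReal.ofReal ((1 + b) ^ 2 + (T + 1) * K * (2 * Real.exp (2 - b))) := by
  have h1 : ∀ ω : Outcome N K, ENNReal.ofReal (sampleFactor T b ω) =
      ENNReal.ofReal ((1 + b) ^ 2) +
        ∑ p ∈ Finset.range (T + 1) ×ˢ (Finset.univ : Finset (Fin K)),
          ENNReal.ofReal (2 * Real.exp (-b)) * ENNReal.ofReal (Real.exp (2 * ω.1 p)) := by
    intro ω
    unfold sampleFactor
    rw [ENNReal.ofReal_add (by positivity) (Finset.sum_nonneg fun _ _ => by positivity),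
      ENNReal.ofReal_sum_of_nonneg fun _ _ => by positivity]
    congr 1
    refine Finset.sum_congr rfl fun p _ => ?_
    rw [← ENNReal.ofReal_mul (by positivity), mul_assoc, ← Real.exp_add]
    congr 3
    ring
  have hm : ∀ p : ℕ × Fin K, Measurable fun ω : Outcome N K =>
      ENNReal.ofReal (Real.exp (2 * ω.1 p)) := fun p => by fun_prop
  have h2 : ∀ p : ℕ × Fin K, ∫⁻ ω, ENNReal.ofReal (Real.exp (2 * ω.1 p)) ∂(outcomeMeasure K v) =
      ENNReal.ofReal (Real.exp 2) := by
    intro p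
    have hmp : MeasurePreserving (fun ω : Outcome N K => ω.1 p) (outcomeMeasure K v)
        (gaussianReal 0 1) :=
      (measurePreserving_eval_infinitePi (fun _ : ℕ × Fin K => gaussianReal 0 1) p).comp
        measurePreserving_fst
    have h3 := hmp.lintegral_comp (f := fun y => ENNReal.ofReal (Real.exp (2 * y))) (by fun_prop)
    rw [h3, lintegral_ofReal_exp_gaussian]
    norm_num
  simp only [h1]
  rw [lintegral_add_left measurable_const, lintegral_const, measure_univ, mul_one,
    lintegral_finsetSum _ fun p _ => (hm p).const_mul _]
  have h4 : ∀ p : ℕ × Fin K, ∫⁻ ω, ENNReal.ofReal (2 * Real.exp (-b)) *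
      ENNReal.ofReal (Real.exp (2 * ω.1 p)) ∂(outcomeMeasure K v) =
      ENNReal.ofReal (2 * Real.exp (2 - b)) := by
    intro p
    rw [lintegral_const_mul _ (hm p), h2, ← ENNReal.ofReal_mul (by positivity), mul_assoc,
      ← Real.exp_add]
    congr 3
    ring
  rw [Finset.sum_congr rfl fun p _ => h4 p, Finset.sum_const, Finset.card_product,
    Finset.card_range, Finset.card_univ, Fintype.card_fin, nsmul_eq_mul,
    ENNReal.ofReal_add (by positivity) (by positivity),
    ENNReal.ofReal_mul (p := ((T : ℝ) + 1) * K) (by positivity)]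
  congr 2
  rw [← ENNReal.ofReal_natCast]
  push_cast
  rfl

/-- The event that at some time the preference of a product in `A` is underestimated at level
`k`. -/
def lowerEvent (T : ℕ) (pick : Finset (Fin N) → Fin N) (sel : (Fin N → ℝ) → Finset (Fin N))
    (v : Fin N → ℝ≥0) (A : Finset (Fin N)) (k : ℕ) : Set (Outcome N K) :=
  {ω | ∃ t ≤ T, LowerDeviation K T v A k (tsState T pick sel ω t)}

theorem measurableSet_lowerEvent (hsel : ∀ S, MeasurableSet {w | sel w = S}) (v : Fin N → ℝ≥0)
    (A : Finset (Fin N)) (k : ℕ) :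
    MeasurableSet (lowerEvent (K := K) T pick sel v A k) := by
  have : lowerEvent (K := K) T pick sel v A k =
      ⋃ t ∈ Set.Iic T, (fun ω => tsState T pick sel ω t) ⁻¹' {s | LowerDeviation K T v A k s} := by
    ext ω; simp [lowerEvent]
  rw [this]
  exact MeasurableSet.biUnion (Set.to_countable _) fun t _ =>
    measurable_tsState hsel t MeasurableSet.of_discrete

/-- An upper bound for the squares of the prices of non-optimism up to time `T`. -/
noncomputable def optimismFactor (T : ℕ) (pick : Finset (Fin N) → Fin N)
    (sel : (Fin N → ℝ) → Finset (Fin N)) (v : Fin N → ℝ≥0) (A : Finset (Fin N)) (m : ℕ)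
    (ω : Outcome N K) : ℝ :=
  optimismCost K 0 ^ 2 * (1 + ∑ k ∈ Finset.range m, Real.exp (3 * (k + 1)) *
    (lowerEvent T pick sel v A k).indicator 1 ω)

theorem optimismFactor_nonneg (v : Fin N → ℝ≥0) (A : Finset (Fin N)) (m : ℕ) (ω : Outcome N K) :
    0 ≤ optimismFactor T pick sel v A m ω := by
  have : ∀ k, 0 ≤ (lowerEvent (K := K) T pick sel v A k).indicator (1 : Outcome N K → ℝ) ω :=
    fun k => Set.indicator_nonneg (fun _ _ => zero_le_one) _
  unfold optimismFactor
  have h2 : 0 ≤ ∑ k ∈ Finset.range m, Real.exp (3 * (k + 1)) *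
    (lowerEvent (K := K) T pick sel v A k).indicator 1 ω :=
    Finset.sum_nonneg fun k _ => mul_nonneg (Real.exp_pos _).le (this k)
  positivity

theorem measurable_optimismFactor (hsel : ∀ S, MeasurableSet {w | sel w = S}) (v : Fin N → ℝ≥0)
    (A : Finset (Fin N)) (m : ℕ) :
    Measurable fun ω : Outcome N K => optimismFactor T pick sel v A m ω := by
  unfold optimismFactor
  refine measurable_const.mul (measurable_const.add (Finset.measurable_fun_sum _ fun k _ => ?_))
  exact measurable_const.mul (measurable_one.indicator (measurableSet_lowerEvent hsel v A k))

theorem lintegral_optimismFactor_le (hsel : ∀ S, MeasurableSet {w | sel w = S})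
    (hK : 1 ≤ K) {v : Fin N → ℝ≥0} (hv : ∀ i, v i ≤ 1) {A : Finset (Fin N)} (hA : A.card ≤ K)
    {m : ℕ} (hm : (m : ℝ) ≤ Real.log (T * K)) :
    ∫⁻ ω, ENNReal.ofReal (optimismFactor T pick sel v A m ω) ∂(outcomeMeasure K v) ≤
      ENNReal.ofReal (optimismCost K 0 ^ 2 * (1 + ∑ k ∈ Finset.range m, Real.exp (3 * (k + 1)) *
        (K * (Nat.log 2 T + 1) * Real.exp (-(5 * k))))) := by
  have hind : ∀ k, ∀ ω, 0 ≤ (lowerEvent (K := K) T pick sel v A k).indicator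
      (1 : Outcome N K → ℝ) ω := fun k ω => Set.indicator_nonneg (fun _ _ => zero_le_one) _
  have h1 : ∀ ω : Outcome N K, ENNReal.ofReal (optimismFactor T pick sel v A m ω) =
      ENNReal.ofReal (optimismCost K 0 ^ 2) * (1 + ∑ k ∈ Finset.range m,
        ENNReal.ofReal (Real.exp (3 * (k + 1))) *
          (lowerEvent (K := K) T pick sel v A k).indicator 1 ω) := by
    intro ω
    unfold optimismFactor
    have h2 : ∀ k ∈ Finset.range m, 0 ≤ Real.exp (3 * (k + 1)) *
        (lowerEvent (K := K) T pick sel v A k).indicator 1 ω :=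
      fun k _ => mul_nonneg (Real.exp_pos _).le (hind k ω)
    rw [ENNReal.ofReal_mul (by positivity), ENNReal.ofReal_add zero_le_one (Finset.sum_nonneg h2),
      ENNReal.ofReal_one, ENNReal.ofReal_sum_of_nonneg h2]
    congr 2
    refine Finset.sum_congr rfl fun k _ => ?_
    rw [ENNReal.ofReal_mul (Real.exp_pos _).le]
    congr 1
    by_cases h : ω ∈ lowerEvent (K := K) T pick sel v A k <;> simp [h]
  have hmeas : ∀ k : ℕ, Measurable fun ω : Outcome N K =>
      ENNReal.ofReal (Real.exp (3 * ((k : ℝ) + 1))) *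
      (lowerEvent (K := K) T pick sel v A k).indicator (1 : Outcome N K → ℝ≥0∞) ω := fun k =>
    measurable_const.mul (measurable_one.indicator (measurableSet_lowerEvent hsel v A k))
  simp only [h1]
  rw [lintegral_const_mul' _ _ ENNReal.ofReal_ne_top, lintegral_add_left measurable_const,
    lintegral_const, measure_univ, mul_one, lintegral_finsetSum _ fun k _ => hmeas k,
    ENNReal.ofReal_mul (by positivity), ENNReal.ofReal_add zero_le_one
      (Finset.sum_nonneg fun _ _ => by positivity), ENNReal.ofReal_one,
    ENNReal.ofReal_sum_of_nonneg fun _ _ => by positivity]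
  gcongr with k hk
  rw [lintegral_const_mul' _ _ ENNReal.ofReal_ne_top,
    lintegral_indicator_one (measurableSet_lowerEvent hsel v A k),
    ENNReal.ofReal_mul (by positivity)]
  gcongr
  refine measure_exists_lowerDeviation_le hsel hK hv hA (le_trans ?_ hm)
  exact_mod_cast (Finset.mem_range.1 hk).le

/-- The least level at which no preference of a product in `A` is underestimated. -/
noncomputable def optimismLevel (K T : ℕ) (v : Fin N → ℝ≥0) (A : Finset (Fin N)) (s : TSState N) :
    ℕ := sInf {k | ¬ LowerDeviation K T v A k s}

theorem GoodState.le_meanEst_add {v : Fin N → ℝ≥0} {A : Finset (Fin N)} {L : ℝ} {m : ℕ}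
    {s : TSState N} (h : GoodState K T v A L m s) : ∀ i ∈ A, (v i : ℝ) ≤
      meanEst (s.served i) (s.bought i) + √(optimismLevel K T v A s) *
        sigmaHat K T (s.served i) (s.bought i) := by
  have h1 : ¬ LowerDeviation K T v A (optimismLevel K T v A s) s :=
    Nat.sInf_mem (s := {k | ¬ LowerDeviation K T v A k s}) ⟨m, h.2.2⟩
  intro i hi
  by_contra h2
  exact h1 ⟨i, hi, Nat.pos_of_ne_zero (h.1 i), not_le.1 h2⟩

/-- If the least sufficient level `k` is positive, level `k - 1` fails, so `ω` lies in the
corresponding event, and the summand with index `k - 1` carries exactly `exp (3 k)`. -/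
theorem sq_optimismCost_le_optimismFactor {v : Fin N → ℝ≥0} {A : Finset (Fin N)} {L : ℝ} {m : ℕ}
    {ω : Outcome N K} {t : ℕ} (ht : t ≤ T)
    (h : GoodState K T v A L m (tsState T pick sel ω t)) :
    optimismCost K (optimismLevel K T v A (tsState T pick sel ω t)) ^ 2 ≤
      optimismFactor T pick sel v A m ω := by
  set s := tsState T pick sel ω t with hs
  set k := optimismLevel K T v A s with hk
  have hkm : k ≤ m := Nat.sInf_le h.2.2
  have hcost : optimismCost K k ^ 2 = optimismCost K 0 ^ 2 * Real.exp (3 * k) := by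
    have : Real.exp (3 / 2 * k) ^ 2 = Real.exp (3 * k) := by
      rw [← Real.exp_nat_mul]; congr 1; push_cast; ring
    unfold optimismCost
    rw [← this]
    simp only [Nat.cast_zero, mul_zero, Real.exp_zero, mul_one]
    ring
  rw [hcost]
  unfold optimismFactor
  refine mul_le_mul_of_nonneg_left ?_ (sq_nonneg _)
  have hnn : ∀ k ∈ Finset.range m, 0 ≤ Real.exp (3 * (k + 1)) *
      (lowerEvent (K := K) T pick sel v A k).indicator 1 ω := fun k _ =>
    mul_nonneg (Real.exp_pos _).le (Set.indicator_nonneg (fun _ _ => zero_le_one) _)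
  rcases Nat.eq_zero_or_pos k with h0 | h0
  · have := Finset.sum_nonneg hnn
    rw [h0]
    simp only [Nat.cast_zero, mul_zero, Real.exp_zero]
    linarith
  · have hlow : LowerDeviation K T v A (k - 1) s := by
      by_contra hcon
      have : k ≤ k - 1 := Nat.sInf_le hcon
      omega
    have hmem : ω ∈ lowerEvent (K := K) T pick sel v A (k - 1) := ⟨t, ht, hlow⟩
    have h1 := Finset.single_le_sum hnn (Finset.mem_range.2 (by omega : k - 1 < m))
    rw [Set.indicator_of_mem hmem, Pi.one_apply, mul_one] at h1
    have h2 : (((k - 1 : ℕ) : ℝ) + 1) = k := by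
      have : k - 1 + 1 = k := by omega
      exact_mod_cast this
    rw [h2] at h1
    linarith

end

end MNLBandit

namespace MNLBandit

/-! ### Decomposition of the regret -/

section

variable {N K T : ℕ} {pick : Finset (Fin N) → Fin N} {sel : (Fin N → ℝ) → Finset (Fin N)}
  {U : (ℝ → ℝ) → ℝ} {r : Fin N → ℝ}

theorem virtualValue_mono (hK : 1 ≤ K) (hU : QuasiconvexRisk U) (hr : ∀ i, 0 < r i ∧ r i ≤ 1)
    (hsel : ∀ w, IsSmallestOptimal U r K w (sel w)) (served bought : Fin N → ℕ)
    {θ θ' : Fin K → ℝ} (h : (⨆ j, θ j) ≤ ⨆ j, θ' j) :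
    virtualValue U r K T sel served bought θ ≤ virtualValue U r K T sel served bought θ' := by
  refine (hsel _).1.optimistic hU hr (hsel _).1.1.1 fun i hi => ?_
  rw [Real.coe_toNNReal _ ((hsel _).1.1.2 i hi), virtualPref_eq hK, virtualPref_eq hK]
  have := mul_le_mul_of_nonneg_right h (sigmaHat_nonneg K T (served i) (bought i))
  linarith

/-- No measurability of `U` is assumed; the virtual value is a monotone function of the largest
sample. -/
theorem measurable_virtualValue (hK : 1 ≤ K) (hU : QuasiconvexRisk U)
    (hr : ∀ i, 0 < r i ∧ r i ≤ 1) (hsel : ∀ w, IsSmallestOptimal U r K w (sel w))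
    (served bought : Fin N → ℕ) :
    Measurable fun θ : Fin K → ℝ => virtualValue U r K T sel served bought θ := by
  have : Nonempty (Fin K) := ⟨⟨0, hK⟩⟩
  have hmono : Monotone fun x : ℝ => virtualValue U r K T sel served bought fun _ : Fin K => x :=
    fun x y hxy => virtualValue_mono hK hU hr hsel _ _ (by simpa using hxy)
  have heq : (fun θ : Fin K → ℝ => virtualValue U r K T sel served bought θ) =
      (fun x : ℝ => virtualValue U r K T sel served bought fun _ : Fin K => x) ∘
        fun θ : Fin K → ℝ => ⨆ j, θ j := by
    funext θ
    exact le_antisymm (virtualValue_mono hK hU hr hsel _ _ (by simp))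
      (virtualValue_mono hK hU hr hsel _ _ (by simp))
  rw [heq]
  exact hmono.measurable.comp measurable_iSup_sample

theorem measurable_comp_sel {β : Type*} [MeasurableSpace β]
    (hselm : ∀ S, MeasurableSet {w | sel w = S}) (g : Finset (Fin N) → β) :
    Measurable fun w => g (sel w) := by
  intro B _
  have : (fun w : Fin N → ℝ => g (sel w)) ⁻¹' B = ⋃ S ∈ {S | g S ∈ B}, {w | sel w = S} := by
    ext w; simp
  rw [this]
  exact MeasurableSet.biUnion (Set.to_countable _) fun S _ => hselm S

open Classical in
/-- In a good state, how much the optimal value exceeds the one for the virtual preferences. -/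
noncomputable def shortfall (U : (ℝ → ℝ) → ℝ) (r : Fin N → ℝ) (K T : ℕ)
    (sel : (Fin N → ℝ) → Finset (Fin N)) (v : Fin N → ℝ≥0) (A : Finset (Fin N)) (L : ℝ) (m : ℕ)
    (s : TSState N) (y : Fin K → ℝ) : ℝ≥0∞ :=
  if GoodState K T v A L m s then
    ENNReal.ofReal (U (profitCDF r A v) - virtualValue U r K T sel s.served s.bought y) else 0

open Classical in
/-- The expectation of the shortfall is controlled by the expectation of this quantity. -/
noncomputable def shortfallBound (γ₂ : ℝ) (K T : ℕ)
    (sel : (Fin N → ℝ) → Finset (Fin N)) (v : Fin N → ℝ≥0) (A : Finset (Fin N)) (L : ℝ) (m : ℕ)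
    (s : TSState N) (y : Fin K → ℝ) : ℝ≥0∞ :=
  if GoodState K T v A L m s then
    ENNReal.ofReal (|γ₂| * optimismCost K (optimismLevel K T v A s)) *
      ENNReal.ofReal ((1 + max (⨆ j, y j) 0) *
        width K T s.served s.bought (sel (virtualPref K T s.served s.bought y))) else 0

open Classical in
/-- In a good state, how much the virtual preferences of the offered products exceed the true
ones. -/
noncomputable def excess (γ₂ : ℝ) (K T : ℕ) (v : Fin N → ℝ≥0) (A : Finset (Fin N)) (L : ℝ) (m : ℕ)
    (s : TSState N) (y : Fin K → ℝ) : ℝ≥0∞ :=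
  if GoodState K T v A L m s then ENNReal.ofReal (|γ₂| *
    ∑ i ∈ s.assortment, max (virtualPref K T s.served s.bought y i - v i) 0) else 0

theorem measurable_shortfall (hK : 1 ≤ K) (hU : QuasiconvexRisk U)
    (hr : ∀ i, 0 < r i ∧ r i ≤ 1) (hsel : ∀ w, IsSmallestOptimal U r K w (sel w))
    (v : Fin N → ℝ≥0) (A : Finset (Fin N)) (L : ℝ) (m : ℕ) (s : TSState N) :
    Measurable (shortfall U r K T sel v A L m s) := by
  unfold shortfall
  split_ifs
  · exact ENNReal.measurable_ofReal.comp
      (measurable_const.sub (measurable_virtualValue hK hU hr hsel _ _))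
  · exact measurable_const

theorem measurable_width_sel (hselm : ∀ S, MeasurableSet {w | sel w = S})
    (served bought : Fin N → ℕ) : Measurable fun y : Fin K → ℝ =>
      ENNReal.ofReal ((1 + max (⨆ j, y j) 0) *
        width K T served bought (sel (virtualPref K T served bought y))) :=
  ENNReal.measurable_ofReal.comp
    (((measurable_iSup_sample.max measurable_const).const_add 1).mul
      ((measurable_comp_sel hselm (width K T served bought)).comp
        (measurable_virtualPref T served bought)))

theorem measurable_shortfallBound (hselm : ∀ S, MeasurableSet {w | sel w = S}) (γ₂ : ℝ)
    (v : Fin N → ℝ≥0) (A : Finset (Fin N)) (L : ℝ) (m : ℕ) (s : TSState N) :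
    Measurable (shortfallBound γ₂ K T sel v A L m s) := by
  unfold shortfallBound
  split_ifs
  · exact (measurable_width_sel hselm _ _).const_mul _
  · exact measurable_const

theorem measurable_excess (γ₂ : ℝ) (v : Fin N → ℝ≥0) (A : Finset (Fin N)) (L : ℝ) (m : ℕ)
    (s : TSState N) : Measurable (excess γ₂ K T v A L m s) := by
  unfold excess
  split_ifs
  · refine ENNReal.measurable_ofReal.comp (measurable_const.mul
      (Finset.measurable_fun_sum _ fun i _ => ?_))
    exact (((measurable_pi_apply i).comp
      (measurable_virtualPref T s.served s.bought)).sub_const _).max measurable_const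
  · exact measurable_const

theorem lintegral_shortfall_le {γ₂ : ℝ} (hK : 1 ≤ K) (hU : QuasiconvexRisk U)
    (hr : ∀ i, 0 < r i ∧ r i ≤ 1) (hlip : OneSidedLipschitzRisk U r γ₂)
    (hsel : ∀ w, IsSmallestOptimal U r K w (sel w)) (hselm : ∀ S, MeasurableSet {w | sel w = S})
    (v : Fin N → ℝ≥0) {A : Finset (Fin N)} (hA : A.card ≤ K) (L : ℝ) (m : ℕ) (s : TSState N) :
    (1 + K : ℝ≥0∞) * ∫⁻ y, shortfall U r K T sel v A L m s y ∂(sampleMeasure K) ≤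
      ∫⁻ y, shortfallBound γ₂ K T sel v A L m s y ∂(sampleMeasure K) := by
  unfold shortfall shortfallBound
  split_ifs with h
  · rw [lintegral_const_mul _ (measurable_width_sel hselm _ _)]
    exact lintegral_optimalValue_sub_virtualValue_le hK hU hr hlip hsel hselm hA h.le_meanEst_add
  · simp

/-- The counts after the end of the current episode. -/
def TSState.next (s : TSState N) : TSState N where
  episode := s.episode + 1
  served := fun i => if i ∈ s.assortment then s.served i + 1 else s.served i
  bought := fun i => if i ∈ s.assortment then s.bought i + s.current i else s.bought i
  current := fun _ => 0
  assortment := ∅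

theorem tsState_succ_of_noPurchase {ω : Outcome N K} {t : ℕ}
    (hc : choiceAt T pick sel ω t = 0) : tsState T pick sel ω (t + 1) =
      { (tsState T pick sel ω t).next with
        assortment := tsSelect K T pick sel (tsState T pick sel ω t).next.served
          (tsState T pick sel ω t).next.bought
          fun j => ω.1 ((tsState T pick sel ω t).episode + 1, j) } := by
  rw [tsState_succ, tsStep, if_pos hc]
  rfl

theorem GoodState.assortment_eq {v : Fin N → ℝ≥0} {A : Finset (Fin N)} {L : ℝ} {m : ℕ}
    {ω : Outcome N K} {t : ℕ} (h : GoodState K T v A L m (tsState T pick sel ω t)) :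
    (tsState T pick sel ω t).assortment = sel (virtualPref K T (tsState T pick sel ω t).served
      (tsState T pick sel ω t).bought (sampleAt T pick sel ω t)) := by
  rw [tsState_assortment, tsSelect, if_neg]
  · rfl
  · rintro ⟨i, hi⟩
    exact h.1 i hi

/-- An episode in a good state ends at each step with probability at least `1 / (1 + K)`, so `1 + K`
times the shortfalls at episode ends suffice. Shifted to the next episode, the sample is independent
of the counts in `next`, and `lintegral_shortfall_le` absorbs `1 + K`. The rest is a bound along
each path. -/
theorem sum_lintegral_shortfall_le {γ₂ : ℝ} (hK : 1 ≤ K) (hKN : K ≤ N) (hU : QuasiconvexRisk U)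
    (hr : ∀ i, 0 < r i ∧ r i ≤ 1) (hlip : OneSidedLipschitzRisk U r γ₂)
    (hsel : ∀ w, IsSmallestOptimal U r K w (sel w)) (hselm : ∀ S, MeasurableSet {w | sel w = S})
    {v : Fin N → ℝ≥0} (hv : ∀ i, v i ≤ 1) {A : Finset (Fin N)} (hA : A.card ≤ K) {L : ℝ}
    (hL : 1 ≤ L) (m : ℕ) {b : ℝ} (hb : 0 ≤ b) :
    ∑ t ∈ Finset.range T, ∫⁻ ω, shortfall U r K T sel v A L m (tsState T pick sel ω t)
        (sampleAt T pick sel ω t) ∂(outcomeMeasure K v) ≤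
      ∫⁻ ω, ENNReal.ofReal (|γ₂| * widthBound N K T L / 2 *
        (optimismFactor T pick sel v A m ω + sampleFactor T b ω)) ∂(outcomeMeasure K v) := by
  classical
  set φ : TSState N → (Fin K → ℝ) → ℝ≥0∞ := shortfall U r K T sel v A L m with hφ
  set ψ : TSState N → (Fin K → ℝ) → ℝ≥0∞ := shortfallBound γ₂ K T sel v A L m with hψ
  set f : ℕ → Outcome N K → ℝ≥0∞ := fun t ω =>
    φ (tsState T pick sel ω t) (sampleAt T pick sel ω t) with hf
  have hφm := measurable_shortfall (T := T) hK hU hr hsel v A L m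
  have hψm := measurable_shortfallBound (K := K) (T := T) hselm γ₂ v A L m
  have hfm : ∀ t, Measurable (f t) := fun t => measurable_comp_state_sample hselm hφm t
  -- pay for each episode when it ends
  have h1 : ∀ t, ∫⁻ ω, f t ω ∂(outcomeMeasure K v) ≤ (1 + K : ℝ≥0∞) *
      ∫⁻ ω, (if choiceAt T pick sel ω t = 0 then f t ω else 0) ∂(outcomeMeasure K v) := by
    intro t
    rw [lintegral_mul_noPurchase hselm v (hfm t) (dependsOnPast_comp_state_sample φ t),
      ← lintegral_const_mul' _ _ (by finiteness)]
    refine lintegral_mono fun ω => ?_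
    by_cases hg : GoodState K T v A L m (tsState T pick sel ω t)
    · have hcard : (tsState T pick sel ω t).assortment.card ≤ K := by
        rw [hg.assortment_eq]; exact (hsel _).1.1.1
      have hV : ∑ i ∈ (tsState T pick sel ω t).assortment, (v i : ℝ) ≤ K := by
        refine (Finset.sum_le_card_nsmul _ _ 1 fun i _ => by exact_mod_cast hv i).trans ?_
        simpa using (by exact_mod_cast hcard :
          ((tsState T pick sel ω t).assortment.card : ℝ) ≤ (K : ℝ))
      have hV0 : (0 : ℝ) ≤ ∑ i ∈ (tsState T pick sel ω t).assortment, (v i : ℝ) :=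
        Finset.sum_nonneg fun i _ => (v i).2
      have hone : 1 ≤ (1 + K : ℝ≥0∞) * ENNReal.ofReal
          (1 / (1 + ∑ i ∈ (tsState T pick sel ω t).assortment, (v i : ℝ))) := by
        have hKc : (1 + K : ℝ≥0∞) = ENNReal.ofReal (1 + K) := by
          rw [ENNReal.ofReal_add zero_le_one (Nat.cast_nonneg _)]; simp
        rw [hKc, ← ENNReal.ofReal_mul (by positivity), ← ENNReal.ofReal_one]
        refine ENNReal.ofReal_le_ofReal ?_
        rw [mul_one_div, le_div_iff₀ (by positivity)]
        linarith
      calc f t ω = f t ω * 1 := (mul_one _).symm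
        _ ≤ f t ω * ((1 + K : ℝ≥0∞) * ENNReal.ofReal
          (1 / (1 + ∑ i ∈ (tsState T pick sel ω t).assortment, (v i : ℝ)))) := by gcongr
        _ = _ := by ring
    · simp [hf, hφ, shortfall, hg]
  -- move to the beginning of the next episode
  have h2 : ∀ ω, (∑ t ∈ Finset.range T, if choiceAt T pick sel ω t = 0 then f t ω else 0) ≤
      ∑ t ∈ Finset.range T, if choiceAt T pick sel ω t = 0 then φ (tsState T pick sel ω t).next
        (fun j => ω.1 ((tsState T pick sel ω t).episode + 1, j)) else 0 := by
    intro ω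
    have htel := sum_ite_add_eq_add_sum_ite_succ (fun t => choiceAt T pick sel ω t = 0)
      (fun t => f t ω) (fun t hc => by
        simp only [hf]
        have hs : tsState T pick sel ω (t + 1) = { (tsState T pick sel ω t) with
            current := fun i => if choiceAt T pick sel ω t = i.succ then
              (tsState T pick sel ω t).current i + 1 else (tsState T pick sel ω t).current i } := by
          rw [tsState_succ, tsStep, if_neg hc]
        have hsam : sampleAt T pick sel ω (t + 1) = sampleAt T pick sel ω t := by
          funext j
          simp only [sampleAt, hs]
        rw [hsam, hs]
        rfl) T
    -- Initially no product has been served, so the first boundary term vanishes.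
    have h0 : f 0 ω = 0 := by
      have : ¬ GoodState K T v A L m (tsState T pick sel ω 0) := fun h =>
        h.1 ⟨0, by omega⟩ rfl
      simp only [hf, hφ, shortfall, this, if_false]
    rw [h0, zero_add] at htel
    refine le_self_add.trans (htel.le.trans (Finset.sum_le_sum fun t _ => ?_))
    split_ifs with hc
    · simp only [hf]
      have hsam : sampleAt T pick sel ω (t + 1) =
          fun j => ω.1 ((tsState T pick sel ω t).episode + 1, j) := by
        funext j
        simp only [sampleAt, tsState_succ_of_noPurchase hc]
        rfl
      rw [hsam, tsState_succ_of_noPurchase hc]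
      exact le_rfl
    · exact le_rfl
  -- replace the shortfall by its bound
  have h3 : ∀ t, (1 + K : ℝ≥0∞) * ∫⁻ ω, (if choiceAt T pick sel ω t = 0 then
        φ (tsState T pick sel ω t).next
          (fun j => ω.1 ((tsState T pick sel ω t).episode + 1, j)) else 0) ∂(outcomeMeasure K v) ≤
      ∫⁻ ω, (if choiceAt T pick sel ω t = 0 then ψ (tsState T pick sel ω t).next
          (fun j => ω.1 ((tsState T pick sel ω t).episode + 1, j)) else 0)
        ∂(outcomeMeasure K v) := by
    intro t
    rw [lintegral_next_sample hselm v t (Φ := fun s => φ s.next) (fun s => hφm s.next),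
      lintegral_next_sample hselm v t (Φ := fun s => ψ s.next) (fun s => hψm s.next),
      ← lintegral_const_mul' _ _ (by finiteness)]
    refine lintegral_mono fun ω => ?_
    split_ifs
    · exact lintegral_shortfall_le hK hU hr hlip hsel hselm v hA L m _
    · simp
  have hmeas1 : ∀ t, Measurable fun ω : Outcome N K =>
      if choiceAt T pick sel ω t = 0 then f t ω else 0 := fun t =>
    Measurable.ite (measurable_choiceAt hselm t (measurableSet_singleton 0)) (hfm t)
      measurable_const
  have hmeas2 : ∀ Φ : TSState N → (Fin K → ℝ) → ℝ≥0∞, (∀ s, Measurable (Φ s)) → ∀ t,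
      Measurable fun ω : Outcome N K => if choiceAt T pick sel ω t = 0 then
        Φ (tsState T pick sel ω t).next
          (fun j => ω.1 ((tsState T pick sel ω t).episode + 1, j)) else 0 := by
    intro Φ hΦ t
    refine Measurable.ite (measurable_choiceAt hselm t (measurableSet_singleton 0)) ?_
      measurable_const
    have h : Measurable fun p : TSState N × Outcome N K =>
        Φ p.1.next fun j => p.2.1 (p.1.episode + 1, j) :=
      measurable_from_prod_countable_right fun s =>
        show Measurable fun ω : Outcome N K => Φ s.next fun j => ω.1 (s.episode + 1, j) from
          (hΦ _).comp (by fun_prop)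
    exact h.comp ((measurable_tsState hselm t).prodMk measurable_id)
  calc ∑ t ∈ Finset.range T, ∫⁻ ω, f t ω ∂(outcomeMeasure K v)
      ≤ ∑ t ∈ Finset.range T, (1 + K : ℝ≥0∞) *
        ∫⁻ ω, (if choiceAt T pick sel ω t = 0 then f t ω else 0) ∂(outcomeMeasure K v) :=
        Finset.sum_le_sum fun t _ => h1 t
    _ = (1 + K : ℝ≥0∞) * ∫⁻ ω, ∑ t ∈ Finset.range T,
          (if choiceAt T pick sel ω t = 0 then f t ω else 0) ∂(outcomeMeasure K v) := by
        rw [← Finset.mul_sum, lintegral_finsetSum _ fun t _ => hmeas1 t]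
    _ ≤ (1 + K : ℝ≥0∞) * ∫⁻ ω, ∑ t ∈ Finset.range T, (if choiceAt T pick sel ω t = 0 then
          φ (tsState T pick sel ω t).next
          (fun j => ω.1 ((tsState T pick sel ω t).episode + 1, j)) else 0)
          ∂(outcomeMeasure K v) := by
        exact mul_le_mul' le_rfl (lintegral_mono h2)
    _ = ∑ t ∈ Finset.range T, (1 + K : ℝ≥0∞) * ∫⁻ ω, (if choiceAt T pick sel ω t = 0 then
          φ (tsState T pick sel ω t).next
          (fun j => ω.1 ((tsState T pick sel ω t).episode + 1, j)) else 0)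
          ∂(outcomeMeasure K v) := by
        rw [lintegral_finsetSum _ fun t _ => hmeas2 φ hφm t, Finset.mul_sum]
    _ ≤ ∑ t ∈ Finset.range T, ∫⁻ ω, (if choiceAt T pick sel ω t = 0 then
          ψ (tsState T pick sel ω t).next
          (fun j => ω.1 ((tsState T pick sel ω t).episode + 1, j)) else 0)
          ∂(outcomeMeasure K v) := Finset.sum_le_sum fun t _ => h3 t
    _ = ∫⁻ ω, ∑ t ∈ Finset.range T, (if choiceAt T pick sel ω t = 0 then
          ψ (tsState T pick sel ω t).next
          (fun j => ω.1 ((tsState T pick sel ω t).episode + 1, j)) else 0)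
          ∂(outcomeMeasure K v) := (lintegral_finsetSum _ fun t _ => hmeas2 ψ hψm t).symm
    _ ≤ _ := by
        refine lintegral_mono fun ω => ?_
        set F := optimismFactor T pick sel v A m ω + sampleFactor T b ω with hF
        have hF0 : 0 ≤ F := add_nonneg (optimismFactor_nonneg _ _ _ _) (sampleFactor_nonneg _ _ _)
        have hterm : ∀ t ∈ Finset.range T, (if choiceAt T pick sel ω t = 0 then
            ψ (tsState T pick sel ω t).next
            (fun j => ω.1 ((tsState T pick sel ω t).episode + 1, j)) else 0) ≤
            ENNReal.ofReal (|γ₂| / 2 * F * if choiceAt T pick sel ω t = 0 then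
              goodWidth K T v A L m (tsState T pick sel ω (t + 1)) else 0) := by
          intro t ht
          by_cases hc : choiceAt T pick sel ω t = 0
          · simp only [hc, if_true]
            by_cases hg : GoodState K T v A L m (tsState T pick sel ω t).next
            · set s := tsState T pick sel ω t with hs
              set y : Fin K → ℝ := fun j => ω.1 (s.episode + 1, j)
              have hsucc := tsState_succ_of_noPurchase hc
              rw [← hs] at hsucc
              have hg' : GoodState K T v A L m (tsState T pick sel ω (t + 1)) := by
                rw [hsucc]; exact hg
              have hsel' : tsSelect K T pick sel s.next.served s.next.bought y =
                  sel (virtualPref K T s.next.served s.next.bought y) := by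
                rw [tsSelect, if_neg]
                rintro ⟨i, hi⟩
                exact hg.1 i hi
              have hw : goodWidth K T v A L m (tsState T pick sel ω (t + 1)) =
                  width K T s.next.served s.next.bought
                    (sel (virtualPref K T s.next.served s.next.bought y)) := by
                rw [goodWidth, if_pos hg', ← hsel', hsucc]
              have hlev : optimismLevel K T v A (tsState T pick sel ω (t + 1)) =
                  optimismLevel K T v A s.next := by
                rw [hsucc]; rfl
              have hc2 := sq_optimismCost_le_optimismFactor (pick := pick) (sel := sel) (ω := ω)
                (t := t + 1) (Finset.mem_range.1 ht) hg'
              rw [hlev] at hc2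
              have hy2 := sq_le_sampleFactor (T := T) hK hb ω (l := s.episode + 1)
                ((Nat.succ_le_succ (tsState_episode_le ω t)).trans (Finset.mem_range.1 ht))
              simp only [hψ, shortfallBound, hg, if_true]
              rw [hw, ← ENNReal.ofReal_mul (mul_nonneg (abs_nonneg _) (optimismCost_nonneg _ _))]
              refine ENNReal.ofReal_le_ofReal ?_
              rw [← mul_assoc]
              refine mul_le_mul_of_nonneg_right ?_ (width_nonneg _ _ _ _ _)
              -- The arithmetic-geometric mean inequality splits the product into squares, which
              -- have bounds uniform in `t` and integrable in `ω`.
              have hprod : optimismCost K (optimismLevel K T v A s.next) *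
                  (1 + max (⨆ j, y j) 0) ≤ F / 2 := by
                have := two_mul_le_add_sq (optimismCost K (optimismLevel K T v A s.next))
                  (1 + max (⨆ j, y j) 0)
                linarith
              calc |γ₂| * optimismCost K (optimismLevel K T v A s.next) * (1 + max (⨆ j, y j) 0)
                  = |γ₂| * (optimismCost K (optimismLevel K T v A s.next) *
                    (1 + max (⨆ j, y j) 0)) := by ring
                _ ≤ |γ₂| * (F / 2) := by gcongr
                _ = _ := by ring
            · simp [hψ, shortfallBound, hg]
          · simp [hc]
        refine (Finset.sum_le_sum hterm).trans ?_
        have hnn : ∀ t ∈ Finset.range T, 0 ≤ |γ₂| / 2 * F * if choiceAt T pick sel ω t = 0 then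
              goodWidth K T v A L m (tsState T pick sel ω (t + 1)) else 0 := by
          intro t _
          refine mul_nonneg (by positivity) ?_
          split_ifs
          · exact goodWidth_nonneg _ _ _ _ _ _ _
          · exact le_rfl
        rw [← ENNReal.ofReal_sum_of_nonneg hnn, ← Finset.mul_sum]
        refine ENNReal.ofReal_le_ofReal ?_
        calc |γ₂| / 2 * F * _ ≤ |γ₂| / 2 * F * widthBound N K T L := by
              refine mul_le_mul_of_nonneg_left ?_ (by positivity)
              exact sum_goodWidth_succ_le hv hL A m ω
          _ = _ := by ring

/-- The weight turns the sum into one over episode ends, with no factor `K`. In a good state the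
excess of a product is at most `5 L σ̂` for the estimate plus the largest sample times `σ̂`. -/
theorem sum_lintegral_excess_le (hK : 1 ≤ K) (γ₂ : ℝ)
    (hselm : ∀ S, MeasurableSet {w | sel w = S})
    {v : Fin N → ℝ≥0} (hv : ∀ i, v i ≤ 1) (A : Finset (Fin N)) {L : ℝ}
    (hL : 1 ≤ L) (hTK : 1 ≤ 75 * √(Real.log (T * K))) (m : ℕ) {b : ℝ} (hb : 0 ≤ b) :
    ∑ t ∈ Finset.range T, ∫⁻ ω, excess γ₂ K T v A L m (tsState T pick sel ω t)
        (sampleAt T pick sel ω t) * ENNReal.ofReal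
          (1 / (1 + ∑ i ∈ (tsState T pick sel ω t).assortment, (v i : ℝ))) ∂(outcomeMeasure K v) ≤
      ∫⁻ ω, ENNReal.ofReal (|γ₂| * widthBound N K T L *
        (5 * L + sampleFactor T b ω)) ∂(outcomeMeasure K v) := by
  have hem : ∀ t, Measurable fun ω : Outcome N K =>
      excess γ₂ K T v A L m (tsState T pick sel ω t) (sampleAt T pick sel ω t) := fun t =>
    measurable_comp_state_sample hselm (measurable_excess γ₂ v A L m) t
  have h1 : ∀ t, ∫⁻ ω, excess γ₂ K T v A L m (tsState T pick sel ω t)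
        (sampleAt T pick sel ω t) * ENNReal.ofReal
          (1 / (1 + ∑ i ∈ (tsState T pick sel ω t).assortment, (v i : ℝ))) ∂(outcomeMeasure K v) =
      ∫⁻ ω, (if choiceAt T pick sel ω t = 0 then excess γ₂ K T v A L m (tsState T pick sel ω t)
        (sampleAt T pick sel ω t) else 0) ∂(outcomeMeasure K v) := fun t =>
    (lintegral_mul_noPurchase hselm v (hem t) (dependsOnPast_comp_state_sample _ t)).symm
  have hmeas : ∀ t, Measurable fun ω : Outcome N K => if choiceAt T pick sel ω t = 0 then
      excess γ₂ K T v A L m (tsState T pick sel ω t) (sampleAt T pick sel ω t) else 0 := fun t =>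
    Measurable.ite (measurable_choiceAt hselm t (measurableSet_singleton 0)) (hem t)
      measurable_const
  simp only [h1]
  rw [← lintegral_finsetSum _ fun t _ => hmeas t]
  refine lintegral_mono fun ω => ?_
  set F := 5 * L + sampleFactor T b ω with hF
  have hS0 := sampleFactor_nonneg T b ω
  have hF0 : 0 ≤ F := by positivity
  have hterm : ∀ t ∈ Finset.range T, (if choiceAt T pick sel ω t = 0 then
      excess γ₂ K T v A L m (tsState T pick sel ω t) (sampleAt T pick sel ω t) else 0) ≤
      ENNReal.ofReal (|γ₂| * F * if choiceAt T pick sel ω t = 0 then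
        goodWidth K T v A L m (tsState T pick sel ω t) else 0) := by
    intro t ht
    by_cases hc : choiceAt T pick sel ω t = 0
    · simp only [hc, if_true]
      by_cases hg : GoodState K T v A L m (tsState T pick sel ω t)
      · simp only [excess, hg, if_true, goodWidth]
        refine ENNReal.ofReal_le_ofReal ?_
        rw [mul_assoc]
        refine mul_le_mul_of_nonneg_left ?_ (abs_nonneg _)
        rw [width, Finset.mul_sum]
        refine Finset.sum_le_sum fun i _ => ?_
        set s := tsState T pick sel ω t with hs
        have hσ := sigmaHat_nonneg K T (s.served i) (s.bought i)
        refine max_le ?_ (mul_nonneg hF0 hσ)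
        rw [virtualPref_eq hK]
        have hmean := meanEst_sub_le hL hTK hg.1 hg.2.1 i
        have hy2 := sq_le_sampleFactor (T := T) hK hb ω (l := s.episode)
          ((tsState_episode_le ω t).trans (Finset.mem_range.1 ht).le)
        have hmax := le_max_left (⨆ j, sampleAt T pick sel ω t j) 0
        have hmax0 := le_max_right (⨆ j, sampleAt T pick sel ω t j) 0
        have hy3 : (⨆ j, sampleAt T pick sel ω t j) ≤ sampleFactor T b ω := by
          have e : (⨆ j, ω.1 (s.episode, j)) = ⨆ j, sampleAt T pick sel ω t j := rfl
          rw [e] at hy2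
          nlinarith
        have h5 := mul_le_mul_of_nonneg_right hy3 hσ
        rw [hF, add_mul]
        linarith
      · simp [excess, hg]
    · simp [hc]
  refine (Finset.sum_le_sum hterm).trans ?_
  have hnn : ∀ t ∈ Finset.range T, 0 ≤ |γ₂| * F * if choiceAt T pick sel ω t = 0 then
        goodWidth K T v A L m (tsState T pick sel ω t) else 0 := by
    intro t _
    refine mul_nonneg (by positivity) ?_
    split_ifs
    · exact goodWidth_nonneg _ _ _ _ _ _ _
    · exact le_rfl
  rw [← ENNReal.ofReal_sum_of_nonneg hnn, ← Finset.mul_sum]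
  refine ENNReal.ofReal_le_ofReal ?_
  calc |γ₂| * F * _ ≤ |γ₂| * F * widthBound N K T L := by
        refine mul_le_mul_of_nonneg_left ?_ (by positivity)
        have h2 := sum_goodWidth_le (T := T) (pick := pick) (sel := sel) hv hL A m ω
        have h3 := goodWidth_nonneg K T v A L m (tsState T pick sel ω T)
        linarith
    _ = _ := by ring

/-- An exploratory episode offers one product with preference at most `1`, so it ends at each step
with probability at least `1/2`; hence the factor `2`. -/
theorem sum_measure_unserved_le (hpick : ∀ A : Finset (Fin N), A.Nonempty → pick A ∈ A)
    (hselm : ∀ S, MeasurableSet {w | sel w = S}) {v : Fin N → ℝ≥0} (hv : ∀ i, v i ≤ 1) (n : ℕ) :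
    ∑ t ∈ Finset.range n, outcomeMeasure K v {ω | ∃ i, (tsState T pick sel ω t).served i = 0} ≤
      2 * N := by
  classical
  set E : ℕ → Set (Outcome N K) := fun t => {ω | ∃ i, (tsState T pick sel ω t).served i = 0}
  set f : ℕ → Outcome N K → ℝ≥0∞ := fun t => (E t).indicator 1 with hf
  have hEm : ∀ t, MeasurableSet (E t) := fun t => measurable_tsState hselm t
    (MeasurableSet.of_discrete (s := {s : TSState N | ∃ i, s.served i = 0}))
  have hfm : ∀ t, Measurable (f t) := fun t => measurable_one.indicator (hEm t)
  have hfp : ∀ t, DependsOnPast t (f t) := fun t =>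
    dependsOnPast_comp_state (K := K) (T := T) (pick := pick) (sel := sel) (t := t)
      ({s : TSState N | ∃ i, s.served i = 0}.indicator (1 : TSState N → ℝ≥0∞)) le_rfl
  have h1 : ∀ t, outcomeMeasure K v (E t) ≤
      2 * ∫⁻ ω, (if choiceAt T pick sel ω t = 0 then f t ω else 0) ∂(outcomeMeasure K v) := by
    intro t
    rw [lintegral_mul_noPurchase hselm v (hfm t) (hfp t), ← lintegral_indicator_one (hEm t),
      ← lintegral_const_mul' _ _ (by finiteness)]
    refine lintegral_mono fun ω => ?_
    by_cases h : ω ∈ E t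
    · have hone : (tsState T pick sel ω t).assortment.card = 1 := by
        have h' : ∃ i, (tsState T pick sel ω t).served i = 0 := h
        rw [tsState_assortment, tsSelect, if_pos h', Finset.card_singleton]
      have hV : ∑ i ∈ (tsState T pick sel ω t).assortment, (v i : ℝ) ≤ 1 := by
        refine (Finset.sum_le_card_nsmul _ _ 1 fun i _ => by exact_mod_cast hv i).trans ?_
        simp [hone]
      have hV0 : (0 : ℝ) ≤ ∑ i ∈ (tsState T pick sel ω t).assortment, (v i : ℝ) :=
        Finset.sum_nonneg fun i _ => (v i).2
      simp only [hf, Set.indicator_of_mem h, Pi.one_apply, one_mul]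
      rw [show (2 : ℝ≥0∞) = ENNReal.ofReal 2 by simp, ← ENNReal.ofReal_mul (by norm_num),
        ← ENNReal.ofReal_one]
      refine ENNReal.ofReal_le_ofReal ?_
      rw [mul_one_div, le_div_iff₀ (by positivity)]
      linarith
    · simp [Set.indicator_of_notMem h]
  have hmeas : ∀ t, Measurable fun ω : Outcome N K =>
      if choiceAt T pick sel ω t = 0 then f t ω else 0 := fun t =>
    Measurable.ite (measurable_choiceAt hselm t (measurableSet_singleton 0)) (hfm t)
      measurable_const
  refine (Finset.sum_le_sum fun t _ => h1 t).trans ?_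
  rw [← Finset.mul_sum, ← lintegral_finsetSum _ fun t _ => hmeas t]
  refine mul_le_mul' le_rfl ?_
  calc ∫⁻ ω, ∑ t ∈ Finset.range n, (if choiceAt T pick sel ω t = 0 then f t ω else 0)
        ∂(outcomeMeasure K v) ≤ ∫⁻ _, (N : ℝ≥0∞) ∂(outcomeMeasure K v) := by
        refine lintegral_mono fun ω => ?_
        have h2 := sum_unserved_le (T := T) (sel := sel) hpick ω n
        have h3 : ∀ t, (if choiceAt T pick sel ω t = 0 then f t ω else 0) =
            (((if choiceAt T pick sel ω t = 0 ∧ ∃ i, (tsState T pick sel ω t).served i = 0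
              then 1 else 0 : ℕ)) : ℝ≥0∞) := by
          intro t
          by_cases hc : choiceAt T pick sel ω t = 0
          · by_cases h : ω ∈ E t
            · have h' : ∃ i, (tsState T pick sel ω t).served i = 0 := h
              simp [hc, hf, h, h']
            · have h' : ¬ ∃ i, (tsState T pick sel ω t).served i = 0 := h
              simp [hc, hf, h, h']
          · simp [hc]
        simp only [h3]
        exact_mod_cast h2
    _ = N := by simp

end

end MNLBandit

namespace MNLBandit

/-! ### The regret bound -/

section

variable {N K T : ℕ} {pick : Finset (Fin N) → Fin N} {sel : (Fin N → ℝ) → Finset (Fin N)}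
  {U : (ℝ → ℝ) → ℝ} {r : Fin N → ℝ}

/-- The expected loss at time `t` given the offered assortment. -/
noncomputable def instantRegret (U : (ℝ → ℝ) → ℝ) (r : Fin N → ℝ) (v : Fin N → ℝ≥0) (K T : ℕ)
    (pick : Finset (Fin N) → Fin N) (sel : (Fin N → ℝ) → Finset (Fin N)) (ω : Outcome N K)
    (t : ℕ) : ℝ :=
  optimalValue U r K v - U (profitCDF r (tsState T pick sel ω t).assortment v)

theorem card_tsState_assortment_le (hK : 1 ≤ K) (hsel : ∀ w, IsSmallestOptimal U r K w (sel w))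
    (ω : Outcome N K) (t : ℕ) : (tsState T pick sel ω t).assortment.card ≤ K := by
  rw [tsState_assortment, tsSelect]
  split_ifs
  · simpa using hK
  · exact (hsel _).1.1.1

theorem instantRegret_nonneg (hK : 1 ≤ K) (hsel : ∀ w, IsSmallestOptimal U r K w (sel w))
    (v : Fin N → ℝ≥0) (ω : Outcome N K) (t : ℕ) : 0 ≤ instantRegret U r v K T pick sel ω t :=
  sub_nonneg.2 (le_optimalValue U r v (card_tsState_assortment_le hK hsel ω t))

theorem instantRegret_le {γ₁ : ℝ} (hU : BoundedRisk U γ₁) (hr : ∀ i, 0 < r i ∧ r i ≤ 1)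
    (v : Fin N → ℝ≥0) (ω : Outcome N K) (t : ℕ) :
    instantRegret U r v K T pick sel ω t ≤ 2 * |γ₁| := by
  obtain ⟨A, -, hA⟩ := exists_eq_optimalValue U r K v
  have h1 := abs_le.1 (hU _ (profitCDF_mem_unitCDFs hr A v))
  have h2 := abs_le.1 (hU _ (profitCDF_mem_unitCDFs hr (tsState T pick sel ω t).assortment v))
  have h3 := le_abs_self γ₁
  rw [instantRegret, ← hA]
  linarith [h1.2, h2.1]

theorem tsRegret_le_of_lintegral_le {γ₁ : ℝ} (hK : 1 ≤ K) (hU : BoundedRisk U γ₁)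
    (hr : ∀ i, 0 < r i ∧ r i ≤ 1) (hsel : ∀ w, IsSmallestOptimal U r K w (sel w))
    (hselm : ∀ S, MeasurableSet {w | sel w = S}) (v : Fin N → ℝ≥0) {X : ℝ} (hX : 0 ≤ X)
    (h : ∫⁻ ω, ∑ t ∈ Finset.range T, ENNReal.ofReal (instantRegret U r v K T pick sel ω t)
      ∂(outcomeMeasure K v) ≤ ENNReal.ofReal X) :
    tsRegret U r v K T pick sel ≤ X := by
  have hint : Integrable (fun ω : Outcome N K => ∑ t ∈ Finset.range T,
      U (profitCDF r (tsState T pick sel ω t).assortment v)) (outcomeMeasure K v) := by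
    refine integrable_finsetSum _ fun t _ => ?_
    refine Integrable.of_bound (measurable_comp_state hselm
      (fun s => U (profitCDF r s.assortment v)) t).aestronglyMeasurable γ₁ ?_
    exact Filter.Eventually.of_forall fun ω => hU _ (profitCDF_mem_unitCDFs hr _ v)
  have heq : tsRegret U r v K T pick sel = ∫ ω, ∑ t ∈ Finset.range T,
      instantRegret U r v K T pick sel ω t ∂(outcomeMeasure K v) := by
    have h1 : ∀ ω : Outcome N K, ∑ t ∈ Finset.range T, instantRegret U r v K T pick sel ω t =
        T * optimalValue U r K v - ∑ t ∈ Finset.range T,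
          U (profitCDF r (tsState T pick sel ω t).assortment v) := fun ω => by
      simp [instantRegret]
    simp only [h1]
    rw [integral_sub (integrable_const _) hint, integral_const, tsRegret]
    simp
  rw [heq, integral_eq_lintegral_of_nonneg_ae]
  · refine ENNReal.toReal_le_of_le_ofReal hX (le_trans (le_of_eq ?_) h)
    refine lintegral_congr fun ω => ?_
    exact ENNReal.ofReal_sum_of_nonneg fun t _ => instantRegret_nonneg hK hsel v ω t
  · exact Filter.Eventually.of_forall fun ω => Finset.sum_nonneg fun t _ =>
      instantRegret_nonneg hK hsel v ω t
  · exact (Finset.measurable_fun_sum _ fun t _ => measurable_comp_state hselm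
      (fun s => optimalValue U r K v - U (profitCDF r s.assortment v)) t).aestronglyMeasurable

theorem tsRegret_le_mul_horizon {γ₁ : ℝ} (hK : 1 ≤ K) (hU : BoundedRisk U γ₁)
    (hr : ∀ i, 0 < r i ∧ r i ≤ 1) (hsel : ∀ w, IsSmallestOptimal U r K w (sel w))
    (hselm : ∀ S, MeasurableSet {w | sel w = S}) (v : Fin N → ℝ≥0) :
    tsRegret U r v K T pick sel ≤ 2 * |γ₁| * T := by
  refine tsRegret_le_of_lintegral_le hK hU hr hsel hselm v (by positivity) ?_
  calc ∫⁻ ω, ∑ t ∈ Finset.range T, ENNReal.ofReal (instantRegret U r v K T pick sel ω t)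
        ∂(outcomeMeasure K v)
      ≤ ∫⁻ _, ∑ t ∈ Finset.range T, ENNReal.ofReal (2 * |γ₁|) ∂(outcomeMeasure K v) :=
        lintegral_mono fun ω => Finset.sum_le_sum fun t _ =>
          ENNReal.ofReal_le_ofReal (instantRegret_le hU hr v ω t)
    _ = _ := by
        simp [mul_comm]

theorem ofReal_instantRegret_le {γ₁ γ₂ : ℝ} (hU : QuasiconvexRisk U)
    (hbdd : BoundedRisk U γ₁)
    (hr : ∀ i, 0 < r i ∧ r i ≤ 1) (hlip : OneSidedLipschitzRisk U r γ₂)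
    (hsel : ∀ w, IsSmallestOptimal U r K w (sel w)) (v : Fin N → ℝ≥0)
    {A : Finset (Fin N)} (hA : U (profitCDF r A v) = optimalValue U r K v) (L : ℝ) (m : ℕ)
    (ω : Outcome N K) {t : ℕ} (ht : t ≤ T) :
    ENNReal.ofReal (instantRegret U r v K T pick sel ω t) ≤
      ENNReal.ofReal (2 * |γ₁|) *
        ({ω : Outcome N K | ∃ i, (tsState T pick sel ω t).served i = 0}.indicator 1 ω +
          {ω : Outcome N K | UpperDeviation v L (tsState T pick sel ω t)}.indicator 1 ω +
          {ω : Outcome N K | ∃ t ≤ T, LowerDeviation K T v A m (tsState T pick sel ω t)}.indicator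
            1 ω) +
      shortfall U r K T sel v A L m (tsState T pick sel ω t) (sampleAt T pick sel ω t) +
      excess γ₂ K T v A L m (tsState T pick sel ω t) (sampleAt T pick sel ω t) * ENNReal.ofReal
          (1 / (1 + ∑ i ∈ (tsState T pick sel ω t).assortment, (v i : ℝ))) := by
  by_cases hg : GoodState K T v A L m (tsState T pick sel ω t)
  · rw [add_assoc]
    refine le_trans ?_ le_add_self
    have hV0 : (0 : ℝ) ≤ ∑ i ∈ (tsState T pick sel ω t).assortment, (v i : ℝ) :=
      Finset.sum_nonneg fun i _ => (v i).2
    rw [shortfall, if_pos hg, excess, if_pos hg, ← ENNReal.ofReal_mul (by positivity)]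
    refine le_trans (ENNReal.ofReal_le_ofReal ?_) ENNReal.ofReal_add_le
    have h := (hsel (virtualPref K T (tsState T pick sel ω t).served
      (tsState T pick sel ω t).bought (sampleAt T pick sel ω t))).sub_le hU hr hlip v
    rw [← hg.assortment_eq] at h
    have h' : |γ₂| / (1 + ∑ i ∈ (tsState T pick sel ω t).assortment, (v i : ℝ)) *
        ∑ i ∈ (tsState T pick sel ω t).assortment, max (virtualPref K T
          (tsState T pick sel ω t).served (tsState T pick sel ω t).bought
          (sampleAt T pick sel ω t) i - v i) 0 = |γ₂| *
        (∑ i ∈ (tsState T pick sel ω t).assortment, max (virtualPref K T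
          (tsState T pick sel ω t).served (tsState T pick sel ω t).bought
          (sampleAt T pick sel ω t) i - v i) 0) *
        (1 / (1 + ∑ i ∈ (tsState T pick sel ω t).assortment, (v i : ℝ))) := by ring
    rw [h'] at h
    rw [instantRegret, ← hA, virtualValue, ← hg.assortment_eq]
    linarith
  · rw [add_assoc]
    refine le_trans ?_ le_self_add
    have h1 := ENNReal.ofReal_le_ofReal (instantRegret_le (K := K) (T := T) (pick := pick)
      (sel := sel) hbdd hr v ω t)
    refine h1.trans ?_
    conv_lhs => rw [← mul_one (ENNReal.ofReal (2 * |γ₁|))]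
    refine mul_le_mul' le_rfl ?_
    by_cases h2 : ∃ i, (tsState T pick sel ω t).served i = 0
    · rw [Set.indicator_of_mem (show ω ∈ {ω : Outcome N K |
        ∃ i, (tsState T pick sel ω t).served i = 0} from h2), add_assoc]
      exact le_self_add
    by_cases h3 : UpperDeviation v L (tsState T pick sel ω t)
    · rw [Set.indicator_of_mem (show ω ∈ {ω : Outcome N K |
        UpperDeviation v L (tsState T pick sel ω t)} from h3), add_right_comm]
      exact le_add_self
    have h4 : LowerDeviation K T v A m (tsState T pick sel ω t) := by
      by_contra h4
      exact hg ⟨fun i hi => h2 ⟨i, hi⟩, h3, h4⟩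
    rw [Set.indicator_of_mem (show ω ∈ {ω : Outcome N K |
      ∃ t ≤ T, LowerDeviation K T v A m (tsState T pick sel ω t)} from ⟨t, ht, h4⟩)]
    exact le_add_self

/-- The parameters stay free: `p` and `q` bound the probabilities of upper and lower deviations, and
`Ξ` and `Υ` the expectations of `optimismFactor` and `sampleFactor`. -/
theorem tsRegret_le {γ₁ γ₂ : ℝ} (hK : 1 ≤ K) (hKN : K ≤ N) (hU : QuasiconvexRisk U)
    (hbdd : BoundedRisk U γ₁)
    (hr : ∀ i, 0 < r i ∧ r i ≤ 1) (hlip : OneSidedLipschitzRisk U r γ₂)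
    (hpick : ∀ A : Finset (Fin N), A.Nonempty → pick A ∈ A)
    (hsel : ∀ w, IsSmallestOptimal U r K w (sel w)) (hselm : ∀ S, MeasurableSet {w | sel w = S})
    {v : Fin N → ℝ≥0} (hv : ∀ i, v i ≤ 1) {L : ℝ} (hL : 1 ≤ L)
    (hTK : 1 ≤ 75 * √(Real.log (T * K))) {m : ℕ} (hm : (m : ℝ) ≤ Real.log (T * K))
    {b : ℝ} (hb : 0 ≤ b) {p q Ξ Υ : ℝ}
    (hp : N * T * Real.exp (-L) ≤ p)
    (hq : K * (Nat.log 2 T + 1) * Real.exp (-(5 * m)) ≤ q)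
    (hΞ : optimismCost K 0 ^ 2 * (1 + ∑ k ∈ Finset.range m, Real.exp (3 * (k + 1)) *
        (K * (Nat.log 2 T + 1) * Real.exp (-(5 * k)))) ≤ Ξ)
    (hΥ : (1 + b) ^ 2 + (T + 1) * K * (2 * Real.exp (2 - b)) ≤ Υ) :
    tsRegret U r v K T pick sel ≤ 2 * |γ₁| * (2 * N + T * p + T * q) +
      |γ₂| * widthBound N K T L / 2 * (Ξ + Υ) + |γ₂| * widthBound N K T L * (5 * L + Υ) := by
  obtain ⟨A, hAK, hA⟩ := exists_eq_optimalValue U r K v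
  set μ := outcomeMeasure K v with hμ
  have hB : 0 ≤ widthBound N K T L := by
    have := Real.log_natCast_nonneg T
    unfold widthBound
    positivity
  have hp0 : 0 ≤ p := le_trans (by positivity) hp
  have hq0 : 0 ≤ q := le_trans (by positivity) hq
  have hΞ0 : 0 ≤ Ξ := le_trans (by positivity) hΞ
  have hΥ0 : 0 ≤ Υ := le_trans (by positivity) hΥ
  refine tsRegret_le_of_lintegral_le hK hbdd hr hsel hselm v (by positivity) ?_
  set E₀ : ℕ → Set (Outcome N K) := fun t => {ω | ∃ i, (tsState T pick sel ω t).served i = 0}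
    with hE₀
  set E₁ : ℕ → Set (Outcome N K) := fun t => {ω | UpperDeviation v L (tsState T pick sel ω t)}
    with hE₁
  set E₂ : Set (Outcome N K) :=
    {ω | ∃ t ≤ T, LowerDeviation K T v A m (tsState T pick sel ω t)} with hE₂
  have hE₀m : ∀ t, MeasurableSet (E₀ t) := fun t => measurable_tsState hselm t
    (MeasurableSet.of_discrete (s := {s : TSState N | ∃ i, s.served i = 0}))
  have hE₁m : ∀ t, MeasurableSet (E₁ t) := fun t => measurable_tsState hselm t
    (MeasurableSet.of_discrete (s := {s : TSState N | UpperDeviation v L s}))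
  have hE₂m : MeasurableSet E₂ := by
    have : E₂ = ⋃ t ∈ Set.Iic T, {ω | LowerDeviation K T v A m (tsState T pick sel ω t)} := by
      ext ω; simp [hE₂]
    rw [this]
    exact MeasurableSet.biUnion (Set.to_countable _) fun t _ => measurable_tsState hselm t
      (MeasurableSet.of_discrete (s := {s : TSState N | LowerDeviation K T v A m s}))
  have hind : ∀ {E : Set (Outcome N K)}, MeasurableSet E →
      Measurable (E.indicator (1 : Outcome N K → ℝ≥0∞)) := fun hE => measurable_one.indicator hE
  have hsm : ∀ t, Measurable fun ω : Outcome N K => shortfall U r K T sel v A L m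
      (tsState T pick sel ω t) (sampleAt T pick sel ω t) := fun t =>
    measurable_comp_state_sample hselm (measurable_shortfall hK hU hr hsel v A L m) t
  have hstep : ∀ t ∈ Finset.range T,
      ∫⁻ ω, ENNReal.ofReal (instantRegret U r v K T pick sel ω t) ∂μ ≤
      ENNReal.ofReal (2 * |γ₁|) * (μ (E₀ t) + ENNReal.ofReal p + ENNReal.ofReal q) +
      ∫⁻ ω, shortfall U r K T sel v A L m
        (tsState T pick sel ω t) (sampleAt T pick sel ω t) ∂μ +
      ∫⁻ ω, excess γ₂ K T v A L m (tsState T pick sel ω t) (sampleAt T pick sel ω t) *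
        ENNReal.ofReal (1 / (1 + ∑ i ∈ (tsState T pick sel ω t).assortment, (v i : ℝ))) ∂μ := by
    intro t ht
    have htT := Finset.mem_range.1 ht
    refine (lintegral_mono fun ω => ofReal_instantRegret_le hU hbdd hr hlip hsel v hA L m ω
      htT.le).trans ?_
    have m1 : Measurable fun ω => (E₀ t).indicator (1 : Outcome N K → ℝ≥0∞) ω +
        (E₁ t).indicator 1 ω := (hind (hE₀m t)).add (hind (hE₁m t))
    have m2 : Measurable fun ω => (E₀ t).indicator (1 : Outcome N K → ℝ≥0∞) ω +
        (E₁ t).indicator 1 ω + E₂.indicator 1 ω := m1.add (hind hE₂m)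
    have m3 : Measurable fun ω => ENNReal.ofReal (2 * |γ₁|) *
        ((E₀ t).indicator (1 : Outcome N K → ℝ≥0∞) ω + (E₁ t).indicator 1 ω + E₂.indicator 1 ω) :=
      m2.const_mul _
    have m4 : Measurable fun ω => ENNReal.ofReal (2 * |γ₁|) *
        ((E₀ t).indicator (1 : Outcome N K → ℝ≥0∞) ω + (E₁ t).indicator 1 ω + E₂.indicator 1 ω) +
        shortfall U r K T sel v A L m (tsState T pick sel ω t) (sampleAt T pick sel ω t) :=
      m3.add (hsm t)
    rw [lintegral_add_left m4, lintegral_add_left m3,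
      lintegral_const_mul _ m2, lintegral_add_left m1, lintegral_add_left (hind (hE₀m t)),
      lintegral_indicator_one (hE₀m t), lintegral_indicator_one (hE₁m t),
      lintegral_indicator_one hE₂m]
    have hu : μ (E₁ t) ≤ ENNReal.ofReal p := by
      refine (measure_upperDeviation_le hselm hv hL t).trans (ENNReal.ofReal_le_ofReal ?_)
      refine le_trans ?_ hp
      have : ((t : ℝ) + 1) ≤ T := by exact_mod_cast htT
      gcongr
    have hl : μ E₂ ≤ ENNReal.ofReal q :=
      (measure_exists_lowerDeviation_le hselm hK hv hAK hm).trans (ENNReal.ofReal_le_ofReal hq)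
    gcongr
  have hΥi : ∫⁻ ω, ENNReal.ofReal (sampleFactor T b ω) ∂μ ≤ ENNReal.ofReal Υ := by
    rw [hμ, lintegral_sampleFactor]
    exact ENNReal.ofReal_le_ofReal hΥ
  have hΞi : ∫⁻ ω, ENNReal.ofReal (optimismFactor T pick sel v A m ω) ∂μ ≤ ENNReal.ofReal Ξ :=
    (lintegral_optimismFactor_le hselm hK hv hAK hm).trans (ENNReal.ofReal_le_ofReal hΞ)
  have hshort : ∑ t ∈ Finset.range T, ∫⁻ ω, shortfall U r K T sel v A L m
        (tsState T pick sel ω t) (sampleAt T pick sel ω t) ∂μ ≤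
      ENNReal.ofReal (|γ₂| * widthBound N K T L / 2 * (Ξ + Υ)) := by
    refine (sum_lintegral_shortfall_le hK hKN hU hr hlip hsel hselm hv hAK hL m hb).trans ?_
    have hc : 0 ≤ |γ₂| * widthBound N K T L / 2 := by positivity
    have hm' : Measurable fun ω : Outcome N K => ENNReal.ofReal
        (optimismFactor T pick sel v A m ω + sampleFactor T b ω) := ENNReal.measurable_ofReal.comp
      ((measurable_optimismFactor hselm v A m).add (measurable_sampleFactor T b))
    simp only [ENNReal.ofReal_mul hc]
    rw [lintegral_const_mul _ hm']
    refine mul_le_mul' le_rfl ?_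
    rw [ENNReal.ofReal_add hΞ0 hΥ0]
    refine (lintegral_mono fun ω => ENNReal.ofReal_add_le).trans ?_
    rw [lintegral_add_left (measurable_optimismFactor hselm v A m).ennreal_ofReal]
    exact add_le_add hΞi hΥi
  have hexc : ∑ t ∈ Finset.range T, ∫⁻ ω, excess γ₂ K T v A L m (tsState T pick sel ω t)
        (sampleAt T pick sel ω t) * ENNReal.ofReal
          (1 / (1 + ∑ i ∈ (tsState T pick sel ω t).assortment, (v i : ℝ))) ∂μ ≤
      ENNReal.ofReal (|γ₂| * widthBound N K T L * (5 * L + Υ)) := by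
    refine (sum_lintegral_excess_le hK γ₂ hselm hv A hL hTK m hb).trans ?_
    have hc : 0 ≤ |γ₂| * widthBound N K T L := by positivity
    have hm' : Measurable fun ω : Outcome N K => ENNReal.ofReal (5 * L + sampleFactor T b ω) :=
      ENNReal.measurable_ofReal.comp ((measurable_sampleFactor T b).const_add _)
    simp only [ENNReal.ofReal_mul hc]
    rw [lintegral_const_mul _ hm']
    refine mul_le_mul' le_rfl ?_
    rw [ENNReal.ofReal_add (by positivity) hΥ0]
    refine (lintegral_mono fun ω => ENNReal.ofReal_add_le).trans ?_
    rw [lintegral_add_left measurable_const, lintegral_const, measure_univ, mul_one]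
    exact add_le_add le_rfl hΥi
  have hmeas : ∀ t, Measurable fun ω : Outcome N K =>
      ENNReal.ofReal (instantRegret U r v K T pick sel ω t) := fun t =>
    measurable_comp_state hselm
      (fun s => ENNReal.ofReal (optimalValue U r K v - U (profitCDF r s.assortment v))) t
  rw [lintegral_finsetSum _ fun t _ => hmeas t]
  refine (Finset.sum_le_sum hstep).trans ?_
  rw [Finset.sum_add_distrib, Finset.sum_add_distrib, ← Finset.mul_sum,
    Finset.sum_add_distrib, Finset.sum_add_distrib, Finset.sum_const, Finset.sum_const,
    Finset.card_range, nsmul_eq_mul, nsmul_eq_mul,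
    ENNReal.ofReal_add (by positivity) (by positivity),
    ENNReal.ofReal_add (by positivity) (by positivity)]
  refine add_le_add (add_le_add ?_ hshort) hexc
  have h2N : ENNReal.ofReal (2 * N) = 2 * N := by
    rw [ENNReal.ofReal_mul zero_le_two, ENNReal.ofReal_natCast, ENNReal.ofReal_ofNat]
  rw [ENNReal.ofReal_mul (by positivity : 0 ≤ 2 * |γ₁|),
    ENNReal.ofReal_add (by positivity) (by positivity),
    ENNReal.ofReal_add (by positivity) (by positivity), ENNReal.ofReal_mul (Nat.cast_nonneg T),
    ENNReal.ofReal_mul (Nat.cast_nonneg T), ENNReal.ofReal_natCast, h2N]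
  gcongr
  exact sum_measure_unserved_le hpick hselm hv T

end

/-! ### Estimates of the constants -/

section

variable {N K T : ℕ}

theorem natLog_add_one_le (hN : 1 ≤ N) (hT : 1 ≤ T) :
    (Nat.log 2 T : ℝ) + 1 ≤ 2 * (1 + Real.log (N * T)) := by
  have hT' : (1 : ℝ) ≤ T := by exact_mod_cast hT
  have hN' : (1 : ℝ) ≤ N := by exact_mod_cast hN
  have h1 : (Nat.log 2 T : ℝ) * Real.log 2 ≤ Real.log T := by
    rw [← Real.log_pow]
    refine Real.log_le_log (by positivity) ?_
    exact_mod_cast Nat.pow_log_le_self 2 (by omega)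
  have h2 : Real.log T ≤ Real.log (N * T) :=
    Real.log_le_log (by positivity) (by nlinarith)
  have h3 := Real.log_two_gt_d9
  have h4 : (0 : ℝ) ≤ Nat.log 2 T := Nat.cast_nonneg _
  nlinarith

theorem mul_exp_neg_le (hT : 1 ≤ T) (hN : 1 ≤ N) :
    N * T * Real.exp (-(1 + 2 * Real.log (N * T))) ≤ 1 / T := by
  have hT' : (1 : ℝ) ≤ T := by exact_mod_cast hT
  have hN' : (1 : ℝ) ≤ N := by exact_mod_cast hN
  have hNT : (0 : ℝ) < N * T := by positivity
  have h1 : Real.exp (-(1 + 2 * Real.log (N * T))) ≤ ((N * T : ℝ) ^ 2)⁻¹ := by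
    rw [← Real.exp_log (pow_pos hNT 2), ← Real.exp_neg, Real.log_pow]
    refine Real.exp_le_exp.2 ?_
    push_cast
    linarith
  calc N * T * Real.exp (-(1 + 2 * Real.log (N * T))) ≤ N * T * ((N * T : ℝ) ^ 2)⁻¹ := by gcongr
    _ = 1 / (N * T) := by field_simp
    _ ≤ 1 / T := one_div_le_one_div_of_le (by positivity) (by nlinarith)

theorem mul_exp_neg_floor_le (hT : 1 ≤ T) (hK : 1 ≤ K) {J : ℝ} (hJ : 0 ≤ J) :
    K * J * Real.exp (-(5 * (⌊Real.log (T * K)⌋₊ : ℝ))) ≤ Real.exp 5 * J / T := by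
  have hT' : (1 : ℝ) ≤ T := by exact_mod_cast hT
  have hK' : (1 : ℝ) ≤ K := by exact_mod_cast hK
  have hTK : (0 : ℝ) < T * K := by positivity
  have h0 : 0 ≤ Real.log (T * K) := Real.log_nonneg (by nlinarith)
  have h1 := Nat.lt_floor_add_one (Real.log (T * K))
  have h2 : Real.exp (-(5 * (⌊Real.log (T * K)⌋₊ : ℝ))) ≤ Real.exp 5 * (T * K : ℝ)⁻¹ := by
    rw [← Real.exp_log hTK, ← Real.exp_neg, ← Real.exp_add, Real.log_exp]
    exact Real.exp_le_exp.2 (by linarith)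
  calc K * J * Real.exp (-(5 * (⌊Real.log (T * K)⌋₊ : ℝ)))
      ≤ K * J * (Real.exp 5 * (T * K : ℝ)⁻¹) := by gcongr
    _ = Real.exp 5 * J / T := by field_simp

/-- The growth `exp (3 k)` against the decay `exp (-5 k)` leaves a geometric series of ratio `exp
(-2)`; the factor `K` of the union bound is absorbed by `1 / K²`. -/
theorem optimismCost_sq_mul_le (hK : 1 ≤ K) {J : ℝ} (hJ : 0 ≤ J) (m : ℕ) :
    optimismCost K 0 ^ 2 * (1 + ∑ k ∈ Finset.range m, Real.exp (3 * (k + 1)) *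
        (K * J * Real.exp (-(5 * k)))) ≤
      (16 * Real.pi * Real.exp 5) ^ 2 * (1 + 2 * Real.exp 3 * J) := by
  have hK' : (1 : ℝ) ≤ K := by exact_mod_cast hK
  have h1 : ∑ k ∈ Finset.range m, Real.exp (3 * (k + 1)) * (K * J * Real.exp (-(5 * k))) =
      Real.exp 3 * (K * J) * ∑ k ∈ Finset.range m, Real.exp (-2) ^ k := by
    rw [Finset.mul_sum]
    refine Finset.sum_congr rfl fun k _ => ?_
    have e : Real.exp (3 * ((k : ℝ) + 1)) * Real.exp (-(5 * k)) =
        Real.exp 3 * Real.exp (k * (-2)) := by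
      rw [← Real.exp_add, ← Real.exp_add]
      ring_nf
    rw [← Real.exp_nat_mul]
    linear_combination K * J * e
  have h2 : ∑ k ∈ Finset.range m, Real.exp (-2) ^ k ≤ 2 := by
    have h3 : Real.exp (-2) ≤ 1 / 2 := by
      rw [Real.exp_neg, ← one_div]
      exact one_div_le_one_div_of_le two_pos (by linarith [Real.add_one_le_exp (2 : ℝ)])
    calc ∑ k ∈ Finset.range m, Real.exp (-2) ^ k ≤ ∑ k ∈ Finset.range m, (1 / 2 : ℝ) ^ k := by
          gcongr
      _ ≤ 2 := sum_geometric_two_le m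
  rw [h1, optimismCost, Nat.cast_zero, mul_zero, Real.exp_zero, mul_one, div_pow]
  have hc : 0 ≤ (16 * Real.pi * Real.exp 5) ^ 2 := by positivity
  rw [div_mul_eq_mul_div, div_le_iff₀ (by positivity), mul_assoc _ (1 + _)]
  refine mul_le_mul_of_nonneg_left ?_ hc
  have h4 : Real.exp 3 * (K * J) * ∑ k ∈ Finset.range m, Real.exp (-2) ^ k ≤
      Real.exp 3 * (K * J) * 2 := by gcongr
  have h5 : 0 ≤ Real.exp 3 * J := by positivity
  nlinarith [mul_nonneg h5 (mul_nonneg (by linarith : (0 : ℝ) ≤ K) (by linarith : (0 : ℝ) ≤ K - 1))]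

theorem sampleBound_le (hK : 1 ≤ K) (hKN : K ≤ N) (hT : 1 ≤ T) :
    (1 + Real.log (N * T)) ^ 2 + (T + 1) * K * (2 * Real.exp (2 - Real.log (N * T))) ≤
      (1 + 4 * Real.exp 2) * (1 + Real.log (N * T)) ^ 2 := by
  have hT' : (1 : ℝ) ≤ T := by exact_mod_cast hT
  have hKN' : (K : ℝ) ≤ N := by exact_mod_cast hKN
  have hN' : (1 : ℝ) ≤ N := by exact_mod_cast hK.trans hKN
  have hNT : (0 : ℝ) < N * T := by positivity
  have h0 : 0 ≤ Real.log (N * T) := Real.log_nonneg (by nlinarith)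
  have h1 : ((T : ℝ) + 1) * K * (2 * Real.exp (2 - Real.log (N * T))) ≤ 4 * Real.exp 2 := by
    rw [Real.exp_sub, Real.exp_log hNT]
    calc ((T : ℝ) + 1) * K * (2 * (Real.exp 2 / (N * T)))
        ≤ (T + T) * N * (2 * (Real.exp 2 / (N * T))) := by gcongr
      _ = 4 * Real.exp 2 := by field_simp; ring
  have h2 : 4 * Real.exp 2 ≤ 4 * Real.exp 2 * (1 + Real.log (N * T)) ^ 2 :=
    le_mul_of_one_le_right (by positivity) (one_le_pow₀ (by linarith))
  linarith

theorem widthBound_le (hK : 1 ≤ K) (hKN : K ≤ N) (hNT : N ≤ T) :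
    widthBound N K T (1 + 2 * Real.log (N * T)) ≤
      220 * (1 + Real.log (N * T)) ^ 2 * √(N * T) := by
  have hN' : (1 : ℝ) ≤ N := by exact_mod_cast hK.trans hKN
  have hK' : (1 : ℝ) ≤ K := by exact_mod_cast hK
  have hKN' : (K : ℝ) ≤ N := by exact_mod_cast hKN
  have hNT' : (N : ℝ) ≤ T := by exact_mod_cast hNT
  have hT' : (1 : ℝ) ≤ T := hN'.trans hNT'
  set x := Real.log (N * T) with hx
  have hx0 : 0 ≤ x := Real.log_nonneg (by nlinarith)
  have h1 : Real.log T ≤ x := Real.log_le_log (by positivity) (by nlinarith)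
  have h2 : √(600 * (1 + 2 * x)) ≤ 35 * (1 + x) := by
    refine Real.sqrt_le_iff.2 ⟨by positivity, ?_⟩
    nlinarith
  have h3 : (N : ℝ) ≤ √(N * T) := Real.le_sqrt_of_sq_le (by nlinarith)
  have h4 : √(Real.log (T * K)) ≤ 1 + x := by
    refine Real.sqrt_le_iff.2 ⟨by positivity, ?_⟩
    have : Real.log (T * K) ≤ x := Real.log_le_log (by positivity) (by nlinarith)
    nlinarith
  have h5 := Real.log_natCast_nonneg T
  unfold widthBound
  calc (2 + Real.log T) * (√(600 * (1 + 2 * x)) * √(N * T) + 75 * N * √(Real.log (T * K)))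
      ≤ (2 * (1 + x)) * (35 * (1 + x) * √(N * T) + 75 * √(N * T) * (1 + x)) := by
        gcongr
        linarith
    _ = _ := by ring

end

end MNLBandit

/-! ### Choice of the parameters and the final bound -/

theorem theorem2 :
    ∃ p : ℕ, ∀ γ₁ γ₂ : ℝ, ∃ C : ℝ,
      ∀ (N K T : ℕ) (_hK : 1 ≤ K) (_hKN : K ≤ N)
        (r : Fin N → ℝ) (_hr : ∀ i, 0 < r i ∧ r i ≤ 1)
        (v : Fin N → ℝ≥0) (_hv : ∀ i, v i ≤ 1)
        (U : (ℝ → ℝ) → ℝ)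
        (_hquasi : MNLBandit.QuasiconvexRisk U)
        (_hbdd : MNLBandit.BoundedRisk U γ₁)
        (_hlip : MNLBandit.OneSidedLipschitzRisk U r γ₂)
        (pick : Finset (Fin N) → Fin N)
        (_hpick : ∀ A : Finset (Fin N), A.Nonempty → pick A ∈ A)
        (sel : (Fin N → ℝ) → Finset (Fin N))
        (_hsel : ∀ w, MNLBandit.IsSmallestOptimal U r K w (sel w))
        (_hselmeas : ∀ S, MeasurableSet {w | sel w = S}),
        MNLBandit.tsRegret U r v K T pick sel ≤
          C * √((N : ℝ) * (T : ℝ)) * (1 + Real.log ((N : ℝ) * (T : ℝ))) ^ p := by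
  -- Two powers of the logarithm come from `widthBound` and two from the expected random factors.
  -- The constant adds up the bounds `h1`, `h2` and `h3` below.
  refine ⟨4, fun γ₁ γ₂ => ⟨2 * |γ₁| * (3 + 2 * Real.exp 5) + |γ₂| *
    (110 * ((16 * Real.pi * Real.exp 5) ^ 2 * (1 + 4 * Real.exp 3) + (1 + 4 * Real.exp 2)) +
      220 * (11 + 4 * Real.exp 2)), ?_⟩⟩
  intro N K T hK hKN r hr v hv U hquasi hbdd hlip pick hpick sel hsel hselm
  set x := Real.log ((N : ℝ) * T) with hx
  have hx0 : 0 ≤ x := by rw [hx, ← Nat.cast_mul]; exact Real.log_natCast_nonneg _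
  have hpow : ∀ {k : ℕ}, k ≤ 4 → (1 + x) ^ k ≤ (1 + x) ^ 4 := fun hk =>
    pow_le_pow_right₀ (by linarith) hk
  have hone : 1 ≤ (1 + x) ^ 4 := by simpa using hpow (Nat.zero_le 4)
  set Q := √((N : ℝ) * T) with hQ
  have hQ0 : 0 ≤ Q := Real.sqrt_nonneg _
  -- If `T ≤ N`, then `T ≤ √(N T)` and boundedness suffices. Otherwise `N ≤ √(N T)` absorbs the cost
  -- of exploration, and `T ≥ 2` keeps `log (T K)` away from `0`.
  rcases le_or_gt T N with hTN | hNT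
  · have hTN' : (T : ℝ) ≤ N := by exact_mod_cast hTN
    have hTQ : (T : ℝ) ≤ Q :=
      Real.le_sqrt_of_sq_le (by nlinarith [(Nat.cast_nonneg T : (0 : ℝ) ≤ T)])
    calc MNLBandit.tsRegret U r v K T pick sel ≤ 2 * |γ₁| * T :=
          MNLBandit.tsRegret_le_mul_horizon hK hbdd hr hsel hselm v
      _ ≤ 2 * |γ₁| * Q := by gcongr
      _ = 2 * |γ₁| * 1 * Q := by ring
      _ ≤ 2 * |γ₁| * (3 + 2 * Real.exp 5) * Q := by
          gcongr
          linarith [Real.exp_pos 5]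
      _ ≤ (2 * |γ₁| * (3 + 2 * Real.exp 5) + |γ₂| *
          (110 * ((16 * Real.pi * Real.exp 5) ^ 2 * (1 + 4 * Real.exp 3) + (1 + 4 * Real.exp 2)) +
          220 * (11 + 4 * Real.exp 2))) * Q := by
          gcongr
          exact le_add_of_nonneg_right (by positivity)
      _ ≤ _ := le_mul_of_one_le_right (by positivity) hone
  · have hT2 : 2 ≤ T := by omega
    have hT' : (2 : ℝ) ≤ T := by exact_mod_cast hT2
    have hK' : (1 : ℝ) ≤ K := by exact_mod_cast hK
    have hN' : (1 : ℝ) ≤ N := by exact_mod_cast hK.trans hKN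
    have hNT' : (N : ℝ) ≤ T := by exact_mod_cast hNT.le
    have hQN : (N : ℝ) ≤ Q := Real.le_sqrt_of_sq_le (by nlinarith)
    have hlog : Real.log 2 ≤ Real.log (T * K) := Real.log_le_log two_pos (by nlinarith)
    have hlog2 := Real.log_two_gt_d9
    have hTK : 1 ≤ 75 * √(Real.log (T * K)) := by
      have : (1 / 75 : ℝ) ≤ √(Real.log (T * K)) := Real.le_sqrt_of_sq_le (by norm_num; linarith)
      linarith
    set J : ℝ := (Nat.log 2 T : ℝ) + 1 with hJ
    have hJ0 : 0 ≤ J := by positivity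
    have hJx : J ≤ 2 * (1 + x) := MNLBandit.natLog_add_one_le (hK.trans hKN) (by omega)
    -- Here `L = 1 + 2 log (N T)` and `m = ⌊log (T K)⌋` make `p = 1 / T` and `q = exp 5 * J / T`,
    -- while `b = log (N T)` balances the two terms of `sampleFactor`.
    refine (MNLBandit.tsRegret_le hK hKN hquasi hbdd hr hlip hpick hsel hselm hv
      (L := 1 + 2 * x) (by linarith) hTK (Nat.floor_le (by linarith)) hx0
      (MNLBandit.mul_exp_neg_le (by omega) (hK.trans hKN))
      (MNLBandit.mul_exp_neg_floor_le (by omega) hK hJ0)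
      (MNLBandit.optimismCost_sq_mul_le hK hJ0 _)
      (MNLBandit.sampleBound_le hK hKN (by omega))).trans ?_
    have hB := MNLBandit.widthBound_le hK hKN hNT.le
    rw [← hx, ← hQ] at hB
    set c := (16 * Real.pi * Real.exp 5) ^ 2
    have hc : 0 ≤ c := by positivity
    have hy : 1 ≤ 1 + x := by linarith
    have hy2 : 1 + x ≤ (1 + x) ^ 2 := le_self_pow₀ hy two_ne_zero
    have h1 : 2 * |γ₁| * (2 * N + T * (1 / T) + T * (Real.exp 5 * J / T)) ≤
        2 * |γ₁| * (3 + 2 * Real.exp 5) * (Q * (1 + x) ^ 4) := by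
      have e1 : (T : ℝ) * (1 / T) = 1 := by field_simp
      have e2 : (T : ℝ) * (Real.exp 5 * J / T) = Real.exp 5 * J := by field_simp
      rw [e1, e2, mul_assoc (2 * |γ₁|)]
      have hQ1 : 1 ≤ Q := hN'.trans hQN
      have f1 : Q ≤ Q * (1 + x) ^ 4 := le_mul_of_one_le_right hQ0 hone
      have f2 : 1 + x ≤ Q * (1 + x) ^ 4 := by
        have := hpow (k := 1) (by norm_num)
        rw [pow_one] at this
        exact this.trans (le_mul_of_one_le_left (by positivity) hQ1)
      have f3 : Real.exp 5 * J ≤ Real.exp 5 * (2 * (Q * (1 + x) ^ 4)) := by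
        gcongr
        linarith
      have : 2 * (N : ℝ) + 1 + Real.exp 5 * J ≤ (3 + 2 * Real.exp 5) * (Q * (1 + x) ^ 4) := by
        linarith
      gcongr
    have hΞ : c * (1 + 2 * Real.exp 3 * J) ≤ c * (1 + 4 * Real.exp 3) * (1 + x) ^ 2 := by
      rw [mul_assoc c]
      refine mul_le_mul_of_nonneg_left ?_ hc
      have : 2 * Real.exp 3 * J ≤ 2 * Real.exp 3 * (2 * (1 + x) ^ 2) := by
        gcongr
        linarith
      linarith
    have h2 : |γ₂| * MNLBandit.widthBound N K T (1 + 2 * x) / 2 *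
        (c * (1 + 2 * Real.exp 3 * J) + (1 + 4 * Real.exp 2) * (1 + x) ^ 2) ≤
        |γ₂| * (110 * (c * (1 + 4 * Real.exp 3) + (1 + 4 * Real.exp 2))) * (Q * (1 + x) ^ 4) := by
      calc _ ≤ |γ₂| * (220 * (1 + x) ^ 2 * Q) / 2 *
            (c * (1 + 4 * Real.exp 3) * (1 + x) ^ 2 + (1 + 4 * Real.exp 2) * (1 + x) ^ 2) := by
            gcongr
        _ = _ := by ring
    have h3 : |γ₂| * MNLBandit.widthBound N K T (1 + 2 * x) *
        (5 * (1 + 2 * x) + (1 + 4 * Real.exp 2) * (1 + x) ^ 2) ≤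
        |γ₂| * (220 * (11 + 4 * Real.exp 2)) * (Q * (1 + x) ^ 4) := by
      calc _ ≤ |γ₂| * (220 * (1 + x) ^ 2 * Q) *
            (10 * (1 + x) ^ 2 + (1 + 4 * Real.exp 2) * (1 + x) ^ 2) := by
            have : 5 * (1 + 2 * x) ≤ 10 * (1 + x) ^ 2 := by linarith
            gcongr
        _ = _ := by ring
    linarith
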